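/- Let $p,q\ge 0$ with $0<p+q\le 1$ and let $\lambda,c>0$. A particle starts at the origin of the plane at time $0$, in one of the four directions $d_j=(\cos\frac{\pi j}{2},\sin\frac{\pi j}{2})$, $j\in\mathbb Z/4$, chosen uniformly, and moves with speed $c$. At the events of a Poisson process of rate $\lambda$ its direction changes, independently of everything else, from $d_j$ to $d_{j+1}$ with probability $p$, to $d_{j-1}$ with probability $q$, and to $d_{j+2}$ with probability $1-p-q$. Let $(X(t),Y(t))$ be its position at time $t$. A (jointly measurable) interior density is a function $u(x,y,t)\ge0$ which for every $t>0$ is the density of the law of $(X(t),Y(t))$ on $\{|x|+|y|<ct\}$, with the lines $x=0$ and $y=0$ removed if $p+q<1$. Put $$\begin{aligned}L_{\lambda,c}={}&\Big(\big(\tfrac{\partial}{\partial t}+\lambda\big)^2-c^2\tfrac{\partial^2}{\partial x^2}\Big)\Big(\big(\tfrac{\partial}{\partial t}+\lambda\big)^2-c^2\tfrac{\partial^2}{\partial y^2}\Big)-4\lambda^2pq\big(\tfrac{\partial}{\partial t}+\lambda\big)^2\\&-\lambda^2(1-p-q)^2\Big(2\big(\tfrac{\partial}{\partial t}+\lambda\big)^2-c^2\Delta\Big)-4\lambda^3(p^2+q^2)(1-p-q)\big(\tfrac{\partial}{\partial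 t}+\lambda\big)\\&+\lambda^4\big[(1-p-q)^2-2pq\big]^2-\lambda^4(p^2+q^2)^2,\end{aligned}$$ $$D(p,q)=\frac14\,\frac{(1-p)+(1-q)}{(1-p)^2+(1-q)^2},\qquad \Delta=\frac{\partial^2}{\partial x^2}+\frac{\partial^2}{\partial y^2}.$$ Let $\lambda_n,c_n>0$ with $\lambda_n\to\infty$, $c_n\to\infty$ and $c_n^2/\lambda_n\to1$, and let $(X_n,Y_n)$ be the motion with parameters $p,q,\lambda_n,c_n$. Then: 1. For every $n$, every interior density $u$ of $(X_n,Y_n)$ satisfies $L_{\lambda_n,c_n}u=0$ in the sense of distributions on $\{(x,y,t):|x|+|y|<c_nt\}$, with the points where $x=0$ or $y=0$ removed if $p+q<1$. 2. The equation $L_{\lambda_n,c_n}u=0$ becomes the heat equation $\frac{\partial u}{\partial t}=D(p,q)\,\Delta u$ in the limit, in the following two senses. (a) For every open $U\subseteq\mathbb R^3$ and every $u\in C^4(U)$, $$\lambda_n^{-3}L_{\lambda_n,c_n}u\;\longrightarrow\;4(p+q)\big((1-p)^2+(1-q)^2\big)\Big(\frac{\partial u}{\partial t}-D(p,q)\,\Delta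 u\Big)$$ locally uniformly on $U$, where the factor $4(p+q)((1-p)^2+(1-q)^2)$ is positive. (b) If $U\subseteq\mathbb R^3$ is open, $v_n\in L^1_{loc}(U)$ satisfies $L_{\lambda_n,c_n}v_n=0$ in the sense of distributions on $U$ for every $n$, and $v_n\to u\in L^1_{loc}(U)$ in the sense of distributions, then $\frac{\partial u}{\partial t}=D(p,q)\,\Delta u$ in the sense of distributions on $U$. 3. The finite-dimensional distributions of $(X_n(t),Y_n(t))_{t\ge0}$ converge weakly to those of $\sqrt{2D(p,q)}\,(B_1(t),B_2(t))_{t\ge0}$, where $B_1,B_2$ are independent standard Brownian motions. 4. $D(p,q)\le D(\tfrac12,\tfrac12)$, with equality if and only if $p=q=\tfrac12$. -/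

import Mathlib

open MeasureTheory ProbabilityTheory Filter Set Topology
open scoped NNReal

noncomputable section

/-! ### The random motion -/

/-- The data driving the motion on a probability space `(Ω, P)`: the initial direction `J`
(uniform on the four directions), the waiting times `τ k` between consecutive changes of direction
(i.i.d. exponential of rate `lam`, so that the changes occur at the events of a Poisson process of
rate `lam`), and the turns `ξ k` (i.i.d.; counter-clockwise `+1` with probability `p`, clockwise
`-1` with probability `q`, reversal `2` with probability `1 - p - q`); all of them independent. -/
structure IsTurningMotion {Ω : Type*} [MeasurableSpace Ω] (P : Measure Ω) (p q lam : ℝ)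
    (J : Ω → ZMod 4) (τ : ℕ → Ω → ℝ) (ξ : ℕ → Ω → ZMod 4) : Prop where
  measurable_initial : Measurable J
  measurable_wait : ∀ k, Measurable (τ k)
  measurable_turn : ∀ k, Measurable (ξ k)
  initial_uniform : ∀ j : ZMod 4, P.real {ω | J ω = j} = 1 / 4
  wait_law : ∀ k, P.map (τ k) = expMeasure lam
  turn_counterclockwise : ∀ k, P.real {ω | ξ k ω = 1} = p
  turn_clockwise : ∀ k, P.real {ω | ξ k ω = -1} = q
  turn_reversal : ∀ k, P.real {ω | ξ k ω = 2} = 1 - p - q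
  indep_wait_turn : ∀ k, IndepFun (τ k) (ξ k) P
  indep_steps : iIndepFun (fun k ω => (τ k ω, ξ k ω)) P
  indep_initial : IndepFun J (fun ω (k : ℕ) => (τ k ω, ξ k ω)) P

/-- `N(t)`: the number of changes of direction up to time `t`. -/
def numChanges {Ω : Type*} (τ : ℕ → Ω → ℝ) (t : ℝ) (ω : Ω) : ℕ :=
  {k : ℕ | ∑ i ∈ Finset.range (k + 1), τ i ω ≤ t}.ncard

/-- `D(t)`: the index (mod 4) of the direction at time `t`. -/
def direction {Ω : Type*} (J : Ω → ZMod 4) (τ : ℕ → Ω → ℝ) (ξ : ℕ → Ω → ZMod 4)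
    (t : ℝ) (ω : Ω) : ZMod 4 :=
  J ω + ∑ k ∈ Finset.range (numChanges τ t ω), ξ k ω

/-- `(X(t), Y(t))`: the particle starts at the origin and moves with speed `c` along
`d_j = (cos (π j / 2), sin (π j / 2))` while the direction index is `j`. -/
def position {Ω : Type*} (c : ℝ) (J : Ω → ZMod 4) (τ : ℕ → Ω → ℝ) (ξ : ℕ → Ω → ZMod 4)
    (t : ℝ) (ω : Ω) : ℝ × ℝ :=
  (c * ∫ s in (0 : ℝ)..t, Real.cos (Real.pi / 2 * ((direction J τ ξ s ω).val : ℝ)),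
   c * ∫ s in (0 : ℝ)..t, Real.sin (Real.pi / 2 * ((direction J τ ξ s ω).val : ℝ)))

/-! ### The interior density

Points of space-time are written `z = (x, y, t) : ℝ × ℝ × ℝ`. -/

/-- The space-time points `(x, y, t)` with `|x| + |y| < c t`; if reversals are possible, the two
diagonals `x = 0` and `y = 0` of the square are removed, as they carry a singular component. -/
def interiorRegion (p q c : ℝ) : Set (ℝ × ℝ × ℝ) :=
  {z | |z.1| + |z.2.1| < c * z.2.2 ∧ (p + q < 1 → z.1 ≠ 0 ∧ z.2.1 ≠ 0)}

/-- `u(·, ·, t)` is the probability density, inside the region, of the random vector `Z t`. -/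
structure IsInteriorDensity {Ω : Type*} [MeasurableSpace Ω] (P : Measure Ω) (p q c : ℝ)
    (Z : ℝ → Ω → ℝ × ℝ) (u : ℝ × ℝ × ℝ → ℝ) : Prop where
  measurable : Measurable u
  nonneg : ∀ z ∈ interiorRegion p q c, 0 ≤ u z
  density : ∀ t : ℝ, 0 < t → ∀ A : Set (ℝ × ℝ), MeasurableSet A →
    (∀ w ∈ A, (w.1, w.2, t) ∈ interiorRegion p q c) →
    P {ω | Z t ω ∈ A} = ∫⁻ w in A, ENNReal.ofReal (u (w.1, w.2, t))

/-! ### The differential operators -/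

/-- `∂/∂x`. -/
def dX (u : ℝ × ℝ × ℝ → ℝ) : ℝ × ℝ × ℝ → ℝ := fun z => fderiv ℝ u z (1, 0, 0)

/-- `∂/∂y`. -/
def dY (u : ℝ × ℝ × ℝ → ℝ) : ℝ × ℝ × ℝ → ℝ := fun z => fderiv ℝ u z (0, 1, 0)

/-- `∂/∂t`. -/
def dT (u : ℝ × ℝ × ℝ → ℝ) : ℝ × ℝ × ℝ → ℝ := fun z => fderiv ℝ u z (0, 0, 1)

/-- The Laplacian in the space variables. -/
def laplacian (u : ℝ × ℝ × ℝ → ℝ) : ℝ × ℝ × ℝ → ℝ := dX (dX u) + dY (dY u)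

/-- The fourth-order operator, written in terms of an operator `T` which stands
for `∂/∂t + lam` (or for its formal transpose `-∂/∂t + lam`). -/
def fourthOrderOp (T : (ℝ × ℝ × ℝ → ℝ) → (ℝ × ℝ × ℝ → ℝ)) (p q lam c : ℝ)
    (u : ℝ × ℝ × ℝ → ℝ) : ℝ × ℝ × ℝ → ℝ :=
  (T (T (T (T u) - c ^ 2 • dY (dY u))) - c ^ 2 • dX (dX (T (T u) - c ^ 2 • dY (dY u))))
    - (4 * lam ^ 2 * p * q) • T (T u)
    - (lam ^ 2 * (1 - p - q) ^ 2) • ((2 : ℝ) • T (T u) - c ^ 2 • laplacian u)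
    - (4 * lam ^ 3 * (p ^ 2 + q ^ 2) * (1 - p - q)) • T u
    + (lam ^ 4 * ((1 - p - q) ^ 2 - 2 * p * q) ^ 2) • u
    - (lam ^ 4 * (p ^ 2 + q ^ 2) ^ 2) • u

/-- The operator of the fourth-order equation `motionOp p q lam c u = 0`. -/
def motionOp (p q lam c : ℝ) (u : ℝ × ℝ × ℝ → ℝ) : ℝ × ℝ × ℝ → ℝ :=
  fourthOrderOp (fun v => dT v + lam • v) p q lam c u

/-- The formal transpose of `motionOp`. -/
def motionOpTranspose (p q lam c : ℝ) (φ : ℝ × ℝ × ℝ → ℝ) : ℝ × ℝ × ℝ → ℝ :=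
  fourthOrderOp (fun v => -dT v + lam • v) p q lam c φ

/-- The operator of the heat equation `∂u/∂t = D Δu`. -/
def heatOp (D : ℝ) (u : ℝ × ℝ × ℝ → ℝ) : ℝ × ℝ × ℝ → ℝ := dT u - D • laplacian u

/-- The formal transpose of `heatOp`. -/
def heatOpTranspose (D : ℝ) (φ : ℝ × ℝ × ℝ → ℝ) : ℝ × ℝ × ℝ → ℝ := -dT φ - D • laplacian φ

/-- Smooth test functions with compact support in `U`. -/
def IsTestFunction (U : Set (ℝ × ℝ × ℝ)) (φ : ℝ × ℝ × ℝ → ℝ) : Prop :=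
  ContDiff ℝ ((⊤ : ℕ∞) : WithTop ℕ∞) φ ∧ HasCompactSupport φ ∧ tsupport φ ⊆ U

/-- `u` solves in the sense of distributions on `U` the linear equation whose operator has the
formal transpose `Lt`. -/
def IsWeakSolution (Lt : (ℝ × ℝ × ℝ → ℝ) → (ℝ × ℝ × ℝ → ℝ)) (U : Set (ℝ × ℝ × ℝ))
    (u : ℝ × ℝ × ℝ → ℝ) : Prop :=
  LocallyIntegrableOn u U ∧ ∀ φ, IsTestFunction U φ → ∫ z, u z * Lt φ z = 0

/-- The diffusion coefficient `(1/4) ((1-p) + (1-q)) / ((1-p)² + (1-q)²)`. -/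
def diffusionCoeff (p q : ℝ) : ℝ :=
  1 / 4 * (((1 - p) + (1 - q)) / ((1 - p) ^ 2 + (1 - q) ^ 2))

end

/-!
The motion is a Markov process in the variables (direction, displacement): along a trajectory the
state changes deterministically between two changes of direction, and each change of direction adds
an independent turn after an independent exponential time. Everything about its law is derived from
Dynkin's formula `IsGeneratorPair.dynkin`: if `g` is the generator of the motion applied to a
bounded function `ψ` of direction, displacement and time, then `ψ - ∫ g` has constant expectation.
It is proved one step at a time: the expected contribution of a single step vanishes by the
exponential integral `exp_clock_identity`, and there are only finitely many steps before a
given time, almost surely.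

*The equation.* Dynkin's formula for `ψ = 1_{direction = i} φ`, with a test function `φ`, yields the
four forward equations (`IsTurningMotion.forward_equation`). They form a linear system
with a 4 × 4 matrix over the commutative algebra generated by `∂/∂x`, `∂/∂y`, `∂/∂t`; the
fourth-order operator is the determinant of this matrix, so the adjugate eliminates the
directions (`exists_elimination`) and leaves one equation for the sum of the four components, that
is, for the law of the position. Restricted to the interior region, this law has the density `u`
(`IsInteriorDensity.isWeakSolution`).

*The heat equation.* Divided by `lam ^ 3`, the operator is a sum of eight fixed differential
expressions whose coefficients are polynomials in `1 / lam` and `c ^ 2 / lam`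
(`fourthOrderOp_eq`). The multiples of `u` itself, of order `lam ^ 4`, cancel, and in the limit only
`∂u/∂t` and `Δu` survive. The same expansion, applied to test functions, passes weak
solutions to the limit.

*The finite-dimensional distributions.* By Lévy's theorem it is enough to follow the expectation of
`exp (i φ(t))`, where the phase `φ(t)` is a linear combination of the positions at the times
`min t (T i)`. Between two of the times `T i`, Dynkin's formula is applied to
`exp (i φ + κ t) ℓ`, with an amplitude `ℓ = 1 + i (c / lam) a + (c / lam) ^ 2 b` that depends on the
direction only. The corrector `a`, `b` (`exists_corrector`) is chosen such that the generator cancels up to an error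
that tends to zero, and this forces the rate `κ = (c ^ 2 / lam) D |Θ| ^ 2`, with the frequency `Θ`
given by the coefficients of the positions still in motion. Hence the expectation decays like the
characteristic function of the Brownian motion on each of the intervals
(`IsTurningMotion.norm_phaseMean_sub_le`), and an induction over the times `T i` concludes.
-/

noncomputable section

/-! ### The law of a single step -/

/-- The average of `f` over the direction after one turn, for a particle that moves in
direction `j`. -/
def turnMean (p q : ℝ) (f : ZMod 4 → ℂ) (j : ZMod 4) : ℂ :=
  p * f (j + 1) + q * f (j - 1) + (1 - p - q : ℝ) * f (j + 2)

theorem integral_expMeasure {lam : ℝ} (hl : 0 < lam) (F : ℝ → ℂ) :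
    ∫ x, F x ∂(expMeasure lam)
      = ∫ x in Ioi (0 : ℝ), (lam * Real.exp (-(lam * x)) : ℝ) • F x := by
  have h1 : expMeasure lam = volume.withDensity (exponentialPDF lam) := rfl
  have h2 : Measurable (exponentialPDF lam) :=
    (measurable_exponentialPDFReal lam).ennreal_ofReal
  rw [h1, integral_withDensity_eq_integral_toReal_smul h2
    (ae_of_all _ fun x => ENNReal.ofReal_lt_top), ← integral_Ici_eq_integral_Ioi,
    ← integral_indicator measurableSet_Ici]
  congr 1 with x
  by_cases hx : 0 ≤ x
  · rw [indicator_of_mem (by exact hx), exponentialPDF_of_nonneg hx,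
      ENNReal.toReal_ofReal (by positivity)]
  · rw [indicator_of_notMem (by exact hx), exponentialPDF_of_neg (not_le.mp hx)]
    simp

theorem integral_exp_density_Ioi {lam : ℝ} (hl : 0 < lam) (L : ℝ) :
    ∫ x in Ioi L, lam * Real.exp (-(lam * x)) = Real.exp (-(lam * L)) := by
  have h := integral_exp_mul_Ioi (a := -lam) (by linarith) L
  rw [integral_const_mul]
  simp only [neg_mul] at h
  rw [h]
  field_simp

theorem integrableOn_exp_density_Ioi {lam : ℝ} (hl : 0 < lam) (L : ℝ) :
    IntegrableOn (fun x => lam * Real.exp (-(lam * x))) (Ioi L) := by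
  have h := integrableOn_exp_mul_Ioi (a := -lam) (by linarith) L
  simp only [neg_mul] at h
  exact h.const_mul lam

/-- The expectation of a function of an exponential waiting time that is constant from `L` on. -/
theorem integral_expMeasure_ite {lam : ℝ} (hl : 0 < lam) {L : ℝ} (hL : 0 ≤ L) (H : ℝ → ℂ) (c : ℂ)
    (hH : IntervalIntegrable H volume 0 L) :
    ∫ x, (if L < x then c else H x) ∂(expMeasure lam)
      = (Real.exp (-(lam * L)) : ℝ) • c
        + ∫ x in (0 : ℝ)..L, (lam * Real.exp (-(lam * x)) : ℝ) • H x := by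
  rw [integral_expMeasure hl, ← Ioc_union_Ioi_eq_Ioi hL, setIntegral_union
    Ioc_disjoint_Ioi_same measurableSet_Ioi, intervalIntegral.integral_of_le hL, add_comm]
  · congr 1
    · rw [← integral_exp_density_Ioi hl L, ← integral_smul_const]
      exact setIntegral_congr_fun measurableSet_Ioi fun x hx => by simp [show L < x from hx]
    · exact setIntegral_congr_fun measurableSet_Ioc fun x hx => by simp [not_lt.mpr hx.2]
  · have : IntegrableOn (fun x => (lam * Real.exp (-(lam * x)) : ℝ) • H x) (Ioc 0 L) :=
      (intervalIntegrable_iff_integrableOn_Ioc_of_le hL).1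
        (hH.continuousOn_smul (Continuous.continuousOn (by fun_prop)))
    exact this.congr_fun (fun x hx => by simp [not_lt.mpr hx.2]) measurableSet_Ioc
  · have : IntegrableOn (fun x => (lam * Real.exp (-(lam * x)) : ℝ) • c) (Ioi L) :=
      (integrableOn_exp_density_Ioi hl L).smul_const c
    exact this.congr_fun (fun x hx => by simp [show L < x from hx]) measurableSet_Ioi

/-- The analytic form of Dynkin's formula up to the first change of direction: if
`A' = g - lam (Q - A)`, then `A a` is the expectation of `A b - ∫ g` or of `Q - ∫ g`, according to
whether the exponential clock started at time `a` rings after or before time `b`. -/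
theorem exp_clock_identity {lam a b : ℝ} (hab : a ≤ b) {A Q g : ℝ → ℂ} {s : Set ℝ}
    (hs : s.Countable) (hA : ContinuousOn A (Icc a b))
    (hd : ∀ x ∈ Ioo a b \ s, HasDerivAt A (g x - lam * (Q x - A x)) x)
    (hg : ∀ x ∈ Ioo a b \ s, ContinuousAt g x) (hgm : Measurable g)
    (hgi : IntervalIntegrable g volume a b) (hQ : IntervalIntegrable Q volume a b) :
    (Real.exp (-(lam * (b - a))) : ℝ) • (A b - ∫ r in a..b, g r)
      + ∫ x in a..b, (lam * Real.exp (-(lam * (x - a))) : ℝ) • (Q x - ∫ r in a..x, g r) = A a := by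
  have hGc : ContinuousOn (fun x => ∫ r in a..x, g r) (Icc a b) := by
    have := intervalIntegral.continuousOn_primitive_interval (μ := volume) (f := g) (a := a)
      (b := b) (by simpa [uIcc_of_le hab] using
        (intervalIntegrable_iff_integrableOn_Icc_of_le hab).1 hgi)
    simpa [uIcc_of_le hab] using this
  have hGi : IntervalIntegrable (fun x => ∫ r in a..x, g r) volume a b :=
    ContinuousOn.intervalIntegrable (by simpa [uIcc_of_le hab] using hGc)
  have key := integral_eq_of_hasDerivAt_off_countable_of_le
    (fun x => (Real.exp (-(lam * (x - a))) : ℝ) • (A x - ∫ r in a..x, g r))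
    (fun x => -((lam * Real.exp (-(lam * (x - a))) : ℝ) • (Q x - ∫ r in a..x, g r)))
    hab hs ?_ ?_ ?_
  · rw [intervalIntegral.integral_neg] at key
    simp only [sub_self, mul_zero, neg_zero, Real.exp_zero, one_smul,
      intervalIntegral.integral_same, sub_zero] at key
    linear_combination -key
  · have hE : ContinuousOn (fun x => Real.exp (-(lam * (x - a)))) (Icc a b) :=
      Continuous.continuousOn (by fun_prop)
    exact hE.smul (hA.sub hGc)
  · intro x hx
    have hxi : x ∈ Icc a b := ⟨hx.1.1.le, hx.1.2.le⟩
    have hG : HasDerivAt (fun x => ∫ r in a..x, g r) (g x) x :=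
      intervalIntegral.integral_hasDerivAt_right
        (hgi.mono_set (by rw [uIcc_of_le hab, uIcc_of_le hxi.1]; exact Icc_subset_Icc_right hxi.2))
        hgm.stronglyMeasurable.stronglyMeasurableAtFilter (hg x hx)
    have hE : HasDerivAt (fun x => Real.exp (-(lam * (x - a))))
        (Real.exp (-(lam * (x - a))) * (-(lam * 1))) x :=
      (((hasDerivAt_id x).sub_const a).const_mul lam).neg.exp
    refine (hE.smul ((hd x hx).sub hG)).congr_deriv ?_
    simp only [Complex.real_smul, Pi.sub_apply]
    push_cast
    ring
  · exact ((hQ.sub hGi).continuousOn_smul (Continuous.continuousOn (by fun_prop))).neg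

section StepLaw

variable {Ω : Type*} [MeasurableSpace Ω] {P : Measure Ω} [IsProbabilityMeasure P] {p q lam : ℝ}
  {J : Ω → ZMod 4} {τ : ℕ → Ω → ℝ} {ξ : ℕ → Ω → ZMod 4}

theorem IsTurningMotion.integral_turn (h : IsTurningMotion P p q lam J τ ξ) (k : ℕ)
    (f : ZMod 4 → ℂ) (j : ZMod 4) :
    ∫ m, f (j + m) ∂(P.map (ξ k)) = turnMean p q f j := by
  have hm := h.measurable_turn k
  have : IsProbabilityMeasure (P.map (ξ k)) := Measure.isProbabilityMeasure_map hm.aemeasurable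
  have hr : ∀ m : ZMod 4, (P.map (ξ k)).real {m} = P.real {ω | ξ k ω = m} := fun m => by
    rw [map_measureReal_apply hm (measurableSet_singleton m)]; rfl
  have h3 : (3 : ZMod 4) = -1 := by decide
  have hu : (Finset.univ : Finset (ZMod 4)) = {0, 1, 2, 3} := by decide
  have h1 := h.turn_counterclockwise k
  have h2 := h.turn_reversal k
  have h4 := h.turn_clockwise k
  have htot : ∑ m : ZMod 4, (P.map (ξ k)).real {m} = 1 := by
    simp
  have hsum : ∀ F : ZMod 4 → ℂ, ∑ m, F m = F 0 + (F 1 + (F 2 + F 3)) := fun F => by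
    rw [hu, Finset.sum_insert (by decide), Finset.sum_insert (by decide),
      Finset.sum_insert (by decide), Finset.sum_singleton]
  have hsum' : ∀ F : ZMod 4 → ℝ, ∑ m, F m = F 0 + (F 1 + (F 2 + F 3)) := fun F => by
    rw [hu, Finset.sum_insert (by decide), Finset.sum_insert (by decide),
      Finset.sum_insert (by decide), Finset.sum_singleton]
  rw [hsum'] at htot
  simp only [hr] at htot
  rw [h3, h1, h2, h4] at htot
  have h0 : P.real {ω | ξ k ω = 0} = 0 := by linarith
  rw [integral_fintype (Integrable.of_finite), hsum]
  simp only [hr]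
  rw [h0, h3, h1, h2, h4, turnMean]
  simp only [Complex.real_smul, sub_eq_add_neg]
  push_cast
  ring

theorem IsTurningMotion.map_step (h : IsTurningMotion P p q lam J τ ξ) (k : ℕ) :
    P.map (fun ω => (τ k ω, ξ k ω)) = (expMeasure lam).prod (P.map (ξ k)) := by
  rw [(indepFun_iff_map_prod_eq_prod_map_map (h.measurable_wait k).aemeasurable
    (h.measurable_turn k).aemeasurable).1 (h.indep_wait_turn k), h.wait_law k]

end StepLaw

/-! ### Trajectories as functions of the driving sequence -/

section Trajectory

variable {V : Type*} [NormedAddCommGroup V]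

/-- The time of the `k`-th change of direction, as a function of the sequence of pairs
(waiting time, turn). -/
def jumpTime (σ : ℕ → ℝ × ZMod 4) (k : ℕ) : ℝ := ∑ i ∈ Finset.range k, (σ i).1

/-- The displacement at time `r` of a particle that is in the state `x = (j, t, w)`, that is, at
the place `w` with direction `j` at time `t`, and keeps its direction. The displacements are
measured by a function `B`, with `B j r - B j t` the displacement in direction `j` from time `t`
to time `r`. -/
def flow (B : ZMod 4 → ℝ → V) (x : ZMod 4 × ℝ × V) (r : ℝ) : V :=
  x.2.2 - B x.1 x.2.1 + B x.1 r

/-- The state (direction, time, displacement) just after the `k`-th change of direction. -/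
def jumpState (B : ZMod 4 → ℝ → V) (j₀ : ZMod 4) (σ : ℕ → ℝ × ZMod 4) : ℕ → ZMod 4 × ℝ × V
  | 0 => (j₀, 0, 0)
  | k + 1 =>
    ((jumpState B j₀ σ k).1 + (σ k).2, (jumpState B j₀ σ k).2.1 + (σ k).1,
      flow B (jumpState B j₀ σ k) ((jumpState B j₀ σ k).2.1 + (σ k).1))

open Classical in
/-- The number of changes of direction up to time `t`: the first `m` such that the change number
`m + 1` happens after time `t`, and `0` if there is none. -/
def jumpCount (σ : ℕ → ℝ × ZMod 4) (t : ℝ) : ℕ :=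
  Nat.find (p := fun m => t < jumpTime σ (m + 1) ∨ ∀ k, ¬ t < jumpTime σ (k + 1)) (by
    by_cases h : ∃ k, t < jumpTime σ (k + 1)
    · exact h.imp fun k hk => Or.inl hk
    · exact ⟨0, Or.inr (not_exists.mp h)⟩)

/-- The pair (direction, displacement) at time `t`. -/
def stateAt (B : ZMod 4 → ℝ → V) (j₀ : ZMod 4) (σ : ℕ → ℝ × ZMod 4) (t : ℝ) : ZMod 4 × V :=
  ((jumpState B j₀ σ (jumpCount σ t)).1, flow B (jumpState B j₀ σ (jumpCount σ t)) t)

/-- The waiting times are positive and the changes of direction do not accumulate. -/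
def IsNonexplosive (σ : ℕ → ℝ × ZMod 4) : Prop :=
  (∀ i, 0 < (σ i).1) ∧ ∀ M : ℝ, ∃ k, M < jumpTime σ k

theorem jumpTime_succ (σ : ℕ → ℝ × ZMod 4) (k : ℕ) :
    jumpTime σ (k + 1) = jumpTime σ k + (σ k).1 :=
  Finset.sum_range_succ _ _

theorem jumpState_time (B : ZMod 4 → ℝ → V) (j₀ : ZMod 4) (σ : ℕ → ℝ × ZMod 4) (k : ℕ) :
    (jumpState B j₀ σ k).2.1 = jumpTime σ k := by
  induction k with
  | zero => simp [jumpState, jumpTime]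
  | succ k ih => rw [jumpTime_succ, ← ih]; rfl

theorem jumpState_direction (B : ZMod 4 → ℝ → V) (j₀ : ZMod 4) (σ : ℕ → ℝ × ZMod 4) (k : ℕ) :
    (jumpState B j₀ σ k).1 = j₀ + ∑ i ∈ Finset.range k, (σ i).2 := by
  induction k with
  | zero => simp [jumpState]
  | succ k ih => rw [Finset.sum_range_succ, ← add_assoc, ← ih]; rfl

theorem jumpState_congr (B : ZMod 4 → ℝ → V) (j₀ : ZMod 4) {σ σ' : ℕ → ℝ × ZMod 4} {k : ℕ}
    (h : ∀ i < k, σ i = σ' i) : jumpState B j₀ σ k = jumpState B j₀ σ' k := by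
  induction k with
  | zero => rfl
  | succ k ih =>
    simp only [jumpState, ih fun i hi => h i (hi.trans k.lt_succ_self), h k k.lt_succ_self]

namespace IsNonexplosive

variable {σ : ℕ → ℝ × ZMod 4}

theorem strictMono (h : IsNonexplosive σ) : StrictMono (jumpTime σ) :=
  strictMono_nat_of_lt_succ fun k => by rw [jumpTime_succ]; linarith [h.1 k]

theorem jumpTime_nonneg (h : IsNonexplosive σ) (k : ℕ) : 0 ≤ jumpTime σ k :=
  Finset.sum_nonneg fun i _ => (h.1 i).le

theorem jumpCount_eq (h : IsNonexplosive σ) {t : ℝ} {k : ℕ} (h1 : jumpTime σ k ≤ t)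
    (h2 : t < jumpTime σ (k + 1)) : jumpCount σ t = k := by
  classical
  rw [jumpCount, Nat.find_eq_iff]
  refine ⟨Or.inl h2, fun m hm => ?_⟩
  rw [not_or]
  exact ⟨not_lt.mpr ((h.strictMono.monotone hm).trans h1), fun hk => hk k h2⟩

theorem exists_jumpTime (h : IsNonexplosive σ) {t : ℝ} (ht : 0 ≤ t) :
    ∃ k, jumpTime σ k ≤ t ∧ t < jumpTime σ (k + 1) := by
  classical
  have hne : ∃ k, t < jumpTime σ (k + 1) := by
    obtain ⟨k, hk⟩ := h.2 t
    exact ⟨k, hk.trans (h.strictMono k.lt_succ_self)⟩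
  refine ⟨Nat.find hne, ?_, Nat.find_spec hne⟩
  rcases hn : Nat.find hne with _ | m
  · simpa [jumpTime] using ht
  · exact not_lt.mp (Nat.find_min hne (by rw [hn]; exact m.lt_succ_self))

theorem stateAt_eq (h : IsNonexplosive σ) (B : ZMod 4 → ℝ → V) (j₀ : ZMod 4) {t : ℝ} {k : ℕ}
    (h1 : jumpTime σ k ≤ t) (h2 : t < jumpTime σ (k + 1)) :
    stateAt B j₀ σ t = ((jumpState B j₀ σ k).1, flow B (jumpState B j₀ σ k) t) := by
  rw [stateAt, h.jumpCount_eq h1 h2]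

end IsNonexplosive

variable [MeasurableSpace V] [BorelSpace V] [SecondCountableTopology V]

theorem measurable_jumpTime (k : ℕ) : Measurable fun σ : ℕ → ℝ × ZMod 4 => jumpTime σ k :=
  Finset.measurable_fun_sum _ fun i _ => (measurable_pi_apply i).fst

theorem measurable_jumpCount :
    Measurable fun z : (ℕ → ℝ × ZMod 4) × ℝ => jumpCount z.1 z.2 := by
  classical
  have hlt : ∀ m, MeasurableSet {z : (ℕ → ℝ × ZMod 4) × ℝ | z.2 < jumpTime z.1 (m + 1)} :=
    fun m => measurableSet_lt measurable_snd ((measurable_jumpTime (m + 1)).comp measurable_fst)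
  refine measurable_find _ fun m => (hlt m).union ?_
  have : {z : (ℕ → ℝ × ZMod 4) × ℝ | ∀ k, ¬ z.2 < jumpTime z.1 (k + 1)}
      = ⋂ k, {z : (ℕ → ℝ × ZMod 4) × ℝ | z.2 < jumpTime z.1 (k + 1)}ᶜ := by
    ext z; simp
  have h' := MeasurableSet.iInter fun k => (hlt k).compl
  rw [← this] at h'
  exact h'

variable {B : ZMod 4 → ℝ → V}

theorem measurable_flow (hB : ∀ j, Measurable (B j)) :
    Measurable fun z : (ZMod 4 × ℝ × V) × ℝ => flow B z.1 z.2 := by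
  have hB' : Measurable fun z : ZMod 4 × ℝ => B z.1 z.2 := measurable_from_prod_countable_right hB
  unfold flow
  exact (measurable_fst.snd.snd.sub
    (hB'.comp (measurable_fst.fst.prodMk measurable_fst.snd.fst))).add
    (hB'.comp (measurable_fst.fst.prodMk measurable_snd))

theorem measurable_jumpState (hB : ∀ j, Measurable (B j)) (k : ℕ) :
    Measurable fun z : ZMod 4 × (ℕ → ℝ × ZMod 4) => jumpState B z.1 z.2 k := by
  induction k with
  | zero => exact measurable_fst.prodMk measurable_const
  | succ k ih =>
    have hs : Measurable fun z : ZMod 4 × (ℕ → ℝ × ZMod 4) => z.2 k :=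
      (measurable_pi_apply k).comp measurable_snd
    exact (ih.fst.add hs.snd).prodMk ((ih.snd.fst.add hs.fst).prodMk
      ((measurable_flow hB).comp (ih.prodMk (ih.snd.fst.add hs.fst))))

theorem measurable_stateAt (hB : ∀ j, Measurable (B j)) :
    Measurable fun z : (ZMod 4 × (ℕ → ℝ × ZMod 4)) × ℝ => stateAt B z.1.1 z.1.2 z.2 := by
  have h1 : Measurable fun z : ℕ × (ZMod 4 × (ℕ → ℝ × ZMod 4)) => jumpState B z.2.1 z.2.2 z.1 :=
    measurable_from_prod_countable_right fun k => measurable_jumpState hB k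
  have h2 : Measurable fun z : (ZMod 4 × (ℕ → ℝ × ZMod 4)) × ℝ => jumpCount z.1.2 z.2 :=
    measurable_jumpCount.comp (measurable_fst.snd.prodMk measurable_snd)
  have h3 := h1.comp (h2.prodMk measurable_fst)
  exact h3.fst.prodMk ((measurable_flow hB).comp (h3.prodMk measurable_snd))

end Trajectory

section Independence

variable {Ω : Type*} [MeasurableSpace Ω] {P : Measure Ω} {p q lam : ℝ}
  {J : Ω → ZMod 4} {τ : ℕ → Ω → ℝ} {ξ : ℕ → Ω → ZMod 4}

theorem IsTurningMotion.measurable_step (h : IsTurningMotion P p q lam J τ ξ) (k : ℕ) :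
    Measurable fun ω => (τ k ω, ξ k ω) :=
  (h.measurable_wait k).prodMk (h.measurable_turn k)

theorem IsTurningMotion.measurable_steps (h : IsTurningMotion P p q lam J τ ξ) :
    Measurable fun ω k => (τ k ω, ξ k ω) :=
  measurable_pi_lambda _ fun k => h.measurable_step k

variable [IsProbabilityMeasure P]

/-- A quantity that depends on the initial direction and the first `k` steps is independent of the
next step. -/
theorem IsTurningMotion.indepFun_step (h : IsTurningMotion P p q lam J τ ξ) (k : ℕ)
    {β : Type*} [MeasurableSpace β] {f : ZMod 4 × (ℕ → ℝ × ZMod 4) → β} (hf : Measurable f)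
    (hfk : ∀ j σ σ', (∀ i < k, σ i = σ' i) → f (j, σ) = f (j, σ')) :
    IndepFun (fun ω => f (J ω, fun i => (τ i ω, ξ i ω))) (fun ω => (τ k ω, ξ k ω)) P := by
  have hJ := h.measurable_initial
  have hs := h.measurable_step k
  have htr : Measurable fun (r : Finset.range k → ℝ × ZMod 4) (i : ℕ) =>
      if hi : i ∈ Finset.range k then r ⟨i, hi⟩ else 0 := by
    refine measurable_pi_lambda _ fun i => ?_
    by_cases hi : i ∈ Finset.range k
    · simp only [hi, dif_pos]; exact measurable_pi_apply _
    · simp only [hi, dif_neg, not_false_eq_true]; exact measurable_const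
  set pre : Ω → (ℕ → ℝ × ZMod 4) := fun ω i => if i < k then (τ i ω, ξ i ω) else 0 with hpre
  have hpre_meas : Measurable pre := measurable_pi_lambda _ fun i =>
    Measurable.ite (.const _) (h.measurable_step i) measurable_const
  have h1 : IndepFun pre (fun ω => (τ k ω, ξ k ω)) P := by
    have h0 := h.indep_steps.indepFun_finset (Finset.range k) {k} (by simp)
      fun i => h.measurable_step i
    have h2 := h0.comp htr (measurable_pi_apply (⟨k, by simp⟩ : ({k} : Finset ℕ)))
    convert h2 using 1
    · funext ω i
      by_cases hi : i < k <;> simp [hpre, hi]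
    · rfl
  have h2 : IndepFun J (fun ω => (pre ω, (τ k ω, ξ k ω))) P := by
    have hm : Measurable fun σ : ℕ → ℝ × ZMod 4 =>
        ((fun i => if i < k then σ i else 0 : ℕ → ℝ × ZMod 4), σ k) := by
      exact Measurable.prodMk (measurable_pi_lambda _ fun i =>
        Measurable.ite (.const _) (measurable_pi_apply i) measurable_const) (measurable_pi_apply k)
    exact h.indep_initial.comp measurable_id hm
  have h3 : IndepFun (fun ω => (J ω, pre ω)) (fun ω => (τ k ω, ξ k ω)) P := by
    have e1 := (indepFun_iff_map_prod_eq_prod_map_map hpre_meas.aemeasurable hs.aemeasurable).1 h1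
    have e2 := (indepFun_iff_map_prod_eq_prod_map_map hJ.aemeasurable
      (hpre_meas.prodMk hs).aemeasurable).1 h2
    have e3 : IndepFun J pre P := h2.comp measurable_id measurable_fst
    have e4 := (indepFun_iff_map_prod_eq_prod_map_map hJ.aemeasurable
      hpre_meas.aemeasurable).1 e3
    have i1 := Measure.isProbabilityMeasure_map (μ := P) hJ.aemeasurable
    have i2 := Measure.isProbabilityMeasure_map (μ := P) hpre_meas.aemeasurable
    have i3 := Measure.isProbabilityMeasure_map (μ := P) hs.aemeasurable
    rw [indepFun_iff_map_prod_eq_prod_map_map (hJ.prodMk hpre_meas).aemeasurable hs.aemeasurable,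
      e4]
    have e5 := congrArg (Measure.map MeasurableEquiv.prodAssoc.symm) e2
    rw [e1, Measure.map_map MeasurableEquiv.prodAssoc.symm.measurable
      (hJ.prodMk (hpre_meas.prodMk hs))] at e5
    rw [← (measurePreserving_prodAssoc _ _ _).symm.map_eq]
    exact e5
  have h4 := h3.comp hf measurable_id
  convert h4 using 1
  · funext ω
    exact hfk _ _ _ fun i hi => by simp [hpre, hi]
  · rfl

/-- By the second Borel–Cantelli lemma infinitely many waiting times exceed one, almost surely. -/
theorem IsTurningMotion.ae_nonexplosive (h : IsTurningMotion P p q lam J τ ξ) (hl : 0 < lam) :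
    ∀ᵐ ω ∂P, IsNonexplosive fun k => (τ k ω, ξ k ω) := by
  have hmap : ∀ k (s : Set ℝ), MeasurableSet s → P (τ k ⁻¹' s) = expMeasure lam s :=
      fun k s hs => by
    rw [← h.wait_law k, Measure.map_apply (h.measurable_wait k) hs]
  have hexp : ∀ s : Set ℝ, MeasurableSet s →
      expMeasure lam s = ∫⁻ x in s, exponentialPDF lam x := fun s hs =>
    withDensity_apply _ hs
  have hpos : ∀ᵐ ω ∂P, ∀ i, 0 < τ i ω := by
    rw [ae_all_iff]
    intro i
    have h0 : P (τ i ⁻¹' Iic 0) = 0 := by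
      rw [hmap i _ measurableSet_Iic, hexp _ measurableSet_Iic,
        setLIntegral_congr Iio_ae_eq_Iic.symm]
      exact lintegral_exponentialPDF_of_nonpos le_rfl
    rw [ae_iff]
    convert h0 using 2
    ext ω; simp
  have hset : iIndepSet (fun i => τ i ⁻¹' Ioi (1 : ℝ)) P := by
    have := h.indep_steps.comp (fun _ => Prod.fst) fun _ => measurable_fst
    exact (iIndepSet_iff_meas_biInter fun i => h.measurable_wait i measurableSet_Ioi).2
      fun s => this.meas_biInter fun i _ => ⟨Ioi 1, measurableSet_Ioi, rfl⟩
  have hbc : P (limsup (fun i => τ i ⁻¹' Ioi (1 : ℝ)) atTop) = 1 := by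
    refine measure_limsup_eq_one (fun i => h.measurable_wait i measurableSet_Ioi) hset ?_
    simp only [hmap _ _ measurableSet_Ioi]
    refine ENNReal.tsum_const_eq_top_of_ne_zero ?_
    have e : ∀ x ∈ Ioi (1 : ℝ), exponentialPDF lam x
        = ENNReal.ofReal (lam * Real.exp (-(lam * x))) := fun x hx =>
      exponentialPDF_of_nonneg (zero_le_one.trans (le_of_lt hx))
    rw [hexp _ measurableSet_Ioi, setLIntegral_congr_fun measurableSet_Ioi e,
      ← ofReal_integral_eq_lintegral_ofReal (integrableOn_exp_density_Ioi hl 1)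
        (ae_of_all _ fun x => by positivity), integral_exp_density_Ioi hl]
    simpa using Real.exp_pos _
  have hbc' : ∀ᵐ ω ∂P, ∃ᶠ i in atTop, 1 < τ i ω := by
    rw [← prob_compl_eq_zero_iff (MeasurableSet.measurableSet_limsup
      fun i => h.measurable_wait i measurableSet_Ioi)] at hbc
    rw [ae_iff]
    convert hbc using 2
    ext ω
    simp [limsup_eq_iInf_iSup_of_nat, frequently_atTop]
  filter_upwards [hpos, hbc'] with ω h1 h2
  refine ⟨h1, fun M => ?_⟩
  have hmono : Monotone (jumpTime fun k => (τ k ω, ξ k ω)) :=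
    monotone_nat_of_le_succ fun k => by rw [jumpTime_succ]; linarith [h1 k]
  have hn : ∀ n : ℕ, ∃ k, (n : ℝ) ≤ jumpTime (fun k => (τ k ω, ξ k ω)) k := by
    intro n
    induction n with
    | zero => exact ⟨0, by simp [jumpTime]⟩
    | succ n ih =>
      obtain ⟨k, hk⟩ := ih
      obtain ⟨i, hi, h3⟩ := frequently_atTop.1 h2 k
      refine ⟨i + 1, ?_⟩
      rw [jumpTime_succ]
      push_cast
      linarith [hmono hi]
  obtain ⟨n, hM⟩ := exists_nat_gt M
  obtain ⟨k, hk⟩ := hn n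
  exact ⟨k, hM.trans_le hk⟩

end Independence

/-! ### Dynkin's formula -/

section Dynkin

theorem turnMean_sub_const (p q : ℝ) (f : ZMod 4 → ℂ) (c : ℂ) (j : ZMod 4) :
    turnMean p q (fun i => f i - c) j = turnMean p q f j - c := by
  simp only [turnMean]; push_cast; ring

theorem norm_setIntegral_Ioc_le {M : ℝ} {f : ℝ → ℂ} {C a b : ℝ} (hC : 0 ≤ C) (ha : 0 ≤ a)
    (hM : 0 ≤ M) (hb : b ≤ M) (hf : ∀ r ≤ M, ‖f r‖ ≤ C) : ‖∫ r in Ioc a b, f r‖ ≤ C * M := by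
  refine (norm_setIntegral_le_of_norm_le_const (by simp)
    fun r hr => hf r (hr.2.trans hb)).trans ?_
  gcongr
  rw [Real.volume_real_Ioc]
  exact max_le (by linarith) hM

variable {V : Type*} [NormedAddCommGroup V]

theorem flow_self (B : ZMod 4 → ℝ → V) (x : ZMod 4 × ℝ × V) : flow B x x.2.1 = x.2.2 := by
  simp [flow]

/-- The value of `ψ - ∫ g` along a trajectory, accumulated up to the `k`-th change of direction or
up to time `M`, whichever comes first. -/
def stoppedValueAt (B : ZMod 4 → ℝ → V) (ψ g : ZMod 4 → V → ℝ → ℂ) (M : ℝ)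
    (j₀ : ZMod 4) (σ : ℕ → ℝ × ZMod 4) (k : ℕ) : ℂ :=
  (if M < jumpTime σ k then ψ (stateAt B j₀ σ M).1 (stateAt B j₀ σ M).2 M
    else ψ (jumpState B j₀ σ k).1 (jumpState B j₀ σ k).2.2 (jumpTime σ k))
  - ∫ r in Ioc 0 (min (jumpTime σ k) M), g (stateAt B j₀ σ r).1 (stateAt B j₀ σ r).2 r

theorem stoppedValueAt_zero {B : ZMod 4 → ℝ → V} {ψ g : ZMod 4 → V → ℝ → ℂ} {M : ℝ} (hM : 0 ≤ M)
    (j₀ : ZMod 4) (σ : ℕ → ℝ × ZMod 4) :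
    stoppedValueAt B ψ g M j₀ σ 0 = ψ j₀ 0 0 := by
  simp [stoppedValueAt, jumpTime, jumpState, hM, not_lt.mpr hM]

variable [MeasurableSpace V]

/-- The hypotheses of Dynkin's formula up to time `M`: the measurable functions `ψ` and `g` of
(direction, displacement, time) are bounded, and `g` is the generator of the motion applied to `ψ`,
along all trajectories that keep their direction and at all times outside a countable set. -/
structure IsGeneratorPair (p q lam M : ℝ) (B : ZMod 4 → ℝ → V) (ψ g : ZMod 4 → V → ℝ → ℂ) :
    Prop where
  measurable_displacement : ∀ j, Measurable (B j)
  measurable_fun : ∀ j, Measurable fun z : V × ℝ => ψ j z.1 z.2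
  measurable_generator : ∀ j, Measurable fun z : V × ℝ => g j z.1 z.2
  bounded_fun : ∃ C, ∀ j w, ∀ t ≤ M, ‖ψ j w t‖ ≤ C
  bounded_generator : ∃ C, ∀ j w, ∀ t ≤ M, ‖g j w t‖ ≤ C
  continuousOn_fun : ∀ j w, ContinuousOn (fun r => ψ j (w + B j r) r) (Icc 0 M)
  hasDerivAt_fun : ∃ s : Set ℝ, s.Countable ∧ ∀ j w, ∀ r ∈ Ioo 0 M \ s,
    ContinuousAt (fun r => g j (w + B j r) r) r ∧
    HasDerivAt (fun r => ψ j (w + B j r) r) (g j (w + B j r) r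
      - lam * (turnMean p q (fun i => ψ i (w + B j r) r) j - ψ j (w + B j r) r)) r

/-- The value of `ψ - ∫ g` accumulated from the state `x = (j, t, w)` up to time `M` or up to the
next change of direction, whichever comes first; `y` is the pair (waiting time, turn). -/
def stepValue (B : ZMod 4 → ℝ → V) (ψ g : ZMod 4 → V → ℝ → ℂ) (M : ℝ)
    (x : ZMod 4 × ℝ × V) (y : ℝ × ZMod 4) : ℂ :=
  (if M < x.2.1 + y.1 then ψ x.1 (flow B x M) M
    else ψ (x.1 + y.2) (flow B x (x.2.1 + y.1)) (x.2.1 + y.1))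
  - ∫ r in Ioc x.2.1 (min (x.2.1 + y.1) M), g x.1 (flow B x r) r

namespace IsGeneratorPair

variable {p q lam M : ℝ} {B : ZMod 4 → ℝ → V} {ψ g : ZMod 4 → V → ℝ → ℂ}

theorem exists_norm_stepValue_le (h : IsGeneratorPair p q lam M B ψ g) :
    ∃ C, ∀ x y, 0 ≤ x.2.1 → x.2.1 ≤ M → ‖stepValue B ψ g M x y‖ ≤ C := by
  obtain ⟨C₁, h1⟩ := h.bounded_fun
  obtain ⟨C₂, h2⟩ := h.bounded_generator
  refine ⟨C₁ + |C₂| * M, fun x y hx hxM => (norm_sub_le _ _).trans (add_le_add ?_ ?_)⟩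
  · split_ifs with hM
    · exact h1 _ _ _ le_rfl
    · exact h1 _ _ _ (not_lt.mp hM)
  · exact norm_setIntegral_Ioc_le (abs_nonneg _) hx (hx.trans hxM) (min_le_right _ _)
      fun r hr => (h2 _ _ _ hr).trans (le_abs_self _)

variable [BorelSpace V] [SecondCountableTopology V]

theorem measurable_stepValue (h : IsGeneratorPair p q lam M B ψ g) :
    Measurable fun z : (ZMod 4 × ℝ × V) × (ℝ × ZMod 4) => stepValue B ψ g M z.1 z.2 := by
  have hψ : Measurable fun z : ZMod 4 × V × ℝ => ψ z.1 z.2.1 z.2.2 :=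
    measurable_from_prod_countable_right h.measurable_fun
  have hg : Measurable fun z : ZMod 4 × V × ℝ => g z.1 z.2.1 z.2.2 :=
    measurable_from_prod_countable_right h.measurable_generator
  have hf := measurable_flow h.measurable_displacement
  have ht : Measurable fun z : (ZMod 4 × ℝ × V) × (ℝ × ZMod 4) => z.1.2.1 + z.2.1 :=
    measurable_fst.snd.fst.add measurable_snd.fst
  have hj : Measurable fun z : (ZMod 4 × ℝ × V) × (ℝ × ZMod 4) => z.1.1 + z.2.2 :=
    (Measurable.of_discrete (f := fun z : ZMod 4 × ZMod 4 => z.1 + z.2)).comp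
      (measurable_fst.fst.prodMk measurable_snd.snd)
  refine Measurable.sub (Measurable.ite (measurableSet_lt measurable_const ht) ?_ ?_) ?_
  · exact hψ.comp (measurable_fst.fst.prodMk
      ((hf.comp (measurable_fst.prodMk measurable_const)).prodMk measurable_const))
  · exact hψ.comp (hj.prodMk
      ((hf.comp (measurable_fst.prodMk ht)).prodMk ht))
  · have hS : MeasurableSet {z : ((ZMod 4 × ℝ × V) × (ℝ × ZMod 4)) × ℝ |
        z.2 ∈ Ioc z.1.1.2.1 (min (z.1.1.2.1 + z.1.2.1) M)} :=
      (measurableSet_lt measurable_fst.fst.snd.fst measurable_snd).inter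
        (measurableSet_le measurable_snd
          ((ht.comp measurable_fst).min measurable_const))
    have hG : Measurable fun z : ((ZMod 4 × ℝ × V) × (ℝ × ZMod 4)) × ℝ =>
        g z.1.1.1 (flow B z.1.1 z.2) z.2 :=
      hg.comp (measurable_fst.fst.fst.prodMk
        ((hf.comp (measurable_fst.fst.prodMk measurable_snd)).prodMk measurable_snd))
    have := (hG.indicator hS).stronglyMeasurable.integral_prod_right' (ν := volume)
    convert this.measurable using 1
    funext z
    rw [← integral_indicator measurableSet_Ioc]
    rfl

end IsGeneratorPair

section

variable {Ω : Type*} [MeasurableSpace Ω] {P : Measure Ω} [IsProbabilityMeasure P] {p q lam : ℝ}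
  {J : Ω → ZMod 4} {τ : ℕ → Ω → ℝ} {ξ : ℕ → Ω → ZMod 4} [BorelSpace V] [SecondCountableTopology V]
  {M : ℝ} {B : ZMod 4 → ℝ → V} {ψ g : ZMod 4 → V → ℝ → ℂ}

/-- Dynkin's formula for a single step. -/
theorem IsGeneratorPair.integral_stepValue (h : IsGeneratorPair p q lam M B ψ g)
    (hm : IsTurningMotion P p q lam J τ ξ) (hl : 0 < lam) (k : ℕ) {x : ZMod 4 × ℝ × V}
    (hx : 0 ≤ x.2.1) (hxM : x.2.1 ≤ M) :
    ∫ y, stepValue B ψ g M x y ∂(P.map fun ω => (τ k ω, ξ k ω)) = ψ x.1 x.2.2 x.2.1 := by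
  obtain ⟨C, hC⟩ := h.exists_norm_stepValue_le
  obtain ⟨C₁, h1⟩ := h.bounded_fun
  obtain ⟨C₂, h2⟩ := h.bounded_generator
  obtain ⟨s, hs, hd⟩ := h.hasDerivAt_fun
  have i1 := isProbabilityMeasure_expMeasure hl
  have i2 : IsProbabilityMeasure (P.map (ξ k)) :=
    Measure.isProbabilityMeasure_map (hm.measurable_turn k).aemeasurable
  have hmeas : Measurable (stepValue B ψ g M x) :=
    h.measurable_stepValue.comp measurable_prodMk_left
  set A : ℝ → ℂ := fun r => ψ x.1 (flow B x r) r with hA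
  set G : ℝ → ℂ := fun r => g x.1 (flow B x r) r with hG
  set Q : ℝ → ℂ := fun r => turnMean p q (fun i => ψ i (flow B x r) r) x.1 with hQ
  have hfm : Measurable (flow B x) :=
    (measurable_flow h.measurable_displacement).comp measurable_prodMk_left
  have hGm : Measurable G := (h.measurable_generator x.1).comp (hfm.prodMk measurable_id)
  have hψm : ∀ i, Measurable fun r => ψ i (flow B x r) r := fun i =>
    (h.measurable_fun i).comp (hfm.prodMk measurable_id)
  have hii : ∀ (f : ℝ → ℂ) (C : ℝ), Measurable f → (∀ r ≤ M, ‖f r‖ ≤ C) →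
      IntervalIntegrable f volume x.2.1 M := fun f C hf hfC => by
    rw [intervalIntegrable_iff_integrableOn_Ioc_of_le hxM]
    exact Measure.integrableOn_of_bounded (by simp) hf.aestronglyMeasurable
      ((ae_restrict_mem measurableSet_Ioc).mono fun r hr => hfC r hr.2)
  have hGi : IntervalIntegrable G volume x.2.1 M := hii G C₂ hGm fun r hr => h2 _ _ _ hr
  have hψi : ∀ i, IntervalIntegrable (fun r => ψ i (flow B x r) r) volume x.2.1 M := fun i =>
    hii _ C₁ (hψm i) fun r hr => h1 _ _ _ hr
  have hQi : IntervalIntegrable Q volume x.2.1 M :=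
    (((hψi _).const_mul _).add ((hψi _).const_mul _)).add ((hψi _).const_mul _)
  have hGc : ContinuousOn (fun b => ∫ r in x.2.1..b, G r) (Icc x.2.1 M) := by
    have := intervalIntegral.continuousOn_primitive_interval (μ := volume) (f := G) (a := x.2.1)
      (b := M) (by simpa [uIcc_of_le hxM] using
        (intervalIntegrable_iff_integrableOn_Icc_of_le hxM).1 hGi)
    simpa [uIcc_of_le hxM] using this
  have hinner : ∀ a, 0 ≤ a → ∫ m, stepValue B ψ g M x (a, m) ∂(P.map (ξ k))
      = if M - x.2.1 < a then A M - ∫ r in x.2.1..M, G r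
        else Q (x.2.1 + a) - ∫ r in x.2.1..(x.2.1 + a), G r := by
    intro a ha
    by_cases haM : M < x.2.1 + a
    · rw [if_pos (by linarith), intervalIntegral.integral_of_le hxM]
      simp only [stepValue, haM, if_true, min_eq_right haM.le]
      simp [hA, hG]
    · rw [if_neg (by linarith), intervalIntegral.integral_of_le (by linarith)]
      simp only [stepValue, haM, if_false, min_eq_left (not_lt.mp haM)]
      rw [hm.integral_turn k (fun i => ψ i (flow B x (x.2.1 + a)) (x.2.1 + a)
        - ∫ r in Ioc x.2.1 (x.2.1 + a), g x.1 (flow B x r) r) x.1, turnMean_sub_const]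
  have hint : Integrable (stepValue B ψ g M x) ((expMeasure lam).prod (P.map (ξ k))) :=
    Integrable.of_bound hmeas.aestronglyMeasurable C (ae_of_all _ fun y => hC x y hx hxM)
  have hnn : ∀ᵐ a ∂(expMeasure lam), 0 ≤ a := by
    have h0 : expMeasure lam (Iio 0) = 0 := by
      have : expMeasure lam (Iio 0) = ∫⁻ x in Iio 0, exponentialPDF lam x :=
        withDensity_apply _ measurableSet_Iio
      rw [this]
      exact lintegral_exponentialPDF_of_nonpos le_rfl
    rw [ae_iff]
    convert h0 using 2
    ext a; simp
  rw [hm.map_step, integral_prod _ hint, integral_congr_ae (hnn.mono hinner),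
    integral_expMeasure_ite hl (by linarith)]
  · have key := exp_clock_identity (lam := lam) hxM hs (A := A) (Q := Q) (g := G)
      ((h.continuousOn_fun x.1 (x.2.2 - B x.1 x.2.1)).mono (Icc_subset_Icc_left hx))
      (fun r hr => (hd _ _ r ⟨⟨hx.trans_lt hr.1.1, hr.1.2⟩, hr.2⟩).2)
      (fun r hr => (hd _ _ r ⟨⟨hx.trans_lt hr.1.1, hr.1.2⟩, hr.2⟩).1) hGm hGi hQi
    have hsub := intervalIntegral.integral_comp_add_left (a := 0) (b := M - x.2.1)
      (fun b => (lam * Real.exp (-(lam * (b - x.2.1))) : ℝ) • (Q b - ∫ r in x.2.1..b, G r)) x.2.1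
    simp only [add_sub_cancel_left, add_zero, add_sub_cancel] at hsub
    rw [hsub, key, hA]
    simp only [flow_self]
  · have := ((hQi.sub (ContinuousOn.intervalIntegrable
      (by simpa [uIcc_of_le hxM] using hGc))).comp_add_left x.2.1)
    simpa using this

theorem IsGeneratorPair.integrableOn_stateAt (h : IsGeneratorPair p q lam M B ψ g)
    (j₀ : ZMod 4) (σ : ℕ → ℝ × ZMod 4) :
    IntegrableOn (fun r => g (stateAt B j₀ σ r).1 (stateAt B j₀ σ r).2 r) (Ioc 0 M) := by
  obtain ⟨C, hC⟩ := h.bounded_generator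
  have hg : Measurable fun z : ZMod 4 × V × ℝ => g z.1 z.2.1 z.2.2 :=
    measurable_from_prod_countable_right h.measurable_generator
  have hs : Measurable fun r => stateAt B j₀ σ r :=
    (measurable_stateAt h.measurable_displacement).comp
      (measurable_prodMk_left (x := (j₀, σ)))
  exact Measure.integrableOn_of_bounded (by simp)
    (hg.comp (hs.fst.prodMk (hs.snd.prodMk measurable_id))).aestronglyMeasurable
    ((ae_restrict_mem measurableSet_Ioc).mono fun r hr => hC _ _ _ hr.2)

theorem IsGeneratorPair.stoppedValueAt_succ (h : IsGeneratorPair p q lam M B ψ g)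
    {σ : ℕ → ℝ × ZMod 4} (hσ : IsNonexplosive σ) (j₀ : ZMod 4) (k : ℕ) :
    stoppedValueAt B ψ g M j₀ σ (k + 1) = stoppedValueAt B ψ g M j₀ σ k
      + if jumpTime σ k ≤ M then stepValue B ψ g M (jumpState B j₀ σ k) (σ k)
          - ψ (jumpState B j₀ σ k).1 (jumpState B j₀ σ k).2.2 (jumpTime σ k) else 0 := by
  have hlt := hσ.strictMono k.lt_succ_self
  by_cases hk : jumpTime σ k ≤ M
  · have hT : jumpTime σ k + (σ k).1 = jumpTime σ (k + 1) := (jumpTime_succ σ k).symm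
    have h0 := hσ.jumpTime_nonneg k
    have hle : jumpTime σ k ≤ min (jumpTime σ (k + 1)) M := le_min hlt.le hk
    have hsplit : ∫ r in Ioc 0 (min (jumpTime σ (k + 1)) M),
          g (stateAt B j₀ σ r).1 (stateAt B j₀ σ r).2 r
        = (∫ r in Ioc 0 (jumpTime σ k), g (stateAt B j₀ σ r).1 (stateAt B j₀ σ r).2 r)
        + ∫ r in Ioc (jumpTime σ k) (min (jumpTime σ (k + 1)) M),
          g (jumpState B j₀ σ k).1 (flow B (jumpState B j₀ σ k) r) r := by
      have hi := h.integrableOn_stateAt j₀ σ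
      rw [← Ioc_union_Ioc_eq_Ioc h0 hle, setIntegral_union (Ioc_disjoint_Ioc_of_le le_rfl)
        measurableSet_Ioc (hi.mono_set (Ioc_subset_Ioc_right hk))
        (hi.mono_set (Ioc_subset_Ioc h0 (min_le_right _ _)))]
      congr 1
      rw [integral_Ioc_eq_integral_Ioo, integral_Ioc_eq_integral_Ioo]
      refine setIntegral_congr_fun measurableSet_Ioo fun r hr => ?_
      simp only [hσ.stateAt_eq B j₀ hr.1.le (hr.2.trans_le (min_le_left _ _))]
    rw [stoppedValueAt, stoppedValueAt, if_pos hk, if_neg (not_lt.mpr hk), hsplit,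
      min_eq_left hk, stepValue, jumpState_time, hT]
    by_cases hM : M < jumpTime σ (k + 1)
    · rw [if_pos hM, if_pos hM, hσ.stateAt_eq B j₀ hk hM]
      ring
    · rw [if_neg hM, if_neg hM]
      simp only [jumpState, jumpState_time, hT]
      ring
  · rw [not_le] at hk
    rw [if_neg (not_le.mpr hk), add_zero, stoppedValueAt, stoppedValueAt, if_pos hk,
      if_pos (hk.trans hlt), min_eq_right hk.le, min_eq_right (hk.trans hlt).le]

/-- **Dynkin's formula.** -/
theorem IsGeneratorPair.dynkin (h : IsGeneratorPair p q lam M B ψ g)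
    (hm : IsTurningMotion P p q lam J τ ξ) (hl : 0 < lam) (hM : 0 ≤ M) :
    ∫ ω, (ψ (stateAt B (J ω) (fun k => (τ k ω, ξ k ω)) M).1
          (stateAt B (J ω) (fun k => (τ k ω, ξ k ω)) M).2 M
        - ∫ r in Ioc 0 M, g (stateAt B (J ω) (fun k => (τ k ω, ξ k ω)) r).1
          (stateAt B (J ω) (fun k => (τ k ω, ξ k ω)) r).2 r) ∂P
      = ∫ ω, ψ (J ω) 0 0 ∂P := by
  have hgood := hm.ae_nonexplosive hl
  obtain ⟨C₁, h1⟩ := h.bounded_fun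
  obtain ⟨C₂, h2⟩ := h.bounded_generator
  obtain ⟨C₃, h3⟩ := h.exists_norm_stepValue_le
  have hψ : Measurable fun z : ZMod 4 × V × ℝ => ψ z.1 z.2.1 z.2.2 :=
    measurable_from_prod_countable_right h.measurable_fun
  -- the increments are centred, since the next step is independent of the current state
  set D : ZMod 4 × ℝ × V → ℝ × ZMod 4 → ℂ := fun x y =>
    if 0 ≤ x.2.1 ∧ x.2.1 ≤ M then stepValue B ψ g M x y - ψ x.1 x.2.2 x.2.1 else 0 with hD
  have hDm : Measurable fun z : (ZMod 4 × ℝ × V) × (ℝ × ZMod 4) => D z.1 z.2 := by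
    refine Measurable.ite ?_ (h.measurable_stepValue.sub ?_) measurable_const
    · exact (measurableSet_le measurable_const measurable_fst.snd.fst).inter
        (measurableSet_le measurable_fst.snd.fst measurable_const)
    · exact hψ.comp (measurable_fst.fst.prodMk
        (measurable_fst.snd.snd.prodMk measurable_fst.snd.fst))
  have hDb : ∀ x y, ‖D x y‖ ≤ |C₃| + |C₁| := fun x y => by
    simp only [hD]
    split_ifs with hx
    · exact (norm_sub_le _ _).trans (add_le_add ((h3 x y hx.1 hx.2).trans (le_abs_self _))
        ((h1 _ _ _ hx.2).trans (le_abs_self _)))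
    · simp only [norm_zero]; positivity
  set X : ℕ → Ω → ZMod 4 × ℝ × V := fun k ω =>
    jumpState B (J ω) (fun i => (τ i ω, ξ i ω)) k with hX
  have hXm : ∀ k, Measurable (X k) := fun k =>
    (measurable_jumpState h.measurable_displacement k).comp
      (hm.measurable_initial.prodMk hm.measurable_steps)
  have hDi : ∀ k, Integrable (fun ω => D (X k ω) (τ k ω, ξ k ω)) P := fun k =>
    Integrable.of_bound (hDm.comp ((hXm k).prodMk (hm.measurable_step k))).aestronglyMeasurable _
      (ae_of_all _ fun ω => hDb _ _)
  have hD0 : ∀ k, ∫ ω, D (X k ω) (τ k ω, ξ k ω) ∂P = 0 := by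
    intro k
    have i1 := Measure.isProbabilityMeasure_map (μ := P) (hXm k).aemeasurable
    have i2 := Measure.isProbabilityMeasure_map (μ := P) (hm.measurable_step k).aemeasurable
    have hind := hm.indepFun_step k (measurable_jumpState h.measurable_displacement k)
      fun j σ σ' hσ => jumpState_congr B j hσ
    have e := (indepFun_iff_map_prod_eq_prod_map_map (hXm k).aemeasurable
      (hm.measurable_step k).aemeasurable).1 hind
    have e1 := integral_map (μ := P) ((hXm k).prodMk (hm.measurable_step k)).aemeasurable
      hDm.aestronglyMeasurable
    rw [← e1, e, integral_prod _ (Integrable.of_bound hDm.aestronglyMeasurable _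
      (ae_of_all _ fun z => hDb _ _))]
    refine integral_eq_zero_of_ae (ae_of_all _ fun x => ?_)
    by_cases hx : 0 ≤ x.2.1 ∧ x.2.1 ≤ M
    · have hs : Integrable (stepValue B ψ g M x) (P.map fun ω => (τ k ω, ξ k ω)) :=
        Integrable.of_bound (h.measurable_stepValue.comp
          measurable_prodMk_left).aestronglyMeasurable C₃
          (ae_of_all _ fun y => h3 x y hx.1 hx.2)
      simp only [hD, hx, and_self, if_true, Pi.zero_apply]
      rw [integral_sub hs (integrable_const _), h.integral_stepValue hm hl k hx.1 hx.2]
      simp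
    · simp [hD, hx]
  set R : ℕ → Ω → ℂ := fun k ω =>
    stoppedValueAt B ψ g M (J ω) (fun i => (τ i ω, ξ i ω)) k with hR
  have hR0 : R 0 = fun ω => ψ (J ω) 0 0 := funext fun ω => stoppedValueAt_zero hM _ _
  have hRs : ∀ k, R (k + 1) =ᵐ[P] fun ω => R k ω + D (X k ω) (τ k ω, ξ k ω) := by
    intro k
    filter_upwards [hgood] with ω hω
    simp only [hR, hD, hX, h.stoppedValueAt_succ hω, jumpState_time, hω.jumpTime_nonneg k, true_and]
  have hRi : ∀ k, Integrable (R k) P := by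
    intro k
    induction k with
    | zero =>
      rw [hR0]
      refine Integrable.of_bound (Measurable.aestronglyMeasurable ?_) C₁
        (ae_of_all _ fun ω => h1 _ _ _ hM)
      exact hψ.comp (hm.measurable_initial.prodMk (measurable_const (a := ((0, 0) : V × ℝ))))
    | succ k ih => exact (ih.add (hDi k)).congr (hRs k).symm
  have hRE : ∀ k, ∫ ω, R k ω ∂P = ∫ ω, ψ (J ω) 0 0 ∂P := by
    intro k
    induction k with
    | zero => rw [hR0]
    | succ k ih => rw [integral_congr_ae (hRs k), integral_add (hRi k) (hDi k), ih, hD0, add_zero]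
  have hlim := tendsto_integral_of_dominated_convergence (μ := P) (F := R)
    (f := fun ω => ψ (stateAt B (J ω) (fun k => (τ k ω, ξ k ω)) M).1
          (stateAt B (J ω) (fun k => (τ k ω, ξ k ω)) M).2 M
        - ∫ r in Ioc 0 M, g (stateAt B (J ω) (fun k => (τ k ω, ξ k ω)) r).1
          (stateAt B (J ω) (fun k => (τ k ω, ξ k ω)) r).2 r)
    (fun _ => C₁ + |C₂| * M) (fun k => (hRi k).aestronglyMeasurable) (integrable_const _) ?_ ?_
  · simp only [hRE] at hlim
    exact tendsto_nhds_unique hlim tendsto_const_nhds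
  · intro k
    refine ae_of_all _ fun ω => (norm_sub_le _ _).trans (add_le_add ?_ ?_)
    · split_ifs with hk
      · exact h1 _ _ _ le_rfl
      · exact h1 _ _ _ (not_lt.mp hk)
    · exact norm_setIntegral_Ioc_le (abs_nonneg _) le_rfl hM (min_le_right _ _)
        fun r hr => (h2 _ _ _ hr).trans (le_abs_self _)
  · filter_upwards [hgood] with ω hω
    obtain ⟨K, hK⟩ := hω.2 M
    refine tendsto_const_nhds.congr' ((eventually_ge_atTop K).mono fun k hk => ?_)
    have hk' := hK.trans_le (hω.strictMono.monotone hk)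
    simp only [hR, stoppedValueAt, if_pos hk', min_eq_right hk'.le]

end

end Dynkin

/-! ### The position of the particle along a trajectory -/

/-- The velocity of the particle in direction `j`. -/
def velocity (c : ℝ) (j : ZMod 4) : ℝ × ℝ :=
  (c * Real.cos (Real.pi / 2 * (j.val : ℝ)), c * Real.sin (Real.pi / 2 * (j.val : ℝ)))

section Displacement

variable {V : Type*} [NormedAddCommGroup V]

theorem jumpState_displacement (B : ZMod 4 → ℝ → V) (j₀ : ZMod 4) (σ : ℕ → ℝ × ZMod 4) (k : ℕ) :
    (jumpState B j₀ σ k).2.2 = ∑ i ∈ Finset.range k,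
      (B (j₀ + ∑ l ∈ Finset.range i, (σ l).2) (jumpTime σ (i + 1))
        - B (j₀ + ∑ l ∈ Finset.range i, (σ l).2) (jumpTime σ i)) := by
  induction k with
  | zero => rfl
  | succ k ih =>
    rw [Finset.sum_range_succ, ← ih]
    simp only [jumpState, flow, jumpState_time, jumpState_direction, jumpTime_succ]
    rw [sub_add_eq_add_sub, add_sub_assoc]

/-- The displacement at a time `t` before the `K`-th change of direction as a sum over the first
`K` steps. -/
theorem IsNonexplosive.stateAt_displacement {σ : ℕ → ℝ × ZMod 4} (h : IsNonexplosive σ)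
    (B : ZMod 4 → ℝ → V) (j₀ : ZMod 4) {t : ℝ} {K : ℕ} (ht : 0 ≤ t) (hK : t < jumpTime σ K) :
    (stateAt B j₀ σ t).2 = ∑ i ∈ Finset.range K,
      (B (j₀ + ∑ l ∈ Finset.range i, (σ l).2) (min t (jumpTime σ (i + 1)))
        - B (j₀ + ∑ l ∈ Finset.range i, (σ l).2) (min t (jumpTime σ i))) := by
  obtain ⟨k, h1, h2⟩ := h.exists_jumpTime ht
  have hkK : k < K := h.strictMono.lt_iff_lt.1 (h1.trans_lt hK)
  obtain ⟨n, rfl⟩ : ∃ n, K = (k + 1) + n := ⟨K - (k + 1), by omega⟩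
  rw [h.stateAt_eq B j₀ h1 h2, Finset.sum_range_add, Finset.sum_range_succ]
  have e1 : ∑ i ∈ Finset.range n, (B (j₀ + ∑ l ∈ Finset.range (k + 1 + i), (σ l).2)
        (min t (jumpTime σ (k + 1 + i + 1)))
      - B (j₀ + ∑ l ∈ Finset.range (k + 1 + i), (σ l).2) (min t (jumpTime σ (k + 1 + i)))) = 0 := by
    refine Finset.sum_eq_zero fun i _ => ?_
    rw [min_eq_left (h2.le.trans (h.strictMono.monotone (by omega))),
      min_eq_left (h2.le.trans (h.strictMono.monotone (by omega))), sub_self]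
  have e2 : ∑ i ∈ Finset.range k, (B (j₀ + ∑ l ∈ Finset.range i, (σ l).2)
        (min t (jumpTime σ (i + 1)))
      - B (j₀ + ∑ l ∈ Finset.range i, (σ l).2) (min t (jumpTime σ i)))
      = (jumpState B j₀ σ k).2.2 := by
    rw [jumpState_displacement]
    refine Finset.sum_congr rfl fun i hi => ?_
    rw [Finset.mem_range] at hi
    rw [min_eq_right ((h.strictMono.monotone (by omega)).trans h1),
      min_eq_right ((h.strictMono.monotone (by omega)).trans h1)]
  rw [e1, e2, min_eq_left h2.le, min_eq_right h1, flow, jumpState_time, jumpState_direction,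
    add_zero, sub_add_eq_add_sub, add_sub_assoc]

end Displacement

section Position

variable {Ω : Type*} {J : Ω → ZMod 4} {τ : ℕ → Ω → ℝ} {ξ : ℕ → Ω → ZMod 4} {ω : Ω}

theorem numChanges_eq_jumpCount (h : IsNonexplosive fun k => (τ k ω, ξ k ω)) {t : ℝ} (ht : 0 ≤ t) :
    numChanges τ t ω = jumpCount (fun k => (τ k ω, ξ k ω)) t := by
  obtain ⟨k, h1, h2⟩ := h.exists_jumpTime ht
  rw [h.jumpCount_eq h1 h2, numChanges]
  have : {i : ℕ | ∑ l ∈ Finset.range (i + 1), τ l ω ≤ t} = (Finset.range k : Set ℕ) := by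
    ext i
    simp only [mem_ofPred_eq, Finset.coe_range, mem_Iio]
    change jumpTime (fun k => (τ k ω, ξ k ω)) (i + 1) ≤ t ↔ i < k
    constructor
    · intro hi
      have := h.strictMono.lt_iff_lt.1 (hi.trans_lt h2)
      omega
    · intro hi
      exact (h.strictMono.monotone (by omega)).trans h1
  rw [this, Set.ncard_coe_finset, Finset.card_range]

theorem integral_direction (h : IsNonexplosive fun k => (τ k ω, ξ k ω)) (f : ZMod 4 → ℝ) {t : ℝ}
    {K : ℕ} (ht : 0 ≤ t) (hK : t < jumpTime (fun k => (τ k ω, ξ k ω)) K) :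
    ∫ s in (0 : ℝ)..t, f (direction J τ ξ s ω) = ∑ i ∈ Finset.range K,
      (min t (jumpTime (fun k => (τ k ω, ξ k ω)) (i + 1))
        - min t (jumpTime (fun k => (τ k ω, ξ k ω)) i))
        * f (J ω + ∑ l ∈ Finset.range i, ξ l ω) := by
  set σ : ℕ → ℝ × ZMod 4 := fun k => (τ k ω, ξ k ω) with hσ
  have hle : ∀ i, min t (jumpTime σ i) ≤ min t (jumpTime σ (i + 1)) := fun i =>
    min_le_min le_rfl (h.strictMono.monotone i.le_succ)
  have hae : ∀ i, (fun s => f (direction J τ ξ s ω)) =ᵐ[volume.restrict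
      (Ioc (min t (jumpTime σ i)) (min t (jumpTime σ (i + 1))))]
      fun _ => f (J ω + ∑ l ∈ Finset.range i, ξ l ω) := by
    intro i
    rw [← Measure.restrict_congr_set (μ := volume) (Ioo_ae_eq_Ioc (a := min t (jumpTime σ i)))]
    filter_upwards [ae_restrict_mem measurableSet_Ioo] with s hs
    have h2 := hs.2.trans_le (min_le_right _ _)
    have h1 : jumpTime σ i ≤ s := by
      rcases min_lt_iff.1 hs.1 with h3 | h3
      · exact absurd (h3.trans (hs.2.trans_le (min_le_left _ _))) (lt_irrefl _)
      · exact h3.le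
    rw [direction, numChanges_eq_jumpCount h ((h.jumpTime_nonneg i).trans h1),
      h.jumpCount_eq h1 h2]
  have hii : ∀ i, IntervalIntegrable (fun s => f (direction J τ ξ s ω)) volume
      (min t (jumpTime σ i)) (min t (jumpTime σ (i + 1))) := fun i => by
    rw [intervalIntegrable_iff_integrableOn_Ioc_of_le (hle i)]
    exact (integrable_const _).congr (hae i).symm
  have hsum := intervalIntegral.sum_integral_adjacent_intervals (n := K) fun i _ => hii i
  have h0 : min t (jumpTime σ 0) = 0 := by simpa [jumpTime] using ht
  rw [h0, min_eq_left hK.le] at hsum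
  rw [← hsum]
  refine Finset.sum_congr rfl fun i _ => ?_
  rw [intervalIntegral.integral_of_le (hle i), integral_congr_ae (hae i)]
  simp [hle i]

theorem position_eq_stateAt (h : IsNonexplosive fun k => (τ k ω, ξ k ω)) (c : ℝ) {t : ℝ}
    (ht : 0 ≤ t) :
    position c J τ ξ t ω
      = (stateAt (fun j r => r • velocity c j) (J ω) (fun k => (τ k ω, ξ k ω)) t).2 := by
  obtain ⟨K, hK⟩ := h.2 t
  rw [h.stateAt_displacement _ _ ht hK, position,
    integral_direction h (fun j => Real.cos (Real.pi / 2 * (j.val : ℝ))) ht hK,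
    integral_direction h (fun j => Real.sin (Real.pi / 2 * (j.val : ℝ))) ht hK,
    Finset.mul_sum, Finset.mul_sum]
  refine Prod.ext ?_ ?_
  · rw [Prod.fst_sum]
    dsimp only
    refine Finset.sum_congr rfl fun i _ => ?_
    simp only [velocity, Prod.smul_mk, smul_eq_mul, Prod.fst_sub]
    ring
  · rw [Prod.snd_sum]
    dsimp only
    refine Finset.sum_congr rfl fun i _ => ?_
    simp only [velocity, Prod.smul_mk, smul_eq_mul, Prod.snd_sub]
    ring

end Position

section Measurability

variable {Ω : Type*} [MeasurableSpace Ω] {P : Measure Ω} [IsProbabilityMeasure P] {p q lam : ℝ}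
  {J : Ω → ZMod 4} {τ : ℕ → Ω → ℝ} {ξ : ℕ → Ω → ZMod 4}

theorem measurable_smul_velocity (c : ℝ) (j : ZMod 4) :
    Measurable fun r : ℝ => r • velocity c j :=
  (continuous_id.smul continuous_const).measurable

theorem IsTurningMotion.aemeasurable_position (h : IsTurningMotion P p q lam J τ ξ) (hl : 0 < lam)
    (c : ℝ) {t : ℝ} (ht : 0 ≤ t) : AEMeasurable (position c J τ ξ t) P := by
  have hm := (measurable_stateAt (measurable_smul_velocity c)).comp
    ((h.measurable_initial.prodMk h.measurable_steps).prodMk (measurable_const (a := t)))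
  refine ⟨_, hm.snd, ?_⟩
  filter_upwards [h.ae_nonexplosive hl] with ω hω
  exact position_eq_stateAt hω c ht

end Measurability

/-! ### The algebra of differential operators on test functions -/

section TestSpace

/-- The test functions on `U` as a real vector space. -/
def testSpace (U : Set (ℝ × ℝ × ℝ)) : Submodule ℝ (ℝ × ℝ × ℝ → ℝ) where
  carrier := {φ | IsTestFunction U φ}
  add_mem' := fun {φ ψ} hφ hψ => ⟨hφ.1.add hψ.1, hφ.2.1.add hψ.2.1,
    (tsupport_add φ ψ).trans (union_subset hφ.2.2 hψ.2.2)⟩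
  zero_mem' := ⟨contDiff_const, HasCompactSupport.zero, by simp [tsupport]⟩
  smul_mem' := fun a φ hφ => ⟨contDiff_const.smul hφ.1, hφ.2.1.smul_left,
    (tsupport_smul_subset_right (fun _ => a) φ).trans hφ.2.2⟩

variable {U : Set (ℝ × ℝ × ℝ)} {φ : ℝ × ℝ × ℝ → ℝ}

theorem IsTestFunction.fderiv_apply (h : IsTestFunction U φ) (v : ℝ × ℝ × ℝ) :
    IsTestFunction U fun z => fderiv ℝ φ z v := by
  refine ⟨(h.1.fderiv_right (by simp)).clm_apply contDiff_const, h.2.1.fderiv_apply ℝ v,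
    (closure_minimal (fun z hz => ?_) (isClosed_tsupport φ)).trans h.2.2⟩
  refine support_fderiv_subset ℝ (f := φ) (fun h0 => hz ?_)
  simp [h0]

/-- The derivative in direction `v` as an operator on test functions. -/
def derivEnd (U : Set (ℝ × ℝ × ℝ)) (v : ℝ × ℝ × ℝ) : Module.End ℝ (testSpace U) where
  toFun φ := ⟨fun z => fderiv ℝ φ.1 z v, IsTestFunction.fderiv_apply φ.2 v⟩
  map_add' φ ψ := by
    ext z
    have h1 := (φ.2.1.differentiable (by simp)) z
    have h2 := (ψ.2.1.differentiable (by simp)) z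
    simp [fderiv_add h1 h2]
  map_smul' a φ := by
    ext z
    have h1 := (φ.2.1.differentiable (by simp)) z
    simp [fderiv_const_smul h1]

theorem derivEnd_comm (v w : ℝ × ℝ × ℝ) :
    derivEnd U v * derivEnd U w = derivEnd U w * derivEnd U v := by
  ext φ z
  have hd : DifferentiableAt ℝ (fderiv ℝ φ.1) z :=
    ((φ.2.1.fderiv_right (m := 1) (by norm_cast)).differentiable (by simp)) z
  have hs : IsSymmSndFDerivAt ℝ φ.1 z :=
    φ.2.1.contDiffAt.isSymmSndFDerivAt (by
      rw [minSmoothness_of_isRCLikeNormedField]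
      exact WithTop.coe_le_coe.2 (le_top : (2 : ℕ∞) ≤ ⊤))
  have key : ∀ a b : ℝ × ℝ × ℝ, fderiv ℝ (fun y => fderiv ℝ φ.1 y a) z b
      = fderiv ℝ (fderiv ℝ φ.1) z b a := fun a b => by
    rw [fderiv_clm_apply hd (differentiableAt_const a)]
    simp
  change fderiv ℝ (fun y => fderiv ℝ φ.1 y w) z v = fderiv ℝ (fun y => fderiv ℝ φ.1 y v) z w
  rw [key, key]
  exact hs v w

end TestSpace

/-- The characteristic polynomial of the motion, an expression in commuting variables: `T` stands
for `∂/∂t + lam` or its transpose, `X` for `c ∂/∂x`, `Y` for `c ∂/∂y` and `r` for `1 - p - q`. -/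
def motionPoly {R : Type*} [CommRing R] (T X Y p q r l : R) : R :=
  (T * (T * (T * T - Y * Y)) - X * (X * (T * T - Y * Y))) - 4 * l ^ 2 * p * q * (T * T)
    - l ^ 2 * r ^ 2 * (2 * (T * T) - (X * X + Y * Y)) - 4 * l ^ 3 * (p ^ 2 + q ^ 2) * r * T
    + l ^ 4 * (r ^ 2 - 2 * p * q) ^ 2 - l ^ 4 * (p ^ 2 + q ^ 2) ^ 2

/-- `motionPoly` is the determinant of the system of transport equations that govern the four
directions, so a combination of the four equations eliminates the direction. -/
theorem exists_elimination {R : Type*} [CommRing R] (T X Y p q r l : R) :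
    ∃ a b d e : R,
      (T - X) * a - l * (p * b + q * e + r * d) = motionPoly T X Y p q r l ∧
      (T - Y) * b - l * (p * d + q * a + r * e) = motionPoly T X Y p q r l ∧
      (T + X) * d - l * (p * e + q * b + r * a) = motionPoly T X Y p q r l ∧
      (T + Y) * e - l * (p * a + q * d + r * b) = motionPoly T X Y p q r l := by
  let A : Matrix (Fin 4) (Fin 4) R :=
    !![T - X, -(l * p), -(l * r), -(l * q); -(l * q), T - Y, -(l * p), -(l * r);
      -(l * r), -(l * q), T + X, -(l * p); -(l * p), -(l * r), -(l * q), T + Y]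
  have hdet : A.det = motionPoly T X Y p q r l := by
    simp only [A, motionPoly, Matrix.det_succ_row_zero, Fin.sum_univ_succ]
    simp [Fin.succAbove, Fin.lt_def]
    ring
  have h : A.mulVec (A.adjugate.mulVec 1) = A.det • (1 : Fin 4 → R) := by
    rw [Matrix.mulVec_mulVec, Matrix.mul_adjugate, Matrix.smul_mulVec, Matrix.one_mulVec]
  rw [hdet] at h
  set u := A.adjugate.mulVec 1
  refine ⟨u 0, u 1, u 2, u 3, ?_, ?_, ?_, ?_⟩
  · have := congrFun h 0
    simp [A, Matrix.mulVec, dotProduct, Fin.sum_univ_four] at this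
    linear_combination this
  · have := congrFun h 1
    simp [A, Matrix.mulVec, dotProduct, Fin.sum_univ_four] at this
    linear_combination this
  · have := congrFun h 2
    simp [A, Matrix.mulVec, dotProduct, Fin.sum_univ_four] at this
    linear_combination this
  · have := congrFun h 3
    simp [A, Matrix.mulVec, dotProduct, Fin.sum_univ_four] at this
    linear_combination this

/-- The operator of the fourth-order equation as an element of an algebra of operators in which
`T` stands for `∂/∂t + lam` or its transpose, `x` for `∂/∂x` and `y` for `∂/∂y`. -/
def motionElem {A : Type*} [Ring A] [Algebra ℝ A] (T x y : A) (p q lam c : ℝ) : A :=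
  (T * (T * (T * T - c ^ 2 • (y * y))) - c ^ 2 • (x * (x * (T * T - c ^ 2 • (y * y)))))
    - (4 * lam ^ 2 * p * q) • (T * T)
    - (lam ^ 2 * (1 - p - q) ^ 2) • ((2 : ℝ) • (T * T) - c ^ 2 • (x * x + y * y))
    - (4 * lam ^ 3 * (p ^ 2 + q ^ 2) * (1 - p - q)) • T
    + (lam ^ 4 * ((1 - p - q) ^ 2 - 2 * p * q) ^ 2) • (1 : A)
    - (lam ^ 4 * (p ^ 2 + q ^ 2) ^ 2) • (1 : A)

open scoped IsMulCommutative in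
/-- The elimination in an algebra of operators, carried out in the commutative subalgebra that the
three operators generate. -/
theorem exists_elimination_of_commute {A : Type*} [Ring A] [Algebra ℝ A] {T x y : A}
    (hTx : T * x = x * T) (hTy : T * y = y * T) (hxy : x * y = y * x) (p q lam c : ℝ) :
    ∃ a b d e : A,
      (T - c • x) * a - lam • (p • b + q • e + (1 - p - q) • d) = motionElem T x y p q lam c ∧
      (T - c • y) * b - lam • (p • d + q • a + (1 - p - q) • e) = motionElem T x y p q lam c ∧
      (T + c • x) * d - lam • (p • e + q • b + (1 - p - q) • a) = motionElem T x y p q lam c ∧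
      (T + c • y) * e - lam • (p • a + q • d + (1 - p - q) • b) = motionElem T x y p q lam c := by
  set S : Set A := {T, x, y} with hS
  have : IsMulCommutative (Algebra.adjoin ℝ S) := Algebra.isMulCommutative_adjoin ℝ (by
    rintro u (rfl | rfl | rfl) v (rfl | rfl | rfl) <;> simp_all)
  let T' : Algebra.adjoin ℝ S := ⟨T, Algebra.subset_adjoin (by simp [hS])⟩
  let x' : Algebra.adjoin ℝ S := ⟨x, Algebra.subset_adjoin (by simp [hS])⟩
  let y' : Algebra.adjoin ℝ S := ⟨y, Algebra.subset_adjoin (by simp [hS])⟩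
  let C : ℝ → Algebra.adjoin ℝ S := algebraMap ℝ _
  have hC : ∀ (s : ℝ) (z : Algebra.adjoin ℝ S), C s * z = s • z := fun s z =>
    (Algebra.smul_def s z).symm
  obtain ⟨a, b, d, e, h0, h1, h2, h3⟩ :=
    exists_elimination T' (C c * x') (C c * y') (C p) (C q) (C (1 - p - q)) (C lam)
  have hL : motionPoly T' (C c * x') (C c * y') (C p) (C q) (C (1 - p - q)) (C lam)
      = motionElem T' x' y' p q lam c := by
    simp only [motionPoly, motionElem, C, Algebra.smul_def, map_mul, map_pow, map_add, map_sub,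
      map_one, map_ofNat]
    ring
  have hL' : ((motionElem T' x' y' p q lam c : Algebra.adjoin ℝ S) : A)
      = motionElem T x y p q lam c := rfl
  rw [hL] at h0 h1 h2 h3
  simp only [hC] at h0 h1 h2 h3
  rw [← hL']
  exact ⟨a, b, d, e, congrArg Subtype.val h0, congrArg Subtype.val h1, congrArg Subtype.val h2,
    congrArg Subtype.val h3⟩

theorem derivEnd_eq (U : Set (ℝ × ℝ × ℝ)) (v : ℝ × ℝ) :
    derivEnd U (v.1, v.2, 0) = v.1 • derivEnd U (1, 0, 0) + v.2 • derivEnd U (0, 1, 0) := by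
  ext φ z
  have : ((v.1, v.2, 0) : ℝ × ℝ × ℝ) = v.1 • (1, 0, 0) + v.2 • (0, 1, 0) := by simp
  change fderiv ℝ φ.1 z (v.1, v.2, 0)
    = v.1 * fderiv ℝ φ.1 z (1, 0, 0) + v.2 * fderiv ℝ φ.1 z (0, 1, 0)
  rw [this, map_add, map_smul, map_smul, smul_eq_mul, smul_eq_mul]

theorem velocity_zero (c : ℝ) : velocity c 0 = (c, 0) := by
  simp [velocity]

theorem velocity_add_one (c : ℝ) (j : ZMod 4) :
    velocity c (j + 1) = (-(velocity c j).2, (velocity c j).1) := by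
  have key : ∃ n : ℤ, (((j + 1).val : ℕ) : ℝ) = (j.val : ℝ) + 1 + n * 4 := by
    have h : (j + 1).val = j.val + 1 ∨ (j + 1).val + 4 = j.val + 1 := by revert j; decide
    rcases h with h | h
    · exact ⟨0, by rw [h]; push_cast; ring⟩
    · refine ⟨-1, ?_⟩
      have h' : (((j + 1).val : ℕ) : ℝ) + 4 = (j.val : ℝ) + 1 := by exact_mod_cast h
      push_cast
      linarith
  obtain ⟨n, hn⟩ := key
  have e : Real.pi / 2 * (((j + 1).val : ℕ) : ℝ)
      = Real.pi / 2 * (j.val : ℝ) + Real.pi / 2 + n * (2 * Real.pi) := by rw [hn]; ring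
  simp only [velocity]
  rw [e, Real.cos_add_int_mul_two_pi, Real.sin_add_int_mul_two_pi, Real.cos_add_pi_div_two,
    Real.sin_add_pi_div_two]
  simp

theorem commute_neg_add_smul_one {A : Type*} [Ring A] [Algebra ℝ A] {t x : A}
    (h : t * x = x * t) (a : ℝ) : (-t + a • (1 : A)) * x = x * (-t + a • (1 : A)) := by
  simp [add_mul, mul_add, h]

/-- Four functionals that satisfy the transport equations in the sense of distributions: their sum
is annihilated by the transposed fourth-order operator. -/
theorem sum_apply_motionOpTranspose {U : Set (ℝ × ℝ × ℝ)} {p q lam c : ℝ}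
    (f : ZMod 4 → testSpace U →ₗ[ℝ] ℂ)
    (hf : ∀ j φ, f j ((-derivEnd U (0, 0, 1) - derivEnd U ((velocity c j).1, (velocity c j).2, 0)
        + lam • (1 : Module.End ℝ (testSpace U))) φ)
      = lam * (p * f (j - 1) φ + q * f (j + 1) φ + (1 - p - q : ℝ) * f (j + 2) φ))
    (φ : testSpace U) :
    ∃ χ : testSpace U, (χ : ℝ × ℝ × ℝ → ℝ) = motionOpTranspose p q lam c φ ∧
      ∑ j, f j χ = 0 := by
  set x := derivEnd U (1, 0, 0) with hx
  set y := derivEnd U (0, 1, 0) with hy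
  set t := derivEnd U (0, 0, 1) with ht
  set T : Module.End ℝ (testSpace U) := -t + lam • (1 : Module.End ℝ (testSpace U)) with hT
  have htx : t * x = x * t := derivEnd_comm _ _
  have hty : t * y = y * t := derivEnd_comm _ _
  have hTx : T * x = x * T :=
    commute_neg_add_smul_one (A := Module.End ℝ (testSpace U)) (t := t) (x := x) htx lam
  have hTy : T * y = y * T :=
    commute_neg_add_smul_one (A := Module.End ℝ (testSpace U)) (t := t) (x := y) hty lam
  obtain ⟨a, b, d, e, h0, h1, h2, h3⟩ := exists_elimination_of_commute (T := T) (x := x) (y := y)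
    hTx hTy (derivEnd_comm _ _) p q lam c
  set L := motionElem T x y p q lam c with hL
  refine ⟨L φ, rfl, ?_⟩
  have hu : (Finset.univ : Finset (ZMod 4)) = {0, 1, 2, 3} := by decide
  rw [hu, Finset.sum_insert (by decide), Finset.sum_insert (by decide),
    Finset.sum_insert (by decide), Finset.sum_singleton]
  have v0 := velocity_zero c
  have v1 : velocity c 1 = (0, c) := by
    have := velocity_add_one c 0
    rw [v0] at this; simpa using this
  have v2 : velocity c 2 = (-c, 0) := by
    have := velocity_add_one c 1
    rw [v1] at this; exact this.trans (by simp)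
  have v3 : velocity c 3 = (0, -c) := by
    have := velocity_add_one c 2
    rw [v2] at this; exact this.trans (by simp)
  have key : ∀ (j : ZMod 4) (w : ℝ × ℝ), velocity c j = w → ∀ Z : Module.End ℝ (testSpace U),
      T - (w.1 • x + w.2 • y) = Z → ∀ ψ, f j (Z ψ)
        = lam * (p * f (j - 1) ψ + q * f (j + 1) ψ + (1 - p - q : ℝ) * f (j + 2) ψ) := by
    rintro j w rfl Z rfl ψ
    rw [← hf j ψ, derivEnd_eq, hT]
    congr 2
    module
  have e0 := key 0 _ v0 (T - c • x) (by module) (a φ)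
  have e1 := key 1 _ v1 (T - c • y) (by module) (b φ)
  have e2 := key 2 _ v2 (T + c • x) (by module) (d φ)
  have e3 := key 3 _ v3 (T + c • y) (by module) (e φ)
  have w0 : f 0 (L φ) = f 0 ((T - c • x) (a φ)) - lam * (p * f 0 (b φ) + q * f 0 (e φ)
      + (1 - p - q : ℝ) * f 0 (d φ)) := by
    rw [← h0]
    simp [Module.End.mul_apply]
    ring
  have w1 : f 1 (L φ) = f 1 ((T - c • y) (b φ)) - lam * (p * f 1 (d φ) + q * f 1 (a φ)
      + (1 - p - q : ℝ) * f 1 (e φ)) := by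
    rw [← h1]
    simp [Module.End.mul_apply]
    ring
  have w2 : f 2 (L φ) = f 2 ((T + c • x) (d φ)) - lam * (p * f 2 (e φ) + q * f 2 (b φ)
      + (1 - p - q : ℝ) * f 2 (a φ)) := by
    rw [← h2]
    simp [Module.End.mul_apply]
    ring
  have w3 : f 3 (L φ) = f 3 ((T + c • y) (e φ)) - lam * (p * f 3 (a φ) + q * f 3 (d φ)
      + (1 - p - q : ℝ) * f 3 (b φ)) := by
    rw [← h3]
    simp [Module.End.mul_apply]
    ring
  rw [w0, w1, w2, w3, e0, e1, e2, e3]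
  simp only [show (0 - 1 : ZMod 4) = 3 by decide, show (0 + 1 : ZMod 4) = 1 by decide,
    show (0 + 2 : ZMod 4) = 2 by decide, show (1 - 1 : ZMod 4) = 0 by decide,
    show (1 + 1 : ZMod 4) = 2 by decide, show (1 + 2 : ZMod 4) = 3 by decide,
    show (2 - 1 : ZMod 4) = 1 by decide, show (2 + 1 : ZMod 4) = 3 by decide,
    show (2 + 2 : ZMod 4) = 0 by decide, show (3 - 1 : ZMod 4) = 2 by decide,
    show (3 + 1 : ZMod 4) = 0 by decide, show (3 + 2 : ZMod 4) = 1 by decide]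
  ring

/-! ### The forward equations -/

section Forward

theorem norm_turnMean_le {p q C : ℝ} {f : ZMod 4 → ℂ} (hf : ∀ i, ‖f i‖ ≤ C) (j : ZMod 4) :
    ‖turnMean p q f j‖ ≤ (|p| + |q| + |1 - p - q|) * C := by
  have h : ∀ (a : ℝ) i, ‖(a : ℂ) * f i‖ ≤ |a| * C := fun a i => by
    rw [norm_mul, Complex.norm_real, Real.norm_eq_abs]
    exact mul_le_mul_of_nonneg_left (hf i) (abs_nonneg a)
  calc ‖turnMean p q f j‖ ≤ |p| * C + |q| * C + |1 - p - q| * C :=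
        (norm_add₃_le).trans (add_le_add (add_le_add (h _ _) (h _ _)) (h _ _))
    _ = _ := by ring

variable {Ω : Type*} {U : Set (ℝ × ℝ × ℝ)} {φ : ℝ × ℝ × ℝ → ℝ} {p q lam c M : ℝ}
  {J : Ω → ZMod 4} {τ : ℕ → Ω → ℝ} {ξ : ℕ → Ω → ZMod 4}

theorem IsTestFunction.continuous (h : IsTestFunction U φ) : Continuous φ := h.1.continuous

theorem IsTestFunction.exists_bound (h : IsTestFunction U φ) : ∃ C, ∀ z, ‖φ z‖ ≤ C :=
  h.2.1.exists_bound_of_continuous h.continuous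

theorem IsTestFunction.eq_zero (h : IsTestFunction U φ) {z : ℝ × ℝ × ℝ} (hz : z ∉ U) : φ z = 0 :=
  image_eq_zero_of_notMem_tsupport fun hz' => hz (h.2.2 hz')

/-- The space-time points with time coordinate in `(0, M)`. -/
def timeSlab (M : ℝ) : Set (ℝ × ℝ × ℝ) := {z | 0 < z.2.2 ∧ z.2.2 < M}

/-- The test function `φ`, restricted to direction `j`. -/
def onDirection (j : ZMod 4) (φ : ℝ × ℝ × ℝ → ℝ) (i : ZMod 4) (w : ℝ × ℝ) (t : ℝ) : ℂ :=
  if i = j then ((φ (w.1, w.2, t) : ℝ) : ℂ) else 0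

theorem norm_onDirection_le {C : ℝ} (hC : ∀ z, ‖φ z‖ ≤ C) (j i : ZMod 4) (w : ℝ × ℝ) (t : ℝ) :
    ‖onDirection j φ i w t‖ ≤ C := by
  rw [onDirection]
  split_ifs
  · simpa using hC _
  · simpa using (norm_nonneg _).trans (hC 0)

theorem continuous_onDirection (hφ : Continuous φ) (j i : ZMod 4) :
    Continuous fun z : (ℝ × ℝ) × ℝ => onDirection j φ i z.1 z.2 := by
  by_cases h : i = j
  · simp only [onDirection, h, if_true]
    fun_prop
  · simp only [onDirection, h, if_false]
    fun_prop

/-- The generator of the motion applied to a test function restricted to direction `j`. -/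
def generatorOnDirection (p q lam c : ℝ) (j : ZMod 4) (φ : ℝ × ℝ × ℝ → ℝ) (i : ZMod 4)
    (w : ℝ × ℝ) (t : ℝ) : ℂ :=
  onDirection j (fun z => fderiv ℝ φ z ((velocity c j).1, (velocity c j).2, 1)) i w t
    + lam * (turnMean p q (fun k => onDirection j φ k w t) i - onDirection j φ i w t)

theorem generatorOnDirection_eq (p q lam c : ℝ) (j : ZMod 4) (φ : ℝ × ℝ × ℝ → ℝ) (i : ZMod 4)
    (w : ℝ × ℝ) (t : ℝ) : generatorOnDirection p q lam c j φ i w t =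
      onDirection j (fun z => fderiv ℝ φ z ((velocity c j).1, (velocity c j).2, 1)) i w t
      + lam * (p * onDirection (j - 1) φ i w t + q * onDirection (j + 1) φ i w t
        + (1 - p - q : ℝ) * onDirection (j + 2) φ i w t - onDirection j φ i w t) := by
  have h1 : (i + 1 = j) = (i = j - 1) := propext eq_sub_iff_add_eq.symm
  have h2 : (i - 1 = j) = (i = j + 1) := propext sub_eq_iff_eq_add
  have h3 : (i + 2 = j) = (i = j + 2) := by
    rw [← eq_sub_iff_add_eq, sub_eq_add_neg, show (-2 : ZMod 4) = 2 by decide]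
  simp only [generatorOnDirection, turnMean, onDirection, h1, h2, h3]

theorem isGeneratorPair_onDirection (h : IsTestFunction U φ) (p q lam c M : ℝ) (j : ZMod 4) :
    IsGeneratorPair p q lam M (fun i r => r • velocity c i) (onDirection j φ)
      (generatorOnDirection p q lam c j φ) := by
  have hD : IsTestFunction U fun z => fderiv ℝ φ z ((velocity c j).1, (velocity c j).2, 1) :=
    h.fderiv_apply _
  have hψ := fun i => continuous_onDirection h.continuous j i
  have hg : ∀ i, Continuous fun z : (ℝ × ℝ) × ℝ => generatorOnDirection p q lam c j φ i z.1 z.2 :=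
    fun i => (continuous_onDirection hD.continuous j i).add (continuous_const.mul
      ((((continuous_const.mul (hψ _)).add (continuous_const.mul (hψ _))).add
        (continuous_const.mul (hψ _))).sub (hψ _)))
  have hpath : ∀ (i : ZMod 4) (w : ℝ × ℝ), Continuous fun r : ℝ => (w + r • velocity c i, r) :=
    fun i w => by fun_prop
  obtain ⟨C, hC⟩ := h.exists_bound
  obtain ⟨C', hC'⟩ := hD.exists_bound
  refine ⟨measurable_smul_velocity c, fun i => (hψ i).measurable, fun i => (hg i).measurable,
    ⟨C, fun i w t _ => norm_onDirection_le hC _ _ _ _⟩,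
    ⟨C' + |lam| * ((|p| + |q| + |1 - p - q|) * C + C), fun i w t _ => ?_⟩,
    fun i w => ((hψ i).comp (hpath i w)).continuousOn, ∅, countable_empty, fun i w r _ =>
    ⟨((hg i).comp (hpath i w)).continuousAt, ?_⟩⟩
  · refine (norm_add_le _ _).trans (add_le_add (norm_onDirection_le hC' _ _ _ _) ?_)
    rw [norm_mul, Complex.norm_real, Real.norm_eq_abs]
    exact mul_le_mul_of_nonneg_left ((norm_sub_le _ _).trans (add_le_add
      (norm_turnMean_le (fun k => norm_onDirection_le hC _ _ _ _) _)
      (norm_onDirection_le hC _ _ _ _))) (abs_nonneg _)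
  · simp only [generatorOnDirection, add_sub_cancel_right]
    by_cases hij : i = j
    · subst hij
      simp only [onDirection, if_true]
      have h1 : HasDerivAt (fun r : ℝ => ((w + r • velocity c i).1, (w + r • velocity c i).2, r))
          ((velocity c i).1, (velocity c i).2, 1) r := by
        have e : ∀ a b : ℝ, HasDerivAt (fun r : ℝ => a + r * b) b r := fun a b => by
          simpa using ((hasDerivAt_id r).mul_const b).const_add a
        exact (e _ _).prodMk ((e _ _).prodMk (hasDerivAt_id r))
      have h2 := ((h.1.differentiable (by simp)) ((w + r • velocity c i).1,
        (w + r • velocity c i).2, r)).hasFDerivAt.comp_hasDerivAt r h1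
      exact h2.ofReal_comp
    · simp only [onDirection, hij, if_false]
      exact hasDerivAt_const _ _

variable [MeasurableSpace Ω] {P : Measure Ω}

/-- The (direction, position) at time `z.2` on the outcome `z.1`. -/
def occupationState (c : ℝ) (J : Ω → ZMod 4) (τ : ℕ → Ω → ℝ) (ξ : ℕ → Ω → ZMod 4) (z : Ω × ℝ) :
    ZMod 4 × ℝ × ℝ :=
  stateAt (fun i r => r • velocity c i) (J z.1) (fun k => (τ k z.1, ξ k z.1)) z.2

theorem IsTurningMotion.measurable_occupationState (h : IsTurningMotion P p q lam J τ ξ) (c : ℝ) :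
    Measurable (occupationState c J τ ξ) :=
  (measurable_stateAt (measurable_smul_velocity c)).comp
    (((h.measurable_initial.comp measurable_fst).prodMk
      (h.measurable_steps.comp measurable_fst)).prodMk measurable_snd)

variable [IsProbabilityMeasure P]

/-- The time spent in direction `j` up to time `M`, integrated against the function `φ` of the
space-time position. -/
def occupationIntegral (P : Measure Ω) (c M : ℝ) (J : Ω → ZMod 4) (τ : ℕ → Ω → ℝ)
    (ξ : ℕ → Ω → ZMod 4) (j : ZMod 4) (φ : ℝ × ℝ × ℝ → ℝ) : ℂ :=
  ∫ z, onDirection j φ (occupationState c J τ ξ z).1 (occupationState c J τ ξ z).2 z.2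
    ∂(P.prod (volume.restrict (Ioc 0 M)))

theorem integrable_onDirection_occupationState (h : IsTurningMotion P p q lam J τ ξ)
    (hφ : IsTestFunction U φ) (c M : ℝ) (j : ZMod 4) :
    Integrable (fun z => onDirection j φ (occupationState c J τ ξ z).1
      (occupationState c J τ ξ z).2 z.2) (P.prod (volume.restrict (Ioc 0 M))) := by
  obtain ⟨C, hC⟩ := hφ.exists_bound
  have hm : Measurable fun z : ZMod 4 × (ℝ × ℝ) × ℝ => onDirection j φ z.1 z.2.1 z.2.2 :=
    measurable_from_prod_countable_right fun i =>
      (continuous_onDirection hφ.continuous j i).measurable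
  have hs := h.measurable_occupationState c
  exact Integrable.of_bound (hm.comp (hs.fst.prodMk (hs.snd.prodMk
    measurable_snd))).aestronglyMeasurable C (ae_of_all _ fun z => norm_onDirection_le hC _ _ _ _)

/-- The forward equation for direction `j`, tested against `φ`. -/
theorem IsTurningMotion.forward_equation (h : IsTurningMotion P p q lam J τ ξ) (hl : 0 < lam)
    (hM : 0 ≤ M) (hφ : IsTestFunction (timeSlab M) φ) (c : ℝ) (j : ZMod 4) :
    occupationIntegral P c M J τ ξ j
        (fun z => fderiv ℝ φ z ((velocity c j).1, (velocity c j).2, 1))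
      + lam * (p * occupationIntegral P c M J τ ξ (j - 1) φ
        + q * occupationIntegral P c M J τ ξ (j + 1) φ
        + (1 - p - q : ℝ) * occupationIntegral P c M J τ ξ (j + 2) φ
        - occupationIntegral P c M J τ ξ j φ) = 0 := by
  have hdyn := (isGeneratorPair_onDirection hφ p q lam c M j).dynkin h hl hM
  have hM0 : ∀ i w, onDirection j φ i w M = 0 := fun i w => by
    simp [onDirection, hφ.eq_zero (z := (w.1, w.2, M)) fun hz => lt_irrefl _ hz.2]
  have h00 : ∀ i w, onDirection j φ i w 0 = 0 := fun i w => by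
    simp [onDirection, hφ.eq_zero (z := (w.1, w.2, 0)) fun hz => lt_irrefl _ hz.1]
  simp only [hM0, h00, zero_sub, integral_zero, integral_neg, neg_eq_zero] at hdyn
  have hI := fun j => integrable_onDirection_occupationState h hφ c M j
  have hI' := integrable_onDirection_occupationState h
    (hφ.fderiv_apply ((velocity c j).1, (velocity c j).2, 1)) c M j
  have i1 := ((hI (j - 1)).const_mul (p : ℂ)).add ((hI (j + 1)).const_mul (q : ℂ))
  have i2 := i1.add ((hI (j + 2)).const_mul ((1 - p - q : ℝ) : ℂ))
  have i3 := (i2.sub (hI j)).const_mul (lam : ℂ)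
  have e := integral_prod _ (hI'.add i3)
  rw [integral_add' hI' i3, integral_const_mul, integral_sub' i2 (hI j), integral_add' i1
    ((hI (j + 2)).const_mul _), integral_add' ((hI (j - 1)).const_mul _)
    ((hI (j + 1)).const_mul _), integral_const_mul, integral_const_mul, integral_const_mul] at e
  simp only [generatorOnDirection_eq] at hdyn
  exact e.trans hdyn

/-- The occupation measure of the motion solves the fourth-order equation. -/
theorem IsTurningMotion.integral_motionOpTranspose (h : IsTurningMotion P p q lam J τ ξ)
    (hl : 0 < lam) (hM : 0 ≤ M) (hφ : IsTestFunction (timeSlab M) φ) (c : ℝ) :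
    IsTestFunction (timeSlab M) (motionOpTranspose p q lam c φ) ∧
    ∫ z, motionOpTranspose p q lam c φ ((occupationState c J τ ξ z).2.1,
      (occupationState c J τ ξ z).2.2, z.2) ∂(P.prod (volume.restrict (Ioc 0 M))) = 0 := by
  let f : ZMod 4 → testSpace (timeSlab M) →ₗ[ℝ] ℂ := fun j =>
    { toFun := fun φ => occupationIntegral P c M J τ ξ j φ.1
      map_add' := fun φ ψ => by
        simp only [occupationIntegral]
        rw [← integral_add (integrable_onDirection_occupationState h φ.2 c M j)
          (integrable_onDirection_occupationState h ψ.2 c M j)]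
        congr 1 with z
        simp only [onDirection]
        split_ifs <;> simp
      map_smul' := fun a φ => by
        simp only [occupationIntegral]
        rw [RingHom.id_apply, ← integral_smul]
        congr 1 with z
        simp only [onDirection]
        split_ifs <;> simp }
  obtain ⟨χ, hχ, hsum⟩ := sum_apply_motionOpTranspose (p := p) (q := q) (lam := lam) (c := c) f
    (fun j φ => by
      have hfw := h.forward_equation hl hM φ.2 c j
      have e1 : derivEnd (timeSlab M) ((velocity c j).1, (velocity c j).2, 1)
          = derivEnd (timeSlab M) (0, 0, 1)
            + derivEnd (timeSlab M) ((velocity c j).1, (velocity c j).2, 0) := by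
        ext ψ z
        change fderiv ℝ ψ.1 z _ = fderiv ℝ ψ.1 z _ + fderiv ℝ ψ.1 z _
        rw [← map_add]
        simp
      have e2 : occupationIntegral P c M J τ ξ j
          (fun z => fderiv ℝ φ.1 z ((velocity c j).1, (velocity c j).2, 1))
          = f j (derivEnd (timeSlab M) ((velocity c j).1, (velocity c j).2, 1) φ) := rfl
      rw [e2, e1] at hfw
      have e3 : ∀ i, occupationIntegral P c M J τ ξ i φ.1 = f i φ := fun i => rfl
      simp only [e3] at hfw
      simp only [LinearMap.add_apply, LinearMap.sub_apply, LinearMap.neg_apply, map_add, map_sub,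
        map_neg, LinearMap.smul_apply, Module.End.one_apply, map_smul, Complex.real_smul] at hfw ⊢
      linear_combination -hfw) ⟨φ, hφ⟩
  refine ⟨hχ ▸ χ.2, ?_⟩
  rw [← hχ]
  have e : ∑ j, f j χ = ((∫ z, χ.1 ((occupationState c J τ ξ z).2.1,
      (occupationState c J τ ξ z).2.2, z.2) ∂(P.prod (volume.restrict (Ioc 0 M))) : ℝ) : ℂ) := by
    change ∑ j, occupationIntegral P c M J τ ξ j χ.1 = _
    simp only [occupationIntegral]
    rw [← integral_finsetSum _ fun j _ => integrable_onDirection_occupationState h χ.2 c M j,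
      ← integral_complex_ofReal]
    congr 1 with z
    simp [onDirection]
  rw [e] at hsum
  exact_mod_cast hsum

end Forward

/-! ### The interior density is a weak solution -/

section InteriorDensity

variable {Ω : Type*} [MeasurableSpace Ω] {P : Measure Ω} {U : Set (ℝ × ℝ × ℝ)}
  {u φ : ℝ × ℝ × ℝ → ℝ} {p q lam c M t : ℝ} {Z : ℝ → Ω → ℝ × ℝ}

theorem isOpen_interiorRegion (p q c : ℝ) : IsOpen (interiorRegion p q c) := by
  have h1 : IsOpen {z : ℝ × ℝ × ℝ | |z.1| + |z.2.1| < c * z.2.2} :=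
    isOpen_lt (by fun_prop) (by fun_prop)
  by_cases h : p + q < 1
  · have h2 : IsOpen {z : ℝ × ℝ × ℝ | z.1 ≠ 0} := isOpen_ne_fun (by fun_prop) (by fun_prop)
    have h3 : IsOpen {z : ℝ × ℝ × ℝ | z.2.1 ≠ 0} := isOpen_ne_fun (by fun_prop) (by fun_prop)
    convert h1.inter (h2.inter h3) using 1
    ext z
    simp [interiorRegion, h]
  · convert h1 using 1
    ext z
    simp [interiorRegion, h]

theorem pos_of_mem_interiorRegion (hc : 0 < c) {z : ℝ × ℝ × ℝ} (hz : z ∈ interiorRegion p q c) :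
    0 < z.2.2 :=
  pos_of_mul_pos_right ((add_nonneg (abs_nonneg z.1) (abs_nonneg z.2.1)).trans_lt hz.1) hc.le

/-- The part of the interior region at time `t`. -/
def regionSlice (p q c t : ℝ) : Set (ℝ × ℝ) := {w | (w.1, w.2, t) ∈ interiorRegion p q c}

theorem measurableSet_regionSlice (p q c t : ℝ) : MeasurableSet (regionSlice p q c t) :=
  ((isOpen_interiorRegion p q c).preimage
    (f := fun w : ℝ × ℝ => (w.1, w.2, t)) (by fun_prop)).measurableSet

theorem IsInteriorDensity.measurable_slice (h : IsInteriorDensity P p q c Z u) (t : ℝ) :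
    Measurable fun w : ℝ × ℝ => u (w.1, w.2, t) :=
  h.measurable.comp (by fun_prop)

theorem IsInteriorDensity.restrict_law (h : IsInteriorDensity P p q c Z u) (ht : 0 < t)
    (hZ : AEMeasurable (Z t) P) : (P.map (Z t)).restrict (regionSlice p q c t)
      = (volume.restrict (regionSlice p q c t)).withDensity
        fun w => ENNReal.ofReal (u (w.1, w.2, t)) := by
  ext s hs
  have hA := measurableSet_regionSlice p q c t
  rw [Measure.restrict_apply hs, Measure.map_apply_of_aemeasurable hZ (hs.inter hA),
    withDensity_apply _ hs, Measure.restrict_restrict hs]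
  exact h.density t ht _ (hs.inter hA) fun w hw => hw.2

theorem IsInteriorDensity.integral_slice (h : IsInteriorDensity P p q c Z u) (ht : 0 < t)
    (hZ : AEMeasurable (Z t) P) (hφ : IsTestFunction (interiorRegion p q c) φ) :
    ∫ ω, φ ((Z t ω).1, (Z t ω).2, t) ∂P = ∫ w : ℝ × ℝ, u (w.1, w.2, t) * φ (w.1, w.2, t) := by
  have hc : Continuous fun w : ℝ × ℝ => φ (w.1, w.2, t) := hφ.continuous.comp (by fun_prop)
  have h0 : ∀ w, w ∉ regionSlice p q c t → φ (w.1, w.2, t) = 0 := fun w hw => hφ.eq_zero hw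
  rw [← integral_map (f := fun w : ℝ × ℝ => φ (w.1, w.2, t)) hZ hc.aestronglyMeasurable,
    ← setIntegral_eq_integral_of_forall_compl_eq_zero h0, h.restrict_law ht hZ,
    integral_withDensity_eq_integral_toReal_smul (h.measurable_slice t).ennreal_ofReal
      (ae_of_all _ fun _ => ENNReal.ofReal_lt_top),
    ← setIntegral_eq_integral_of_forall_compl_eq_zero (s := regionSlice p q c t)
      (f := fun w : ℝ × ℝ => u (w.1, w.2, t) * φ (w.1, w.2, t))
      fun w hw => by simp [h0 w hw]]
  refine setIntegral_congr_fun (measurableSet_regionSlice p q c t) fun w hw => ?_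
  simp only [smul_eq_mul]
  rw [ENNReal.toReal_ofReal (h.nonneg _ hw)]

theorem IsInteriorDensity.integrableOn [IsProbabilityMeasure P]
    (h : IsInteriorDensity P p q c Z u) (M : ℝ) :
    IntegrableOn u (interiorRegion p q c ∩ timeSlab M) := by
  have hR := (isOpen_interiorRegion p q c).measurableSet
  have hT : MeasurableSet (timeSlab M) :=
    (measurableSet_lt measurable_const measurable_snd.snd).inter
      (measurableSet_lt measurable_snd.snd measurable_const)
  refine ⟨h.measurable.aestronglyMeasurable, ?_⟩
  have e1 : ∫⁻ z in interiorRegion p q c ∩ timeSlab M, ‖u z‖ₑ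
      = ∫⁻ z, (interiorRegion p q c ∩ timeSlab M).indicator (fun z => ENNReal.ofReal (u z)) z := by
    rw [lintegral_indicator (hR.inter hT)]
    exact setLIntegral_congr_fun (hR.inter hT) fun z hz =>
      Real.enorm_of_nonneg (h.nonneg z hz.1)
  have hm : Measurable ((interiorRegion p q c ∩ timeSlab M).indicator
      fun z => ENNReal.ofReal (u z)) := h.measurable.ennreal_ofReal.indicator (hR.inter hT)
  rw [HasFiniteIntegral, e1, ← (volume_preserving_prodAssoc (α₁ := ℝ) (β₁ := ℝ)
    (γ₁ := ℝ)).lintegral_comp hm, Measure.volume_eq_prod,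
    lintegral_prod_symm' (fun z => (interiorRegion p q c ∩ timeSlab M).indicator
      (fun z => ENNReal.ofReal (u z)) (MeasurableEquiv.prodAssoc z))
      (hm.comp MeasurableEquiv.prodAssoc.measurable)]
  refine (lintegral_mono (g := (Ioo 0 M).indicator 1) fun t => ?_).trans_lt ?_
  · by_cases ht : t ∈ Ioo 0 M
    · rw [indicator_of_mem ht, Pi.one_apply]
      have e2 : ∀ w : ℝ × ℝ, (interiorRegion p q c ∩ timeSlab M).indicator
          (fun z => ENNReal.ofReal (u z)) (MeasurableEquiv.prodAssoc (w, t))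
          = (regionSlice p q c t).indicator (fun w => ENNReal.ofReal (u (w.1, w.2, t))) w := by
        intro w
        by_cases hw : w ∈ regionSlice p q c t
        · have hw' : MeasurableEquiv.prodAssoc (w, t) ∈ interiorRegion p q c ∩ timeSlab M :=
            ⟨hw, ht⟩
          rw [indicator_of_mem hw, indicator_of_mem hw']
          rfl
        · rw [indicator_of_notMem hw, indicator_of_notMem fun hw' => hw hw'.1]
      simp only [e2]
      rw [lintegral_indicator (measurableSet_regionSlice p q c t), ← h.density t ht.1 _
        (measurableSet_regionSlice p q c t) fun w hw => hw]
      exact prob_le_one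
    · have e2 : ∀ w : ℝ × ℝ, (interiorRegion p q c ∩ timeSlab M).indicator
          (fun z => ENNReal.ofReal (u z)) (MeasurableEquiv.prodAssoc (w, t)) = 0 := fun w =>
        indicator_of_notMem (fun hw => ht hw.2) _
      simp [e2]
  · rw [lintegral_indicator_one measurableSet_Ioo]
    simp

theorem IsInteriorDensity.locallyIntegrableOn [IsProbabilityMeasure P]
    (h : IsInteriorDensity P p q c Z u) (hc : 0 < c) :
    LocallyIntegrableOn u (interiorRegion p q c) := by
  intro z hz
  refine ⟨_, ?_, h.integrableOn (z.2.2 + 1)⟩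
  refine inter_mem_nhdsWithin _ (IsOpen.mem_nhds ?_ ⟨pos_of_mem_interiorRegion hc hz, by simp⟩)
  exact (isOpen_lt continuous_const continuous_snd.snd).inter
    (isOpen_lt continuous_snd.snd continuous_const)

theorem IsTestFunction.motionOpTranspose (hφ : IsTestFunction U φ) (p q lam c : ℝ) :
    IsTestFunction U (motionOpTranspose p q lam c φ) :=
  (motionElem (-derivEnd U (0, 0, 1) + lam • (1 : Module.End ℝ (testSpace U)))
    (derivEnd U (1, 0, 0)) (derivEnd U (0, 1, 0)) p q lam c ⟨φ, hφ⟩).2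

theorem IsTestFunction.exists_timeSlab (hc : 0 < c)
    (hφ : IsTestFunction (interiorRegion p q c) φ) :
    ∃ M, 0 ≤ M ∧ IsTestFunction (timeSlab M) φ := by
  obtain ⟨C, hC⟩ := hφ.2.1.isCompact.exists_bound_of_continuousOn
    (f := fun z : ℝ × ℝ × ℝ => z.2.2) (by fun_prop)
  refine ⟨|C| + 1, by positivity, hφ.1, hφ.2.1, fun z hz =>
    ⟨pos_of_mem_interiorRegion hc (hφ.2.2 hz), ?_⟩⟩
  linarith [(le_abs_self z.2.2).trans (hC z hz), le_abs_self C]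

/-- The interior density of the motion solves the fourth-order equation in the sense of
distributions: tested against a function supported in the interior region, it agrees with the
occupation measure of the motion. -/
theorem IsInteriorDensity.isWeakSolution [IsProbabilityMeasure P] {J : Ω → ZMod 4}
    {τ : ℕ → Ω → ℝ} {ξ : ℕ → Ω → ZMod 4} (hu : IsInteriorDensity P p q c (position c J τ ξ) u)
    (h : IsTurningMotion P p q lam J τ ξ) (hl : 0 < lam) (hc : 0 < c) :
    IsWeakSolution (motionOpTranspose p q lam c) (interiorRegion p q c) u := by
  refine ⟨hu.locallyIntegrableOn hc, fun φ hφ => ?_⟩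
  obtain ⟨M, hM, hφM⟩ := hφ.exists_timeSlab hc
  have hχ := hφ.motionOpTranspose p q lam c
  obtain ⟨hχM, h0⟩ := h.integral_motionOpTranspose hl hM hφM c
  set χ := motionOpTranspose p q lam c φ
  have hpos : ∀ t, 0 < t → AEMeasurable (position c J τ ξ t) P := fun t ht =>
    h.aemeasurable_position hl c ht.le
  obtain ⟨C, hC⟩ := hχ.exists_bound
  -- the test function vanishes outside the part of the region where the density is integrable
  have hint : Integrable fun z => u z * χ z := by
    have hi : IntegrableOn (fun z => u z * χ z) (interiorRegion p q c ∩ timeSlab M) :=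
      (hu.integrableOn M).mul_bdd hχ.continuous.aestronglyMeasurable (ae_of_all _ hC)
    refine (integrableOn_iff_integrable_of_support_subset fun z hz => ?_).1 hi
    by_contra hz'
    refine hz ?_
    rcases not_and_or.1 hz' with h1 | h1
    · simp [hχ.eq_zero h1]
    · simp [hχM.eq_zero h1]
  have hmp := volume_preserving_prodAssoc (α₁ := ℝ) (β₁ := ℝ) (γ₁ := ℝ)
  have hint' : Integrable fun z : (ℝ × ℝ) × ℝ =>
      u (z.1.1, z.1.2, z.2) * χ (z.1.1, z.1.2, z.2) :=
    (hmp.integrable_comp_emb MeasurableEquiv.prodAssoc.measurableEmbedding).2 hint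
  have hmeas : Measurable fun z : Ω × ℝ => χ ((occupationState c J τ ξ z).2.1,
      (occupationState c J τ ξ z).2.2, z.2) := by
    have hs := h.measurable_occupationState c
    exact hχ.continuous.measurable.comp (hs.snd.fst.prodMk (hs.snd.snd.prodMk measurable_snd))
  calc ∫ z, u z * χ z = ∫ z : (ℝ × ℝ) × ℝ, u (z.1.1, z.1.2, z.2) * χ (z.1.1, z.1.2, z.2) :=
        (hmp.integral_comp MeasurableEquiv.prodAssoc.measurableEmbedding _).symm
    _ = ∫ t, ∫ w : ℝ × ℝ, u (w.1, w.2, t) * χ (w.1, w.2, t) := by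
        rw [Measure.volume_eq_prod] at hint' ⊢
        exact integral_prod_symm _ hint'
    _ = ∫ t in Ioc 0 M, ∫ w : ℝ × ℝ, u (w.1, w.2, t) * χ (w.1, w.2, t) := by
        refine (setIntegral_eq_integral_of_forall_compl_eq_zero fun t ht => ?_).symm
        have : ∀ w : ℝ × ℝ, χ (w.1, w.2, t) = 0 := fun w =>
          hχM.eq_zero fun hw => ht ⟨hw.1, hw.2.le⟩
        simp [this]
    _ = ∫ t in Ioc 0 M, ∫ ω, χ ((occupationState c J τ ξ (ω, t)).2.1,
          (occupationState c J τ ξ (ω, t)).2.2, t) ∂P := by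
        refine setIntegral_congr_fun measurableSet_Ioc fun t ht => ?_
        rw [← hu.integral_slice ht.1 (hpos t ht.1) hχ]
        refine integral_congr_ae ?_
        filter_upwards [h.ae_nonexplosive hl] with ω hω
        rw [position_eq_stateAt hω c ht.1.le]
        rfl
    _ = 0 := by
        refine Eq.trans ?_ h0
        exact (integral_prod_symm _ (Integrable.of_bound hmeas.aestronglyMeasurable C
          (ae_of_all _ fun z => hC _))).symm

end InteriorDensity

/-! ### Expansion of the fourth-order operator -/

section Expansion

/-- The derivative in direction `v`. -/
def dirDeriv (v : ℝ × ℝ × ℝ) (f : ℝ × ℝ × ℝ → ℝ) : ℝ × ℝ × ℝ → ℝ := fun z => fderiv ℝ f z v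

variable {U : Set (ℝ × ℝ × ℝ)} {f g : ℝ × ℝ × ℝ → ℝ} {ι : Type*} [Fintype ι]

theorem Set.EqOn.dirDeriv (hU : IsOpen U) (h : EqOn f g U) (v : ℝ × ℝ × ℝ) :
    EqOn (dirDeriv v f) (dirDeriv v g) U := fun z hz => by
  have : f =ᶠ[𝓝 z] g := h.eventuallyEq_of_mem (hU.mem_nhds hz)
  simp only [_root_.dirDeriv, this.fderiv_eq]

theorem ContDiffOn.dirDeriv (hU : IsOpen U) {m n : WithTop ℕ∞} (h : ContDiffOn ℝ n f U)
    (hmn : m + 1 ≤ n) (v : ℝ × ℝ × ℝ) : ContDiffOn ℝ m (dirDeriv v f) U :=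
  (h.fderiv_of_isOpen hU hmn).clm_apply contDiffOn_const

theorem dirDeriv_sum (hU : IsOpen U) (s : ι → ℝ) {F : ι → ℝ × ℝ × ℝ → ℝ}
    (hF : ∀ i, ContDiffOn ℝ 1 (F i) U) (v : ℝ × ℝ × ℝ) :
    EqOn (dirDeriv v (∑ i, s i • F i)) (∑ i, s i • dirDeriv v (F i)) U := fun z hz => by
  have hd : ∀ i, DifferentiableAt ℝ (F i) z := fun i =>
    ((hF i).differentiableOn one_ne_zero).differentiableAt (hU.mem_nhds hz)
  simp only [dirDeriv, Finset.sum_apply, Pi.smul_apply]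
  rw [fderiv_sum fun i _ => (hd i).const_smul (s i)]
  simp [fderiv_const_smul (hd _)]

theorem dirDeriv_dirDeriv_sum (hU : IsOpen U) (s : ι → ℝ) {F : ι → ℝ × ℝ × ℝ → ℝ}
    (hF : ∀ i, ContDiffOn ℝ 2 (F i) U) (v : ℝ × ℝ × ℝ) :
    EqOn (dirDeriv v (dirDeriv v (∑ i, s i • F i))) (∑ i, s i • dirDeriv v (dirDeriv v (F i))) U :=
  ((dirDeriv_sum hU s (fun i => (hF i).of_le (by norm_num)) v).dirDeriv hU v).trans
    (dirDeriv_sum hU s (fun i => (hF i).dirDeriv hU (by norm_num) v) v)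

/-- The square of the operator `σ ∂/∂t + lam`. -/
theorem timeOp_timeOp (hU : IsOpen U) (hf : ContDiffOn ℝ 2 f U) (σ lam : ℝ) {z : ℝ × ℝ × ℝ}
    (hz : z ∈ U) : (σ • dT (σ • dT f + lam • f) + lam • (σ • dT f + lam • f)) z
      = σ ^ 2 * dT (dT f) z + 2 * σ * lam * dT f z + lam ^ 2 * f z := by
  have h := dirDeriv_sum hU ![σ, lam] (F := ![dT f, f]) (by
    intro i
    fin_cases i
    · exact hf.dirDeriv hU (by norm_num) _
    · exact hf.of_le (by norm_num)) (0, 0, 1) hz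
  simp only [Fin.sum_univ_two, Matrix.cons_val_zero, Matrix.cons_val_one] at h
  have e : dT (σ • dT f + lam • f) z = σ * dT (dT f) z + lam * dT f z := h
  simp only [Pi.add_apply, Pi.smul_apply, smul_eq_mul, e]
  ring

theorem timeOp_congr (hU : IsOpen U) (h : EqOn f g U) (σ lam : ℝ) :
    EqOn (σ • dT f + lam • f) (σ • dT g + lam • g) U := fun z hz => by
  have e : dT f z = dT g z := h.dirDeriv hU (0, 0, 1) hz
  simp only [Pi.add_apply, Pi.smul_apply, e, h hz]

/-- The derivatives that occur in the fourth-order operator, grouped by their coefficients. -/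
def derivTerms (u : ℝ × ℝ × ℝ → ℝ) : Fin 8 → ℝ × ℝ × ℝ → ℝ :=
  ![dT (dT (dT (dT u))), dT (dT (dT u)), dT (dT u), dT u,
    dT (dT (dY (dY u))) + dX (dX (dT (dT u))), dT (dY (dY u)) + dX (dX (dT u)), laplacian u,
    dX (dX (dY (dY u)))]

/-- The coefficients of `derivTerms` in `lam ^ (-3)` times the fourth-order operator with
`T = σ ∂/∂t + lam`, as functions of `ε = 1 / lam` and `ρ = c ^ 2 / lam`. -/
def derivCoeffs (σ p q ε ρ : ℝ) : Fin 8 → ℝ :=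
  ![σ ^ 4 * ε ^ 3, 4 * σ ^ 3 * ε ^ 2, (6 - 4 * p * q - 2 * (1 - p - q) ^ 2) * σ ^ 2 * ε,
    4 * (p + q) * ((1 - p) ^ 2 + (1 - q) ^ 2) * σ, -(σ ^ 2 * ρ * ε ^ 2), -(2 * σ * ρ * ε),
    -(ρ * (1 - (1 - p - q) ^ 2)), ρ ^ 2 * ε]

/-- The expansion of the fourth-order operator: the terms of order `lam ^ 4` cancel. The mixed
derivatives are kept in the order in which they arise. -/
theorem fourthOrderOp_eq (hU : IsOpen U) {u : ℝ × ℝ × ℝ → ℝ} (hu : ContDiffOn ℝ 4 u U)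
    (σ p q : ℝ) {lam : ℝ} (hl : 0 < lam) (c : ℝ) {z : ℝ × ℝ × ℝ} (hz : z ∈ U) :
    fourthOrderOp (fun v => σ • dT v + lam • v) p q lam c u z / lam ^ 3
      = ∑ i, derivCoeffs σ p q lam⁻¹ (c ^ 2 / lam) i * derivTerms u i z := by
  have hd : ∀ (f : ℝ × ℝ × ℝ → ℝ) (m n : WithTop ℕ∞) (v : ℝ × ℝ × ℝ), ContDiffOn ℝ n f U →
      m + 1 ≤ n → ContDiffOn ℝ m (dirDeriv v f) U := fun f m n v h hmn => h.dirDeriv hU hmn v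
  have h2 : ContDiffOn ℝ 2 u U := hu.of_le (by norm_num)
  have hT3 : ContDiffOn ℝ 3 (dT u) U := hd _ 3 4 _ hu (by norm_num)
  have hT2 : ContDiffOn ℝ 2 (dT u) U := hT3.of_le (by norm_num)
  have hTT : ContDiffOn ℝ 2 (dT (dT u)) U := hd _ 2 3 _ hT3 (by norm_num)
  have hY3 : ContDiffOn ℝ 3 (dY u) U := hd _ 3 4 _ hu (by norm_num)
  have hYY : ContDiffOn ℝ 2 (dY (dY u)) U := hd _ 2 3 _ hY3 (by norm_num)
  set s : Fin 4 → ℝ := ![σ ^ 2, 2 * σ * lam, lam ^ 2, -c ^ 2] with hs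
  set F : Fin 4 → ℝ × ℝ × ℝ → ℝ := ![dT (dT u), dT u, u, dY (dY u)] with hF
  have hF2 : ∀ i, ContDiffOn ℝ 2 (F i) U := by
    intro i
    fin_cases i
    exacts [hTT, hT2, h2, hYY]
  have hF1 : ∀ i, ContDiffOn ℝ 1 (F i) U := fun i => (hF2 i).of_le (by norm_num)
  set TTu := σ • dT (σ • dT u + lam • u) + lam • (σ • dT u + lam • u) with hTTu
  set w := TTu - c ^ 2 • dY (dY u) with hw
  set w' : ℝ × ℝ × ℝ → ℝ := ∑ i, s i • F i with hw'
  have hww : EqOn w w' U := fun y hy => by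
    have e1 : TTu y = _ := timeOp_timeOp hU h2 σ lam hy
    simp only [hw, hw', Pi.sub_apply, e1, Fin.sum_univ_four, Pi.add_apply, Pi.smul_apply, hs, hF,
      smul_eq_mul, Matrix.cons_val]
    ring
  have hw2 : ContDiffOn ℝ 2 w' U := by
    have : w' = fun y => ∑ i, s i * F i y := by
      funext y; simp [hw']
    rw [this]
    exact ContDiffOn.sum fun i _ => contDiffOn_const.mul (hF2 i)
  -- the square of the time operator and the second derivative of `w`, expanded
  have hTTw : (σ • dT (σ • dT w + lam • w) + lam • (σ • dT w + lam • w)) z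
      = σ ^ 2 * dT (dT w') z + 2 * σ * lam * dT w' z + lam ^ 2 * w' z := by
    rw [← timeOp_timeOp hU hw2 σ lam hz]
    exact timeOp_congr hU (timeOp_congr hU hww σ lam) σ lam hz
  have hXXw : dX (dX w) z = dX (dX w') z := (hww.dirDeriv hU (1, 0, 0)).dirDeriv hU (1, 0, 0) hz
  have e1 : dT w' z = ∑ i, s i * dT (F i) z := by
    have := dirDeriv_sum hU s hF1 (0, 0, 1) hz
    simp only [Finset.sum_apply, Pi.smul_apply, smul_eq_mul] at this
    exact this
  have e2 : dT (dT w') z = ∑ i, s i * dT (dT (F i)) z := by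
    have := dirDeriv_dirDeriv_sum hU s hF2 (0, 0, 1) hz
    simp only [Finset.sum_apply, Pi.smul_apply, smul_eq_mul] at this
    exact this
  have e3 : dX (dX w') z = ∑ i, s i * dX (dX (F i)) z := by
    have := dirDeriv_dirDeriv_sum hU s hF2 (1, 0, 0) hz
    simp only [Finset.sum_apply, Pi.smul_apply, smul_eq_mul] at this
    exact this
  have e4 : w' z = ∑ i, s i * F i z := by simp [hw']
  have e5 : TTu z = _ := timeOp_timeOp hU h2 σ lam hz
  have expand : fourthOrderOp (fun v => σ • dT v + lam • v) p q lam c u z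
      = (σ • dT (σ • dT w + lam • w) + lam • (σ • dT w + lam • w)) z - c ^ 2 * dX (dX w) z
        - (4 * lam ^ 2 * p * q) * TTu z
        - (lam ^ 2 * (1 - p - q) ^ 2) * (2 * TTu z - c ^ 2 * laplacian u z)
        - (4 * lam ^ 3 * (p ^ 2 + q ^ 2) * (1 - p - q)) * (σ * dT u z + lam * u z)
        + (lam ^ 4 * ((1 - p - q) ^ 2 - 2 * p * q) ^ 2) * u z
        - (lam ^ 4 * (p ^ 2 + q ^ 2) ^ 2) * u z := rfl
  rw [expand, hTTw, hXXw, e1, e2, e3, e4, e5]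
  simp only [hs, hF, Fin.sum_univ_four, Fin.sum_univ_eight, derivCoeffs, derivTerms,
    Matrix.cons_val, Pi.add_apply, laplacian]
  field_simp
  ring

theorem continuousOn_derivTerms (hU : IsOpen U) {u : ℝ × ℝ × ℝ → ℝ} (hu : ContDiffOn ℝ 4 u U)
    (i : Fin 8) : ContinuousOn (derivTerms u i) U := by
  have hd : ∀ (f : ℝ × ℝ × ℝ → ℝ) (m n : WithTop ℕ∞) (v : ℝ × ℝ × ℝ), ContDiffOn ℝ n f U →
      m + 1 ≤ n → ContDiffOn ℝ m (dirDeriv v f) U := fun f m n v h hmn => h.dirDeriv hU hmn v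
  have h3 : ∀ v, ContDiffOn ℝ 3 (dirDeriv v u) U := fun v => hd _ 3 4 _ hu (by norm_num)
  have h2 : ∀ v w, ContDiffOn ℝ 2 (dirDeriv v (dirDeriv w u)) U := fun v w =>
    hd _ 2 3 _ (h3 w) (by norm_num)
  have h1 : ∀ v w x, ContDiffOn ℝ 1 (dirDeriv v (dirDeriv w (dirDeriv x u))) U := fun v w x =>
    hd _ 1 2 _ (h2 w x) (by norm_num)
  have h0 : ∀ v w x y, ContinuousOn (dirDeriv v (dirDeriv w (dirDeriv x (dirDeriv y u)))) U :=
    fun v w x y => (hd _ 0 1 _ (h1 w x y) (by norm_num)).continuousOn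
  fin_cases i
  · exact h0 _ _ _ _
  · exact (h1 _ _ _).continuousOn
  · exact (h2 _ _).continuousOn
  · exact (h3 _).continuousOn
  · exact (h0 _ _ _ _).add (h0 _ _ _ _)
  · exact (h1 _ _ _).continuousOn.add (h1 _ _ _).continuousOn
  · exact (h2 _ _).continuousOn.add (h2 _ _).continuousOn
  · exact h0 _ _ _ _

theorem tendstoLocallyUniformlyOn_sum_mul {X : Type*} [TopologicalSpace X] {K : Set X}
    {a : ℕ → ι → ℝ} {A : ι → ℝ} {F : ι → X → ℝ} (ha : ∀ i, Tendsto (fun n => a n i) atTop (𝓝 (A i)))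
    (hF : ∀ i, ContinuousOn (F i) K) :
    TendstoLocallyUniformlyOn (fun n z => ∑ i, a n i * F i z) (fun z => ∑ i, A i * F i z)
      atTop K := by
  rw [Metric.tendstoLocallyUniformlyOn_iff]
  intro ε hε x hx
  -- a neighbourhood of `x` on which all the functions are bounded
  refine ⟨{y | ∀ i, |F i y| < |F i x| + 1}, ?_, ?_⟩
  · rw [ofPred_forall]
    refine (Filter.iInter_mem).2 fun i => ?_
    exact ((hF i) x hx).abs.eventually (gt_mem_nhds (lt_add_one _))
  · have hlim : Tendsto (fun n => ∑ i, |A i - a n i| * (|F i x| + 1)) atTop (𝓝 0) := by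
      have : ∀ i, Tendsto (fun n => |A i - a n i| * (|F i x| + 1)) atTop (𝓝 0) := fun i => by
        have h := ((tendsto_const_nhds (x := A i)).sub (ha i)).abs.mul_const (|F i x| + 1)
        simpa using h
      simpa using tendsto_finsetSum Finset.univ fun i _ => this i
    filter_upwards [hlim.eventually (gt_mem_nhds hε)] with n hn y hy
    refine lt_of_le_of_lt ?_ hn
    rw [Real.dist_eq, ← Finset.sum_sub_distrib]
    refine (Finset.abs_sum_le_sum_abs _ _).trans (Finset.sum_le_sum fun i _ => ?_)
    rw [← sub_mul, abs_mul]
    exact mul_le_mul_of_nonneg_left (hy i).le (abs_nonneg _)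


theorem motionOp_eq (p q lam c : ℝ) (u : ℝ × ℝ × ℝ → ℝ) :
    motionOp p q lam c u = fourthOrderOp (fun v => (1 : ℝ) • dT v + lam • v) p q lam c u := by
  simp only [motionOp, one_smul]

theorem motionOpTranspose_eq (p q lam c : ℝ) (u : ℝ × ℝ × ℝ → ℝ) :
    motionOpTranspose p q lam c u
      = fourthOrderOp (fun v => (-1 : ℝ) • dT v + lam • v) p q lam c u := by
  simp only [motionOpTranspose, neg_one_smul]

end Expansion

section Limit

variable {p q : ℝ} {lam c : ℕ → ℝ}

theorem continuous_derivCoeffs (σ p q : ℝ) :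
    ∀ i, Continuous fun x : ℝ × ℝ => derivCoeffs σ p q x.1 x.2 i := by
  refine continuous_pi_iff.1 ?_
  unfold derivCoeffs
  fun_prop

theorem tendsto_derivCoeffs (hlam : Tendsto lam atTop atTop)
    (hratio : Tendsto (fun n => c n ^ 2 / lam n) atTop (𝓝 1)) (σ p q : ℝ) (i : Fin 8) :
    Tendsto (fun n => derivCoeffs σ p q (lam n)⁻¹ (c n ^ 2 / lam n) i) atTop
      (𝓝 (derivCoeffs σ p q 0 1 i)) := by
  have h : Tendsto (fun x : ℝ × ℝ => derivCoeffs σ p q x.1 x.2 i) (𝓝 ((0 : ℝ), (1 : ℝ)))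
      (𝓝 (derivCoeffs σ p q 0 1 i)) := (continuous_derivCoeffs σ p q i).tendsto _
  have ht : Tendsto (fun n => ((lam n)⁻¹, c n ^ 2 / lam n)) atTop (𝓝 ((0 : ℝ), (1 : ℝ))) :=
    (tendsto_inv_atTop_zero.comp hlam).prodMk_nhds hratio
  exact Tendsto.comp (f := fun n => ((lam n)⁻¹, c n ^ 2 / lam n))
    (g := fun x : ℝ × ℝ => derivCoeffs σ p q x.1 x.2 i) h ht

theorem sq_add_sq_pos_of_add_le_one (hpq : p + q ≤ 1) : 0 < (1 - p) ^ 2 + (1 - q) ^ 2 := by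
  nlinarith [sq_nonneg (p - q), sq_nonneg (p + q - 1)]

/-- The terms that survive in the limit form a multiple of the heat operator. -/
theorem sum_derivCoeffs_zero_one (hpq : p + q ≤ 1) (σ : ℝ) (u : ℝ × ℝ × ℝ → ℝ) (z : ℝ × ℝ × ℝ) :
    ∑ i, derivCoeffs σ p q 0 1 i * derivTerms u i z
      = 4 * (p + q) * ((1 - p) ^ 2 + (1 - q) ^ 2)
        * (σ * dT u z - diffusionCoeff p q * laplacian u z) := by
  have h := (sq_add_sq_pos_of_add_le_one hpq).ne'
  simp only [Fin.sum_univ_eight, derivCoeffs, derivTerms, Matrix.cons_val, diffusionCoeff]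
  field_simp
  ring

theorem tendstoLocallyUniformlyOn_motionOp (hpq : p + q ≤ 1) (hlam_pos : ∀ n, 0 < lam n)
    (hlam : Tendsto lam atTop atTop)
    (hratio : Tendsto (fun n => c n ^ 2 / lam n) atTop (𝓝 1)) {U : Set (ℝ × ℝ × ℝ)}
    {u : ℝ × ℝ × ℝ → ℝ} (hU : IsOpen U) (hu : ContDiffOn ℝ 4 u U) :
    TendstoLocallyUniformlyOn (fun n z => motionOp p q (lam n) (c n) u z / lam n ^ 3)
      (fun z => 4 * (p + q) * ((1 - p) ^ 2 + (1 - q) ^ 2) * heatOp (diffusionCoeff p q) u z)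
      atTop U := by
  refine ((tendstoLocallyUniformlyOn_sum_mul (tendsto_derivCoeffs hlam hratio 1 p q)
    (continuousOn_derivTerms hU hu)).congr fun n z hz => ?_).congr_right fun z _ => ?_
  · simp only [motionOp_eq]
    exact (fourthOrderOp_eq hU hu 1 p q (hlam_pos n) (c n) hz).symm
  · simp only [sum_derivCoeffs_zero_one hpq, heatOp, one_mul, Pi.sub_apply, Pi.smul_apply,
      smul_eq_mul]

theorem isTestFunction_derivTerms {U : Set (ℝ × ℝ × ℝ)} {φ : ℝ × ℝ × ℝ → ℝ}
    (hφ : IsTestFunction U φ) (i : Fin 8) : IsTestFunction U (derivTerms φ i) := by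
  have hd : ∀ (v : ℝ × ℝ × ℝ) (f : ℝ × ℝ × ℝ → ℝ), IsTestFunction U f →
      IsTestFunction U (dirDeriv v f) := fun v f hf => hf.fderiv_apply v
  have hs : ∀ f g : ℝ × ℝ × ℝ → ℝ, IsTestFunction U f → IsTestFunction U g →
      IsTestFunction U (f + g) := fun f g hf hg => (testSpace U).add_mem hf hg
  fin_cases i
  · exact hd _ _ (hd _ _ (hd _ _ (hd _ _ hφ)))
  · exact hd _ _ (hd _ _ (hd _ _ hφ))
  · exact hd _ _ (hd _ _ hφ)
  · exact hd _ _ hφ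
  · exact hs _ _ (hd _ _ (hd _ _ (hd _ _ (hd _ _ hφ)))) (hd _ _ (hd _ _ (hd _ _ (hd _ _ hφ))))
  · exact hs _ _ (hd _ _ (hd _ _ (hd _ _ hφ))) (hd _ _ (hd _ _ (hd _ _ hφ)))
  · exact hs _ _ (hd _ _ (hd _ _ hφ)) (hd _ _ (hd _ _ hφ))
  · exact hd _ _ (hd _ _ (hd _ _ (hd _ _ hφ)))

theorem LocallyIntegrableOn.integrable_mul_isTestFunction {U : Set (ℝ × ℝ × ℝ)}
    {u φ : ℝ × ℝ × ℝ → ℝ} (hu : LocallyIntegrableOn u U) (hφ : IsTestFunction U φ) :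
    Integrable fun z => u z * φ z := by
  have hK : IsCompact (tsupport φ) := hφ.2.1
  have h1 : IntegrableOn (fun z => u z * φ z) (tsupport φ) :=
    (hu.integrableOn_compact_subset hφ.2.2 hK).mul_continuousOn hφ.continuous.continuousOn hK
  refine (integrableOn_iff_integrable_of_support_subset fun z hz => ?_).1 h1
  exact subset_tsupport φ fun h => hz (by simp [h])

/-- The equations pass to the limit term by term, as each of them tests a fixed finite number of
derivatives of the test function with convergent coefficients. -/
theorem isWeakSolution_heatOpTranspose (hpq : p + q ≤ 1) (hpq0 : 0 < p + q)
    (hlam_pos : ∀ n, 0 < lam n) (hlam : Tendsto lam atTop atTop)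
    (hratio : Tendsto (fun n => c n ^ 2 / lam n) atTop (𝓝 1)) {U : Set (ℝ × ℝ × ℝ)}
    {v : ℕ → ℝ × ℝ × ℝ → ℝ} {u : ℝ × ℝ × ℝ → ℝ}
    (hv : ∀ n, IsWeakSolution (motionOpTranspose p q (lam n) (c n)) U (v n))
    (hu : LocallyIntegrableOn u U)
    (hlim : ∀ φ, IsTestFunction U φ →
      Tendsto (fun n => ∫ z, v n z * φ z) atTop (𝓝 (∫ z, u z * φ z))) :
    IsWeakSolution (heatOpTranspose (diffusionCoeff p q)) U u := by
  refine ⟨hu, fun φ hφ => ?_⟩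
  have hterm := isTestFunction_derivTerms hφ
  have hsum : ∀ (w : ℝ × ℝ × ℝ → ℝ) (a : Fin 8 → ℝ), LocallyIntegrableOn w U →
      ∫ z, w z * ∑ i, a i * derivTerms φ i z = ∑ i, a i * ∫ z, w z * derivTerms φ i z := by
    intro w a hw
    simp_rw [Finset.mul_sum, ← integral_const_mul]
    rw [← integral_finsetSum _ fun i _ =>
      (LocallyIntegrableOn.integrable_mul_isTestFunction hw (hterm i)).const_mul (a i)]
    exact integral_congr_ae (.of_forall fun z => Finset.sum_congr rfl fun i _ => by ring)
  have hzero : ∀ n, ∑ i, derivCoeffs (-1) p q (lam n)⁻¹ (c n ^ 2 / lam n) i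
      * ∫ z, v n z * derivTerms φ i z = 0 := fun n => by
    rw [← hsum (v n) _ (hv n).1]
    have h := (hv n).2 φ hφ
    have e : ∀ z, v n z * ∑ i, derivCoeffs (-1) p q (lam n)⁻¹ (c n ^ 2 / lam n) i
        * derivTerms φ i z = v n z * motionOpTranspose p q (lam n) (c n) φ z / lam n ^ 3 := by
      intro z
      have h4 : ContDiff ℝ 4 φ := hφ.1.of_le (WithTop.coe_le_coe.2 (le_top : ((4 : ℕ) : ℕ∞) ≤ ⊤))
      rw [← fourthOrderOp_eq isOpen_univ h4.contDiffOn (-1) p q (hlam_pos n) (c n) (mem_univ z),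
        motionOpTranspose_eq, mul_div_assoc]
    simp_rw [e, integral_div, h, zero_div]
  have hL : Tendsto (fun n => ∑ i, derivCoeffs (-1) p q (lam n)⁻¹ (c n ^ 2 / lam n) i
      * ∫ z, v n z * derivTerms φ i z) atTop
      (𝓝 (∑ i, derivCoeffs (-1) p q 0 1 i * ∫ z, u z * derivTerms φ i z)) :=
    tendsto_finsetSum _ fun i _ =>
      (tendsto_derivCoeffs hlam hratio (-1) p q i).mul (hlim _ (hterm i))
  simp_rw [hzero] at hL
  have h0 := tendsto_nhds_unique hL tendsto_const_nhds
  rw [← hsum u _ hu] at h0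
  simp_rw [sum_derivCoeffs_zero_one hpq, mul_left_comm (u _), integral_const_mul] at h0
  have hK := (sq_add_sq_pos_of_add_le_one hpq).ne'
  have h1 := (mul_eq_zero.1 h0).resolve_left (by positivity)
  rw [← h1]
  refine integral_congr_ae (.of_forall fun z => ?_)
  simp [heatOpTranspose]

end Limit

/-! ### The maximal diffusion coefficient -/

theorem diffusionCoeff_half : diffusionCoeff (1 / 2) (1 / 2) = 1 / 2 := by
  norm_num [diffusionCoeff]

/-- The deficit of the diffusion coefficient as a sum of nonnegative terms. -/
theorem half_sub_diffusionCoeff {p q : ℝ} (hpq : p + q ≤ 1) :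
    1 / 2 - diffusionCoeff p q
      = ((p - q) ^ 2 + (1 - (p + q)) * (2 - (p + q))) / (4 * ((1 - p) ^ 2 + (1 - q) ^ 2)) := by
  have h := (sq_add_sq_pos_of_add_le_one hpq).ne'
  rw [diffusionCoeff]
  field_simp
  ring

theorem diffusionCoeff_le_half {p q : ℝ} (hpq : p + q ≤ 1) :
    diffusionCoeff p q ≤ diffusionCoeff (1 / 2) (1 / 2) := by
  rw [diffusionCoeff_half, ← sub_nonneg, half_sub_diffusionCoeff hpq]
  have h : 0 ≤ (1 - (p + q)) * (2 - (p + q)) := mul_nonneg (by linarith) (by linarith)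
  positivity

theorem diffusionCoeff_eq_half_iff {p q : ℝ} (hpq : p + q ≤ 1) :
    diffusionCoeff p q = diffusionCoeff (1 / 2) (1 / 2) ↔ p = 1 / 2 ∧ q = 1 / 2 := by
  refine ⟨fun h => ?_, fun h => by rw [h.1, h.2]⟩
  have hpos := sq_add_sq_pos_of_add_le_one hpq
  have h0 := half_sub_diffusionCoeff hpq
  rw [h, diffusionCoeff_half, sub_self, eq_comm, div_eq_zero_iff] at h0
  have h1 := h0.resolve_right (by positivity)
  have h2 : 0 ≤ (1 - (p + q)) * (2 - (p + q)) := mul_nonneg (by linarith) (by linarith)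
  have h3 : p - q = 0 := pow_eq_zero_iff two_ne_zero |>.1 (by nlinarith [sq_nonneg (p - q)])
  have h4 : (1 - (p + q)) * (2 - (p + q)) = 0 := by nlinarith [sq_nonneg (p - q)]
  have h5 : 1 - (p + q) = 0 := (mul_eq_zero.1 h4).resolve_right (by linarith)
  constructor <;> linarith

/-! ### The corrector -/

section Corrector

/-- The component of the unit vector in direction `j` along `(x, y)`. -/
def dirComponent (x y : ℝ) (j : ZMod 4) : ℝ := x * (velocity 1 j).1 + y * (velocity 1 j).2

theorem mul_velocity (c x y : ℝ) (j : ZMod 4) :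
    x * (velocity c j).1 + y * (velocity c j).2 = c * dirComponent x y j := by
  simp only [dirComponent, velocity]
  ring

theorem dirComponent_add_one (x y : ℝ) (j : ZMod 4) :
    dirComponent x y (j + 1) = dirComponent y (-x) j := by
  simp only [dirComponent, velocity_add_one]
  ring

theorem dirComponent_add_two (x y : ℝ) (j : ZMod 4) :
    dirComponent x y (j + 2) = -dirComponent x y j := by
  rw [show j + 2 = j + 1 + 1 by ring, dirComponent_add_one, dirComponent_add_one]
  simp only [dirComponent]
  ring

theorem dirComponent_sub_one (x y : ℝ) (j : ZMod 4) :
    dirComponent x y (j - 1) = -dirComponent y (-x) j := by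
  have h := dirComponent_add_one y (-x) (j - 1)
  rw [sub_add_cancel] at h
  rw [h]
  simp only [dirComponent]
  ring

theorem dirComponent_sq_add_sq (x y : ℝ) (j : ZMod 4) :
    dirComponent x y j ^ 2 + dirComponent y (-x) j ^ 2 = x ^ 2 + y ^ 2 := by
  simp only [dirComponent, velocity]
  linear_combination (x ^ 2 + y ^ 2) * Real.cos_sq_add_sin_sq (Real.pi / 2 * (j.val : ℝ))

/-- The two equations for the corrector of order one and two.  The first one is solved by a linear
function of the direction, as the turns commute with rotations; the right-hand side of the second
one changes its sign under a quarter turn, precisely because `diffusionCoeff p q` is the effective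
diffusion coefficient, and hence is a multiple of its image under the averaged turns minus
itself. -/
theorem exists_corrector {p q : ℝ} (hpq : p + q ≤ 1) (hpq0 : 0 < p + q) (x y : ℝ) :
    ∃ a b : ZMod 4 → ℝ, ∀ j,
      p * a (j + 1) + q * a (j - 1) + (1 - p - q) * a (j + 2) - a j = -dirComponent x y j ∧
      p * b (j + 1) + q * b (j - 1) + (1 - p - q) * b (j + 2) - b j
        = dirComponent x y j * a j - diffusionCoeff p q * (x ^ 2 + y ^ 2) := by
  have hN := (sq_add_sq_pos_of_add_le_one hpq).ne'
  have hpq0' := hpq0.ne'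
  set N := (1 - p) ^ 2 + (1 - q) ^ 2 with hNdef
  set β := (p - q) / (2 * N) with hβ
  have hα : 2 * diffusionCoeff p q = (2 - p - q) / (2 * N) := by
    rw [diffusionCoeff, ← hNdef]; field_simp; ring
  set D := diffusionCoeff p q with hD
  have h1 : 2 * D * (2 - p - q) + β * (p - q) = 1 := by
    rw [hα, hβ]; field_simp; rw [hNdef]; ring
  have h2 : 2 * D * (p - q) = β * (2 - p - q) := by
    rw [hα, hβ]; ring
  set e : ZMod 4 → ℝ := dirComponent x y with he
  set f : ZMod 4 → ℝ := dirComponent y (-x) with hf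
  have e1 : ∀ j, e (j + 1) = f j := dirComponent_add_one x y
  have e2 : ∀ j, e (j - 1) = -f j := dirComponent_sub_one x y
  have e3 : ∀ j, e (j + 2) = -e j := dirComponent_add_two x y
  have hneg : ∀ j, dirComponent (-x) (-y) j = -e j := fun j => by
    simp only [he, dirComponent]; ring
  have f1 : ∀ j, f (j + 1) = -e j := fun j => (dirComponent_add_one y (-x) j).trans (hneg j)
  have f2 : ∀ j, f (j - 1) = e j := fun j => by
    rw [hf, dirComponent_sub_one, hneg, neg_neg]
  have f3 : ∀ j, f (j + 2) = -f j := dirComponent_add_two y (-x)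
  have hs : ∀ j, e j ^ 2 + f j ^ 2 = x ^ 2 + y ^ 2 := dirComponent_sq_add_sq x y
  refine ⟨fun j => 2 * D * e j + β * f j,
    fun j => -(D * (e j ^ 2 - f j ^ 2) + β * e j * f j) / (2 * (p + q)), fun j => ⟨?_, ?_⟩⟩
  · simp only [e1, e2, e3, f1, f2, f3]
    linear_combination (-e j) * h1 + f j * h2
  · simp only [e1, e2, e3, f1, f2, f3]
    rw [← hs j]
    field_simp
    ring

end Corrector

/-! ### The phase of a trajectory -/

section Phase

variable {ι : Type*} [Fintype ι]

/-- The displacement function of the sum, with weights `(θ i, η i)`, of the positions at the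
times `T i`, each frozen after its time `T i`. -/
def phaseDisplacement (T θ η : ι → ℝ) (c : ℝ) (j : ZMod 4) (r : ℝ) : ℝ :=
  ∑ i, min r (T i) * (c * dirComponent (θ i) (η i) j)

/-- The velocity of the phase in direction `j` at time `r`. -/
def phaseVelocity (T θ η : ι → ℝ) (c : ℝ) (j : ZMod 4) (r : ℝ) : ℝ :=
  ∑ i, if r ≤ T i then c * dirComponent (θ i) (η i) j else 0

variable {T θ η : ι → ℝ} {c : ℝ}

theorem continuous_phaseDisplacement (j : ZMod 4) : Continuous (phaseDisplacement T θ η c j) := by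
  unfold phaseDisplacement
  fun_prop

theorem measurable_phaseVelocity (j : ZMod 4) : Measurable (phaseVelocity T θ η c j) := by
  unfold phaseVelocity
  exact Finset.measurable_sum _ fun i _ =>
    Measurable.ite measurableSet_Iic measurable_const measurable_const

theorem exists_abs_phaseVelocity_le : ∃ C, ∀ j r, |phaseVelocity T θ η c j r| ≤ C := by
  refine ⟨∑ j, ∑ i, |c * dirComponent (θ i) (η i) j|, fun j r => ?_⟩
  refine le_trans ?_ (Finset.single_le_sum
    (f := fun j => ∑ i, |c * dirComponent (θ i) (η i) j|)
    (fun j _ => Finset.sum_nonneg fun i _ => abs_nonneg _) (Finset.mem_univ j))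
  refine (Finset.abs_sum_le_sum_abs _ _).trans (Finset.sum_le_sum fun i _ => ?_)
  split_ifs
  · exact le_rfl
  · rw [abs_zero]
    exact abs_nonneg _

theorem hasDerivAt_phaseDisplacement (j : ZMod 4) {r : ℝ} (hr : r ∉ range T) :
    HasDerivAt (phaseDisplacement T θ η c j) (phaseVelocity T θ η c j r) r := by
  unfold phaseDisplacement phaseVelocity
  refine HasDerivAt.fun_sum fun i _ => ?_
  rcases lt_or_gt_of_ne (fun h : r = T i => hr ⟨i, h.symm⟩) with h | h
  · rw [if_pos h.le]
    have h1 : HasDerivAt (fun s : ℝ => s * (c * dirComponent (θ i) (η i) j))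
        (c * dirComponent (θ i) (η i) j) r := by
      simpa using (hasDerivAt_id r).mul_const (c * dirComponent (θ i) (η i) j)
    refine h1.congr_of_eventuallyEq ?_
    filter_upwards [gt_mem_nhds h] with s hs
    rw [min_eq_left hs.le]
  · rw [if_neg (not_le.2 h)]
    refine (hasDerivAt_const r (T i * (c * dirComponent (θ i) (η i) j))).congr_of_eventuallyEq ?_
    filter_upwards [lt_mem_nhds h] with s hs
    rw [min_eq_right hs.le]

theorem continuousAt_phaseVelocity (j : ZMod 4) {r : ℝ} (hr : r ∉ range T) :
    ContinuousAt (phaseVelocity T θ η c j) r := by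
  unfold phaseVelocity
  refine tendsto_finsetSum _ fun i _ => ?_
  rcases lt_or_gt_of_ne (fun h : r = T i => hr ⟨i, h.symm⟩) with h | h
  · refine tendsto_const_nhds.congr' ?_
    filter_upwards [gt_mem_nhds h] with s hs
    rw [if_pos h.le, if_pos hs.le]
  · refine tendsto_const_nhds.congr' ?_
    filter_upwards [lt_mem_nhds h] with s hs
    rw [if_neg (not_le.2 h), if_neg (not_le.2 hs)]

/-- The phase at time `t` is the weighted sum of the positions at the times `min t (T i)`. -/
theorem stateAt_phaseDisplacement {Ω : Type*} {J : Ω → ZMod 4} {τ : ℕ → Ω → ℝ}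
    {ξ : ℕ → Ω → ZMod 4} {ω : Ω} (h : IsNonexplosive fun k => (τ k ω, ξ k ω))
    (hT : ∀ i, 0 ≤ T i) {t : ℝ} (ht : 0 ≤ t) :
    (stateAt (phaseDisplacement T θ η c) (J ω) (fun k => (τ k ω, ξ k ω)) t).2
      = ∑ i, (θ i * (position c J τ ξ (min t (T i)) ω).1
        + η i * (position c J τ ξ (min t (T i)) ω).2) := by
  obtain ⟨K, hK⟩ := h.2 t
  rw [h.stateAt_displacement _ _ ht hK]
  have hpos : ∀ i, position c J τ ξ (min t (T i)) ω = _ := fun i =>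
    (position_eq_stateAt h c (le_min ht (hT i))).trans
      (h.stateAt_displacement _ _ (le_min ht (hT i)) ((min_le_left _ _).trans_lt hK))
  simp only [hpos, Prod.fst_sum, Prod.snd_sum, Finset.mul_sum, phaseDisplacement,
    ← Finset.sum_sub_distrib, ← Finset.sum_add_distrib]
  rw [Finset.sum_comm]
  refine Finset.sum_congr rfl fun i _ => Finset.sum_congr rfl fun k _ => ?_
  simp only [← mul_velocity, Prod.fst_sub, Prod.snd_sub, Prod.smul_fst, Prod.smul_snd, smul_eq_mul,
    min_right_comm]
  ring

/-- The exponential of the phase, with amplitude `ℓ j` in direction `j`, growing at rate `κ`. -/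
def phaseFun (κ : ℝ) (ℓ : ZMod 4 → ℂ) (j : ZMod 4) (w r : ℝ) : ℂ :=
  Complex.exp (w * Complex.I + (κ * r : ℝ)) * ℓ j

/-- The generator of the motion applied to `phaseFun`. -/
def phaseGen (p q lam : ℝ) (T θ η : ι → ℝ) (c κ : ℝ) (ℓ : ZMod 4 → ℂ) (j : ZMod 4) (w r : ℝ) : ℂ :=
  Complex.exp (w * Complex.I + (κ * r : ℝ))
    * ((phaseVelocity T θ η c j r * Complex.I + κ) * ℓ j + lam * (turnMean p q ℓ j - ℓ j))

theorem norm_exp_phase (κ w r : ℝ) :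
    ‖Complex.exp (w * Complex.I + (κ * r : ℝ))‖ = Real.exp (κ * r) := by
  rw [Complex.norm_exp]
  simp

theorem norm_exp_phase_le {κ r M : ℝ} (hκ : 0 ≤ κ) (hr : r ≤ M) (w : ℝ) :
    ‖Complex.exp (w * Complex.I + (κ * r : ℝ))‖ ≤ Real.exp (κ * M) := by
  rw [norm_exp_phase]
  exact Real.exp_le_exp.2 (mul_le_mul_of_nonneg_left hr hκ)

theorem isGeneratorPair_phaseFun (p q lam M : ℝ) (T θ η : ι → ℝ) (c : ℝ) {κ : ℝ} (hκ : 0 ≤ κ)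
    (ℓ : ZMod 4 → ℂ) :
    IsGeneratorPair p q lam M (phaseDisplacement T θ η c) (phaseFun κ ℓ)
      (phaseGen p q lam T θ η c κ ℓ) where
  measurable_displacement j := (continuous_phaseDisplacement j).measurable
  measurable_fun j := by
    unfold phaseFun
    exact (by fun_prop : Continuous fun z : ℝ × ℝ =>
      Complex.exp (z.1 * Complex.I + (κ * z.2 : ℝ)) * ℓ j).measurable
  measurable_generator j := by
    have h1 : Measurable fun z : ℝ × ℝ => Complex.exp (z.1 * Complex.I + (κ * z.2 : ℝ)) :=
      (by fun_prop : Continuous _).measurable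
    have h2 : Measurable fun z : ℝ × ℝ => (phaseVelocity T θ η c j z.2 : ℂ) :=
      Complex.measurable_ofReal.comp ((measurable_phaseVelocity j).comp measurable_snd)
    exact h1.mul ((((h2.mul_const _).add_const _).mul_const _).add_const _)
  bounded_fun := by
    refine ⟨Real.exp (κ * M) * ∑ j, ‖ℓ j‖, fun j w t ht => ?_⟩
    rw [phaseFun, norm_mul]
    exact mul_le_mul (norm_exp_phase_le hκ ht w)
      (Finset.single_le_sum (fun j _ => norm_nonneg (ℓ j)) (Finset.mem_univ j)) (norm_nonneg _)
      (Real.exp_pos _).le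
  bounded_generator := by
    obtain ⟨C, hC⟩ := exists_abs_phaseVelocity_le (T := T) (θ := θ) (η := η) (c := c)
    refine ⟨Real.exp (κ * M) * ∑ j, ((C + κ) * ‖ℓ j‖ + ‖lam * (turnMean p q ℓ j - ℓ j)‖),
      fun j w t ht => ?_⟩
    have hC0 : 0 ≤ C := (abs_nonneg _).trans (hC 0 0)
    rw [phaseGen, norm_mul]
    refine mul_le_mul (norm_exp_phase_le hκ ht w) (le_trans ?_ (Finset.single_le_sum
      (f := fun j => (C + κ) * ‖ℓ j‖ + ‖lam * (turnMean p q ℓ j - ℓ j)‖)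
      (fun j _ => by positivity) (Finset.mem_univ j))) (norm_nonneg _) (Real.exp_pos _).le
    refine (norm_add_le _ _).trans (add_le_add ?_ le_rfl)
    rw [norm_mul]
    refine mul_le_mul_of_nonneg_right ((norm_add_le _ _).trans (add_le_add ?_ ?_)) (norm_nonneg _)
    · rw [norm_mul, Complex.norm_I, mul_one, Complex.norm_real]
      exact hC j t
    · rw [Complex.norm_real, Real.norm_of_nonneg hκ]
  continuousOn_fun j w := by
    have h := continuous_phaseDisplacement (T := T) (θ := θ) (η := η) (c := c) j
    unfold phaseFun
    exact Continuous.continuousOn (by fun_prop)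
  hasDerivAt_fun := by
    refine ⟨range T, countable_range T, fun j w r hr => ?_⟩
    have hB := hasDerivAt_phaseDisplacement (θ := θ) (η := η) (c := c) j hr.2
    have hE : HasDerivAt (fun r : ℝ => Complex.exp
        (((w + phaseDisplacement T θ η c j r : ℝ) : ℂ) * Complex.I + (κ * r : ℝ)))
        (Complex.exp (((w + phaseDisplacement T θ η c j r : ℝ) : ℂ) * Complex.I + (κ * r : ℝ))
          * (phaseVelocity T θ η c j r * Complex.I + κ)) r := by
      have h1 := ((hB.const_add w).ofReal_comp.mul_const Complex.I)
      have h2 : HasDerivAt (fun r : ℝ => ((κ * r : ℝ) : ℂ)) (κ : ℂ) r := by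
        have := ((hasDerivAt_id r).const_mul κ).ofReal_comp
        simpa using this
      exact (h1.add h2).cexp
    constructor
    · unfold phaseGen
      have h1 : ContinuousAt (fun r : ℝ => (phaseVelocity T θ η c j r : ℂ)) r :=
        Complex.continuous_ofReal.continuousAt.comp (continuousAt_phaseVelocity j hr.2)
      exact hE.continuousAt.mul ((((h1.mul_const _).add_const _).mul_const _).add_const _)
    · refine HasDerivAt.congr_deriv (hE.mul_const (ℓ j)) ?_
      simp only [phaseGen, phaseFun, turnMean]
      ring

end Phase

/-! ### Convergence of the characteristic functions -/

section Increment

variable {Ω : Type*} [MeasurableSpace Ω] {P : Measure Ω}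
  {V : Type*} [NormedAddCommGroup V] [MeasurableSpace V] [BorelSpace V]
  [SecondCountableTopology V] {p q lam s t : ℝ} {J : Ω → ZMod 4} {τ : ℕ → Ω → ℝ}
  {ξ : ℕ → Ω → ZMod 4} {B : ZMod 4 → ℝ → V} {ψ g : ZMod 4 → V → ℝ → ℂ}

theorem IsTurningMotion.measurable_comp_stateAt (h : IsTurningMotion P p q lam J τ ξ)
    (hB : ∀ j, Measurable (B j)) {F : ZMod 4 → V → ℝ → ℂ}
    (hF : ∀ j, Measurable fun z : V × ℝ => F j z.1 z.2) :
    Measurable fun z : Ω × ℝ => F (stateAt B (J z.1) (fun k => (τ k z.1, ξ k z.1)) z.2).1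
      (stateAt B (J z.1) (fun k => (τ k z.1, ξ k z.1)) z.2).2 z.2 := by
  have h1 : Measurable fun z : ZMod 4 × V × ℝ => F z.1 z.2.1 z.2.2 :=
    measurable_from_prod_countable_right hF
  have h2 : Measurable fun z : Ω × ℝ =>
      stateAt B (J z.1) (fun k => (τ k z.1, ξ k z.1)) z.2 :=
    (measurable_stateAt hB).comp (((h.measurable_initial.comp measurable_fst).prodMk
      (h.measurable_steps.comp measurable_fst)).prodMk measurable_snd)
  exact h1.comp (h2.fst.prodMk (h2.snd.prodMk measurable_snd))

/-- The expectation of `ψ` changes slowly over a period in which its generator `g` is small. -/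
theorem IsGeneratorPair.norm_integral_sub_le [IsProbabilityMeasure P]
    (hs : IsGeneratorPair p q lam s B ψ g)
    (ht : IsGeneratorPair p q lam t B ψ g) (h : IsTurningMotion P p q lam J τ ξ) (hl : 0 < lam)
    (h0 : 0 ≤ s) (hst : s ≤ t) {G : ℝ} (hG : ∀ j w, ∀ r ∈ Ioc s t, ‖g j w r‖ ≤ G) :
    ‖(∫ ω, ψ (stateAt B (J ω) (fun k => (τ k ω, ξ k ω)) t).1
          (stateAt B (J ω) (fun k => (τ k ω, ξ k ω)) t).2 t ∂P)
      - ∫ ω, ψ (stateAt B (J ω) (fun k => (τ k ω, ξ k ω)) s).1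
          (stateAt B (J ω) (fun k => (τ k ω, ξ k ω)) s).2 s ∂P‖ ≤ G * (t - s) := by
  obtain ⟨C, hC⟩ := ht.bounded_fun
  obtain ⟨C', hC'⟩ := ht.bounded_generator
  have ht0 := h0.trans hst
  have hC0 : 0 ≤ C' := (norm_nonneg _).trans (hC' 0 0 t le_rfl)
  have hψm := h.measurable_comp_stateAt ht.measurable_displacement ht.measurable_fun
  have hgm := h.measurable_comp_stateAt ht.measurable_displacement ht.measurable_generator
  have hψi : ∀ r ≤ t, Integrable (fun ω => ψ (stateAt B (J ω) (fun k => (τ k ω, ξ k ω)) r).1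
      (stateAt B (J ω) (fun k => (τ k ω, ξ k ω)) r).2 r) P := fun r hr =>
    Integrable.of_bound (hψm.comp (measurable_prodMk_right (y := r))).aestronglyMeasurable C
      (ae_of_all _ fun ω => hC _ _ _ hr)
  have hgi : ∀ r ≤ t, Integrable (fun ω => ∫ r in Ioc 0 r,
      g (stateAt B (J ω) (fun k => (τ k ω, ξ k ω)) r).1
        (stateAt B (J ω) (fun k => (τ k ω, ξ k ω)) r).2 r) P := fun r hr =>
    Integrable.of_bound (hgm.stronglyMeasurable.integral_prod_right
        (ν := volume.restrict (Ioc 0 r))).aestronglyMeasurable (C' * t)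
      (ae_of_all _ fun ω => norm_setIntegral_Ioc_le hC0 le_rfl ht0 hr fun r hr => hC' _ _ _ hr)
  have e1 := hs.dynkin h hl h0
  have e2 := ht.dynkin h hl ht0
  rw [integral_sub (hψi _ hst) (hgi _ hst)] at e1
  rw [integral_sub (hψi _ le_rfl) (hgi _ le_rfl)] at e2
  have e3 : (∫ ω, ψ (stateAt B (J ω) (fun k => (τ k ω, ξ k ω)) t).1
          (stateAt B (J ω) (fun k => (τ k ω, ξ k ω)) t).2 t ∂P)
      - ∫ ω, ψ (stateAt B (J ω) (fun k => (τ k ω, ξ k ω)) s).1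
          (stateAt B (J ω) (fun k => (τ k ω, ξ k ω)) s).2 s ∂P
      = ∫ ω, ((∫ r in Ioc 0 t, g (stateAt B (J ω) (fun k => (τ k ω, ξ k ω)) r).1
          (stateAt B (J ω) (fun k => (τ k ω, ξ k ω)) r).2 r)
        - ∫ r in Ioc 0 s, g (stateAt B (J ω) (fun k => (τ k ω, ξ k ω)) r).1
          (stateAt B (J ω) (fun k => (τ k ω, ξ k ω)) r).2 r) ∂P := by
    rw [integral_sub (hgi _ le_rfl) (hgi _ hst)]
    linear_combination e2 - e1
  rw [e3]
  refine (norm_integral_le_of_norm_le_const (C := G * (t - s)) (ae_of_all _ fun ω => ?_)).trans ?_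
  · have hi := ht.integrableOn_stateAt (J ω) fun k => (τ k ω, ξ k ω)
    rw [← Ioc_union_Ioc_eq_Ioc h0 hst, setIntegral_union (Ioc_disjoint_Ioc_of_le le_rfl)
      measurableSet_Ioc (hi.mono_set (Ioc_subset_Ioc_right hst))
      (hi.mono_set (Ioc_subset_Ioc_left h0)), add_sub_cancel_left]
    refine (norm_setIntegral_le_of_norm_le_const (by simp) fun r hr => hG _ _ _ hr).trans ?_
    rw [Real.volume_real_Ioc_of_le hst]
  · simp

end Increment

section CharFun

variable {ι : Type*} [Fintype ι]

/-- The mean of the exponential of the sum, with weights `(θ i, η i)`, of the positions at the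
times `min t (T i)`. -/
def phaseMean {Ω : Type*} [MeasurableSpace Ω] (P : Measure Ω) (c : ℝ) (J : Ω → ZMod 4)
    (τ : ℕ → Ω → ℝ) (ξ : ℕ → Ω → ZMod 4) (T θ η : ι → ℝ) (t : ℝ) : ℂ :=
  ∫ ω, Complex.exp ((∑ i, (θ i * (position c J τ ξ (min t (T i)) ω).1
    + η i * (position c J τ ξ (min t (T i)) ω).2) : ℝ) * Complex.I) ∂P

/-- With the corrector as amplitude, the generator is of higher order. -/
theorem corrector_generator {p q lam c D x y : ℝ} (hl : lam ≠ 0) {a b : ZMod 4 → ℝ} {j : ZMod 4}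
    (h1 : p * a (j + 1) + q * a (j - 1) + (1 - p - q) * a (j + 2) - a j = -dirComponent x y j)
    (h2 : p * b (j + 1) + q * b (j - 1) + (1 - p - q) * b (j + 2) - b j
        = dirComponent x y j * a j - D * (x ^ 2 + y ^ 2)) {κ : ℝ}
    (hκ : κ = c ^ 2 / lam * (D * (x ^ 2 + y ^ 2))) {ℓ : ZMod 4 → ℂ}
    (hℓ : ∀ j, ℓ j = 1 + (c / lam * a j : ℝ) * Complex.I + ((c / lam) ^ 2 * b j : ℝ)) :
    ((c * dirComponent x y j : ℝ) * Complex.I + κ) * ℓ j + lam * (turnMean p q ℓ j - ℓ j)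
      = (κ * (c / lam) * a j + c * (c / lam) ^ 2 * (dirComponent x y j * b j) : ℝ) * Complex.I
        + (κ * (c / lam) ^ 2 * b j : ℝ) := by
  have e1 : turnMean p q ℓ j - ℓ j
      = (c / lam * (p * a (j + 1) + q * a (j - 1) + (1 - p - q) * a (j + 2) - a j) : ℝ) * Complex.I
        + ((c / lam) ^ 2
          * (p * b (j + 1) + q * b (j - 1) + (1 - p - q) * b (j + 2) - b j) : ℝ) := by
    simp only [turnMean, hℓ]
    push_cast
    ring
  rw [e1, h1, h2, hℓ, hκ]
  have hl' : (lam : ℂ) ≠ 0 := Complex.ofReal_ne_zero.2 hl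
  push_cast
  field_simp
  ring_nf
  simp only [Complex.I_sq]
  ring

theorem norm_mul_I_add_le (u v : ℝ) : ‖(u : ℂ) * Complex.I + (v : ℂ)‖ ≤ |u| + |v| := by
  refine (norm_add_le _ _).trans (le_of_eq ?_)
  rw [norm_mul, Complex.norm_I, mul_one, Complex.norm_real, Complex.norm_real, Real.norm_eq_abs,
    Real.norm_eq_abs]

variable {Ω : Type*} [MeasurableSpace Ω] {P : Measure Ω} [IsProbabilityMeasure P]
  {p q lam c : ℝ} {J : Ω → ZMod 4} {τ : ℕ → Ω → ℝ} {ξ : ℕ → Ω → ZMod 4} {T θ η : ι → ℝ}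

/-- Between consecutive times `T i`, the phase mean decays approximately at the rate `κ`. -/
theorem IsTurningMotion.norm_phaseMean_sub_le (h : IsTurningMotion P p q lam J τ ξ) (hl : 0 < lam)
    (hc : 0 < c) (hT : ∀ i, 0 ≤ T i) {s t : ℝ} (h0 : 0 ≤ s) (hst : s ≤ t)
    (hfree : ∀ i, T i ≤ s ∨ t ≤ T i) {D x y C κ : ℝ} (hD : 0 ≤ D)
    (hx : x = ∑ i, if t ≤ T i then θ i else 0) (hy : y = ∑ i, if t ≤ T i then η i else 0)
    {a b : ZMod 4 → ℝ}
    (hab : ∀ j, p * a (j + 1) + q * a (j - 1) + (1 - p - q) * a (j + 2) - a j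
        = -dirComponent x y j ∧
      p * b (j + 1) + q * b (j - 1) + (1 - p - q) * b (j + 2) - b j
        = dirComponent x y j * a j - D * (x ^ 2 + y ^ 2))
    (hC : ∀ j, |a j| ≤ C ∧ |b j| ≤ C ∧ |dirComponent x y j| ≤ C)
    (hκ : κ = c ^ 2 / lam * (D * (x ^ 2 + y ^ 2))) :
    ‖phaseMean P c J τ ξ T θ η t
        - Complex.exp ((-(κ * (t - s)) : ℝ)) * phaseMean P c J τ ξ T θ η s‖
      ≤ 2 * (c / lam * C + (c / lam) ^ 2 * C)
        + (κ * (c / lam) * C + c * (c / lam) ^ 2 * (C * C) + κ * (c / lam) ^ 2 * C) * (t - s) := by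
  have ht0 := h0.trans hst
  have hκ0 : 0 ≤ κ := by rw [hκ]; positivity
  have hC0 : 0 ≤ C := (abs_nonneg _).trans (hC 0).1
  set ε := c / lam with hε
  have hε0 : 0 < ε := div_pos hc hl
  set ℓ : ZMod 4 → ℂ := fun j => 1 + (ε * a j : ℝ) * Complex.I + (ε ^ 2 * b j : ℝ) with hℓ
  set δ := ε * C + ε ^ 2 * C with hδ
  set γ := κ * ε * C + c * ε ^ 2 * (C * C) + κ * ε ^ 2 * C with hγ
  have hℓ1 : ∀ j, ‖ℓ j - 1‖ ≤ δ := fun j => by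
    have e : ℓ j - 1 = (ε * a j : ℝ) * Complex.I + (ε ^ 2 * b j : ℝ) := by
      simp only [hℓ]; ring
    rw [e]
    refine (norm_mul_I_add_le _ _).trans ?_
    rw [abs_mul, abs_mul, abs_of_pos hε0, abs_of_pos (pow_pos hε0 2)]
    have h1 := (hC j).1
    have h2 := (hC j).2.1
    exact add_le_add (mul_le_mul_of_nonneg_left h1 hε0.le)
      (mul_le_mul_of_nonneg_left h2 (pow_pos hε0 2).le)
  set B := phaseDisplacement T θ η c with hB
  have hp := fun M => isGeneratorPair_phaseFun p q lam M T θ η c hκ0 ℓ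
  have hgood := h.ae_nonexplosive hl
  -- the generator is small on the interval
  have hvel : ∀ j, ∀ r ∈ Ioc s t, phaseVelocity T θ η c j r = c * dirComponent x y j := by
    intro j r hr
    have e : ∀ i, (r ≤ T i) = (t ≤ T i) := fun i => propext
      ⟨fun hi => (hfree i).resolve_left (not_le.2 (hr.1.trans_le hi)), hr.2.trans⟩
    simp only [phaseVelocity, e, hx, hy, dirComponent, Finset.sum_mul, Finset.mul_sum,
      ← Finset.sum_add_distrib]
    refine Finset.sum_congr rfl fun i _ => ?_
    split_ifs
    · rfl
    · ring
  have hgen : ∀ j (w : ℝ), ∀ r ∈ Ioc s t,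
      ‖phaseGen p q lam T θ η c κ ℓ j w r‖ ≤ Real.exp (κ * t) * γ := by
    intro j w r hr
    rw [phaseGen, norm_mul, hvel j r hr,
      corrector_generator hl.ne' (hab j).1 (hab j).2 hκ fun _ => rfl]
    refine mul_le_mul (norm_exp_phase_le hκ0 hr.2 w) ((norm_mul_I_add_le _ _).trans ?_)
      (norm_nonneg _) (Real.exp_pos _).le
    obtain ⟨h1, h2, h3⟩ := hC j
    refine add_le_add ((abs_add_le _ _).trans (add_le_add ?_ ?_)) ?_
    · rw [abs_mul, abs_of_nonneg (by positivity : 0 ≤ κ * ε)]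
      gcongr
    · rw [abs_mul, abs_of_nonneg (by positivity : 0 ≤ c * ε ^ 2), abs_mul]
      gcongr
    · rw [abs_mul, abs_of_nonneg (by positivity : 0 ≤ κ * ε ^ 2)]
      gcongr
  have hmain := (hp s).norm_integral_sub_le (hp t) h hl h0 hst hgen
  -- the amplitude is close to one
  have hclose : ∀ r, 0 ≤ r → r ≤ t →
      ‖(∫ ω, phaseFun κ ℓ (stateAt B (J ω) (fun k => (τ k ω, ξ k ω)) r).1
          (stateAt B (J ω) (fun k => (τ k ω, ξ k ω)) r).2 r ∂P)
        - Complex.exp ((κ * r : ℝ)) * phaseMean P c J τ ξ T θ η r‖ ≤ Real.exp (κ * t) * δ := by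
    intro r hr0 hrt
    have e1 : Complex.exp ((κ * r : ℝ)) * phaseMean P c J τ ξ T θ η r
        = ∫ ω, phaseFun κ (fun _ => 1) (stateAt B (J ω) (fun k => (τ k ω, ξ k ω)) r).1
          (stateAt B (J ω) (fun k => (τ k ω, ξ k ω)) r).2 r ∂P := by
      rw [phaseMean, ← integral_const_mul]
      refine integral_congr_ae ?_
      filter_upwards [hgood] with ω hω
      rw [phaseFun, mul_one, hB, stateAt_phaseDisplacement hω hT hr0, ← Complex.exp_add, add_comm]
    have hint : ∀ ℓ' : ZMod 4 → ℂ, Integrable (fun ω =>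
        phaseFun κ ℓ' (stateAt B (J ω) (fun k => (τ k ω, ξ k ω)) r).1
          (stateAt B (J ω) (fun k => (τ k ω, ξ k ω)) r).2 r) P := by
      intro ℓ'
      have hp' := isGeneratorPair_phaseFun p q lam r T θ η c hκ0 ℓ'
      obtain ⟨C', hC'⟩ := hp'.bounded_fun
      exact Integrable.of_bound ((h.measurable_comp_stateAt hp'.measurable_displacement
        hp'.measurable_fun).comp (measurable_prodMk_right (y := r))).aestronglyMeasurable C'
        (ae_of_all _ fun ω => hC' _ _ _ le_rfl)
    rw [e1, ← integral_sub (hint _) (hint _)]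
    refine (norm_integral_le_of_norm_le_const (C := Real.exp (κ * t) * δ)
      (ae_of_all _ fun ω => ?_)).trans (by simp)
    rw [phaseFun, phaseFun, ← mul_sub, norm_mul]
    exact mul_le_mul (norm_exp_phase_le hκ0 hrt _) (hℓ1 _) (norm_nonneg _) (Real.exp_pos _).le
  have hfinal : ‖Complex.exp ((κ * t : ℝ)) * phaseMean P c J τ ξ T θ η t
      - Complex.exp ((κ * s : ℝ)) * phaseMean P c J τ ξ T θ η s‖
      ≤ Real.exp (κ * t) * (2 * δ + γ * (t - s)) := by
    have n1 := hclose t ht0 le_rfl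
    have n2 := hclose s h0 hst
    rw [norm_sub_rev] at n1
    refine (norm_sub_le_norm_sub_add_norm_sub _ _ _).trans
      ((add_le_add n1 ((norm_sub_le_norm_sub_add_norm_sub _ _ _).trans
        (add_le_add hmain n2))).trans (le_of_eq ?_))
    ring
  have e : phaseMean P c J τ ξ T θ η t
        - Complex.exp ((-(κ * (t - s)) : ℝ)) * phaseMean P c J τ ξ T θ η s
      = Complex.exp ((-(κ * t) : ℝ)) * (Complex.exp ((κ * t : ℝ)) * phaseMean P c J τ ξ T θ η t
      - Complex.exp ((κ * s : ℝ)) * phaseMean P c J τ ξ T θ η s) := by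
    have e1 : Complex.exp ((-(κ * t) : ℝ)) * Complex.exp ((κ * t : ℝ)) = 1 := by
      rw [← Complex.exp_add, ← Complex.ofReal_add, neg_add_cancel, Complex.ofReal_zero,
        Complex.exp_zero]
    have e2 : Complex.exp ((-(κ * t) : ℝ)) * Complex.exp ((κ * s : ℝ))
        = Complex.exp ((-(κ * (t - s)) : ℝ)) := by
      rw [← Complex.exp_add, ← Complex.ofReal_add]
      congr 2
      ring
    linear_combination (-phaseMean P c J τ ξ T θ η t) * e1 + phaseMean P c J τ ξ T θ η s * e2
  rw [e, norm_mul, Complex.norm_exp_ofReal]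
  calc _ ≤ Real.exp (-(κ * t)) * (Real.exp (κ * t) * (2 * δ + γ * (t - s))) := by gcongr
    _ = _ := by rw [← mul_assoc, ← Real.exp_add, neg_add_cancel, Real.exp_zero, one_mul]

end CharFun

section Limit

variable {ι : Type*} [Fintype ι] {T θ η : ι → ℝ}

/-- The variance, up to the factor `2 D`, of the weighted sum of the positions of a planar Brownian
motion at the times `min t (T i)`. -/
def phaseVariance (T θ η : ι → ℝ) (t : ℝ) : ℝ :=
  ∑ i, ∑ j, (θ i * θ j + η i * η j) * min t (min (T i) (T j))

theorem phaseVariance_zero (hT : ∀ i, 0 ≤ T i) : phaseVariance T θ η 0 = 0 :=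
  Finset.sum_eq_zero fun i _ => Finset.sum_eq_zero fun j _ => by
    rw [min_eq_left (le_min (hT i) (hT j)), mul_zero]

theorem phaseVariance_sub {s t : ℝ} (hst : s ≤ t) (hfree : ∀ i, T i ≤ s ∨ t ≤ T i) :
    phaseVariance T θ η t = phaseVariance T θ η s
      + ((∑ i, if t ≤ T i then θ i else 0) ^ 2 + (∑ i, if t ≤ T i then η i else 0) ^ 2)
        * (t - s) := by
  rw [sq, sq, Finset.sum_mul_sum, Finset.sum_mul_sum]
  simp only [phaseVariance, ← Finset.sum_add_distrib, Finset.sum_mul]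
  refine Finset.sum_congr rfl fun i _ => Finset.sum_congr rfl fun j _ => ?_
  by_cases hi : t ≤ T i
  · by_cases hj : t ≤ T j
    · rw [if_pos hi, if_pos hj, if_pos hi, if_pos hj, min_eq_left (le_min hi hj),
        min_eq_left (hst.trans (le_min hi hj))]
      ring
    · have h := (min_le_right (T i) (T j)).trans ((hfree j).resolve_right hj)
      rw [if_neg hj, if_neg hj, min_eq_right h, min_eq_right (h.trans hst)]
      ring
  · have h := (min_le_left (T i) (T j)).trans ((hfree i).resolve_right hi)
    rw [if_neg hi, if_neg hi, min_eq_right h, min_eq_right (h.trans hst)]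
    ring

/-- The last of the times `0` and `T i` before time `t`. -/
theorem exists_previous_time (hT : ∀ i, 0 ≤ T i) {t : ℝ} (ht : 0 < t) :
    ∃ s, 0 ≤ s ∧ s < t ∧ (∀ i, T i ≤ s ∨ t ≤ T i) ∧ (s = 0 ∨ ∃ i, T i = s) := by
  classical
  by_cases hne : (Finset.univ.filter fun i => T i < t).Nonempty
  · obtain ⟨k, hk, hmax⟩ := Finset.exists_max_image _ T hne
    refine ⟨T k, hT k, (Finset.mem_filter.1 hk).2, fun i => ?_, .inr ⟨k, rfl⟩⟩
    by_cases hi : T i < t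
    · exact .inl (hmax i (Finset.mem_filter.2 ⟨Finset.mem_univ i, hi⟩))
    · exact .inr (not_lt.1 hi)
  · refine ⟨0, le_rfl, ht, fun i => .inr ?_, .inl rfl⟩
    by_contra hi
    exact hne ⟨i, Finset.mem_filter.2 ⟨Finset.mem_univ i, not_le.1 hi⟩⟩

variable {p q : ℝ} {lam c : ℕ → ℝ} {Ω : ℕ → Type*} [∀ n, MeasurableSpace (Ω n)]
  {P : ∀ n, Measure (Ω n)} [∀ n, IsProbabilityMeasure (P n)] {J : ∀ n, Ω n → ZMod 4}
  {τ : ∀ n, ℕ → Ω n → ℝ} {ξ : ∀ n, ℕ → Ω n → ZMod 4}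

theorem diffusionCoeff_nonneg (hpq : p + q ≤ 1) : 0 ≤ diffusionCoeff p q := by
  have h := sq_add_sq_pos_of_add_le_one hpq
  have h1 : 0 ≤ (1 - p) + (1 - q) := by linarith
  rw [diffusionCoeff]
  positivity

/-- The propagation of the convergence from a time `s` to a time `t`, when none of the times `T i`
lies strictly between. -/
theorem tendsto_phaseMean_step (hpq : p + q ≤ 1) (hpq0 : 0 < p + q)
    (hlam_pos : ∀ n, 0 < lam n) (hc_pos : ∀ n, 0 < c n) (hc : Tendsto c atTop atTop)
    (hratio : Tendsto (fun n => c n ^ 2 / lam n) atTop (𝓝 1))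
    (hmotion : ∀ n, IsTurningMotion (P n) p q (lam n) (J n) (τ n) (ξ n)) (hT : ∀ i, 0 ≤ T i)
    {s t : ℝ} (h0 : 0 ≤ s) (hst : s ≤ t) (hfree : ∀ i, T i ≤ s ∨ t ≤ T i)
    (hs : Tendsto (fun n => phaseMean (P n) (c n) (J n) (τ n) (ξ n) T θ η s) atTop
      (𝓝 (Complex.exp ((-(diffusionCoeff p q * phaseVariance T θ η s) : ℝ))))) :
    Tendsto (fun n => phaseMean (P n) (c n) (J n) (τ n) (ξ n) T θ η t) atTop
      (𝓝 (Complex.exp ((-(diffusionCoeff p q * phaseVariance T θ η t) : ℝ)))) := by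
  set D := diffusionCoeff p q with hD
  have hD0 : 0 ≤ D := diffusionCoeff_nonneg hpq
  set x := ∑ i, if t ≤ T i then θ i else 0 with hx
  set y := ∑ i, if t ≤ T i then η i else 0 with hy
  obtain ⟨a, b, hab⟩ := exists_corrector hpq hpq0 x y
  obtain ⟨C, hC⟩ : ∃ C, ∀ j, |a j| ≤ C ∧ |b j| ≤ C ∧ |dirComponent x y j| ≤ C := by
    refine ⟨∑ j, (|a j| + |b j| + |dirComponent x y j|), fun j => ?_⟩
    have h := Finset.single_le_sum (f := fun j => |a j| + |b j| + |dirComponent x y j|)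
      (fun j _ => by positivity) (Finset.mem_univ j)
    have h1 := abs_nonneg (a j)
    have h2 := abs_nonneg (b j)
    have h3 := abs_nonneg (dirComponent x y j)
    refine ⟨?_, ?_, ?_⟩ <;> linarith
  set κ : ℕ → ℝ := fun n => c n ^ 2 / lam n * (D * (x ^ 2 + y ^ 2)) with hκ
  have hκlim : Tendsto κ atTop (𝓝 (D * (x ^ 2 + y ^ 2))) := by
    simpa using hratio.mul_const (D * (x ^ 2 + y ^ 2))
  have hinv : Tendsto (fun n => (c n)⁻¹) atTop (𝓝 0) := tendsto_inv_atTop_zero.comp hc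
  have hε : Tendsto (fun n => c n / lam n) atTop (𝓝 0) := by
    have h := hratio.mul hinv
    rw [mul_zero] at h
    refine h.congr fun n => ?_
    have := (hc_pos n).ne'
    field_simp
  have hcε : Tendsto (fun n => c n * (c n / lam n) ^ 2) atTop (𝓝 0) := by
    have h := (hratio.pow 2).mul hinv
    rw [mul_zero] at h
    refine h.congr fun n => ?_
    have := (hc_pos n).ne'
    field_simp
  have herr : Tendsto (fun n => 2 * (c n / lam n * C + (c n / lam n) ^ 2 * C)
        + (κ n * (c n / lam n) * C + c n * (c n / lam n) ^ 2 * (C * C)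
          + κ n * (c n / lam n) ^ 2 * C) * (t - s)) atTop (𝓝 0) := by
    have h := (((hε.mul_const C).add ((hε.pow 2).mul_const C)).const_mul 2).add
      (((((hκlim.mul hε).mul_const C).add (hcε.mul_const (C * C))).add
        ((hκlim.mul (hε.pow 2)).mul_const C)).mul_const (t - s))
    simpa using h
  have hdiff : Tendsto (fun n => phaseMean (P n) (c n) (J n) (τ n) (ξ n) T θ η t
      - Complex.exp ((-(κ n * (t - s)) : ℝ)) * phaseMean (P n) (c n) (J n) (τ n) (ξ n) T θ η s)
      atTop (𝓝 0) :=
    squeeze_zero_norm (fun n => (hmotion n).norm_phaseMean_sub_le (hlam_pos n) (hc_pos n) hT h0 hst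
      hfree hD0 hx hy hab hC rfl) herr
  have hexp : Tendsto (fun n => Complex.exp ((-(κ n * (t - s)) : ℝ))) atTop
      (𝓝 (Complex.exp ((-(D * (x ^ 2 + y ^ 2) * (t - s)) : ℝ)))) :=
    (Complex.continuous_exp.tendsto _).comp
      ((Complex.continuous_ofReal.tendsto _).comp (hκlim.mul_const (t - s)).neg)
  have h := hdiff.add (hexp.mul hs)
  simp only [sub_add_cancel, zero_add, ← Complex.exp_add, ← Complex.ofReal_add] at h
  rw [phaseVariance_sub hst hfree]
  convert h using 4
  ring

theorem tendsto_phaseMean (hpq : p + q ≤ 1) (hpq0 : 0 < p + q)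
    (hlam_pos : ∀ n, 0 < lam n) (hc_pos : ∀ n, 0 < c n) (hc : Tendsto c atTop atTop)
    (hratio : Tendsto (fun n => c n ^ 2 / lam n) atTop (𝓝 1))
    (hmotion : ∀ n, IsTurningMotion (P n) p q (lam n) (J n) (τ n) (ξ n)) (hT : ∀ i, 0 ≤ T i)
    {t : ℝ} (ht : 0 ≤ t) :
    Tendsto (fun n => phaseMean (P n) (c n) (J n) (τ n) (ξ n) T θ η t) atTop
      (𝓝 (Complex.exp ((-(diffusionCoeff p q * phaseVariance T θ η t) : ℝ)))) := by
  classical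
  have hzero : Tendsto (fun n => phaseMean (P n) (c n) (J n) (τ n) (ξ n) T θ η 0) atTop
      (𝓝 (Complex.exp ((-(diffusionCoeff p q * phaseVariance T θ η 0) : ℝ)))) := by
    simp [phaseVariance_zero hT, phaseMean, min_eq_left (hT _), position]
  induction hk : (Finset.univ.filter fun i => T i < t).card using Nat.strong_induction_on
    generalizing t with
  | _ k ih =>
    rcases ht.eq_or_lt with rfl | ht'
    · exact hzero
    obtain ⟨s, h0, hst, hfree, hs⟩ := exists_previous_time hT ht'
    refine tendsto_phaseMean_step hpq hpq0 hlam_pos hc_pos hc hratio hmotion hT h0 hst.le hfree ?_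
    rcases hs with rfl | ⟨i, rfl⟩
    · exact hzero
    · refine ih _ ?_ h0 rfl
      rw [← hk]
      refine Finset.card_lt_card (Finset.ssubset_iff_of_subset ?_ |>.2 ⟨i, ?_, ?_⟩)
      · exact Finset.monotone_filter_right _ fun j _ hj => lt_trans hj hst
      · simpa using hst
      · simp

end Limit

/-! ### Convergence of the finite-dimensional distributions -/

section Law

open scoped RealInnerProductSpace Matrix

theorem integral_exp_projectiveFamily (I : Finset ℝ≥0) (w : I → ℝ) :
    ∫ x, Complex.exp ((∑ i, w i * x i : ℝ) * Complex.I) ∂(BrownianReal.projectiveFamily I)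
      = Complex.exp ((-((∑ i, ∑ j, w i * w j * min ((i : ℝ≥0) : ℝ) (j : ℝ≥0)) / 2) : ℝ)) := by
  rw [BrownianReal.integral_projectiveFamily]
  have h := charFun_multivariateGaussian (μ := (0 : EuclideanSpace ℝ I))
    (BrownianReal.posSemidef_covMatrix I) (WithLp.toLp 2 w)
  rw [charFun_apply] at h
  simp only [PiLp.inner_apply, inner_zero_right, Complex.ofReal_zero, zero_mul, zero_sub,
    dotProduct, Matrix.mulVec, BrownianReal.covMatrix_apply] at h
  have e : (fun x : EuclideanSpace ℝ I => Complex.exp ((∑ i, w i * x i : ℝ) * Complex.I))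
      = fun x : EuclideanSpace ℝ I =>
        Complex.exp ((∑ i, inner ℝ (x i) (w i) : ℝ) * Complex.I) := by
    simp
  rw [e]
  refine h.trans ?_
  congr 1
  simp only [Finset.mul_sum]
  push_cast
  congr 2
  refine Finset.sum_congr rfl fun i _ => Finset.sum_congr rfl fun j _ => ?_
  ring

end Law

section FiniteDimensional

variable {I : Finset ℝ≥0}

/-- The coordinates of a finite family of points of the plane as a vector of a Euclidean space. -/
def planarToEuclidean (z : I → ℝ × ℝ) : EuclideanSpace ℝ (I ⊕ I) :=
  WithLp.toLp 2 (Sum.elim (fun i => (z i).1) fun i => (z i).2)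

theorem continuous_planarToEuclidean : Continuous (planarToEuclidean (I := I)) := by
  refine (PiLp.continuous_toLp 2 _).comp (continuous_pi fun k => ?_)
  rcases k with i | i
  · exact (continuous_apply i).fst
  · exact (continuous_apply i).snd

/-- The inverse of `planarToEuclidean`. -/
def euclideanToPlanar (x : EuclideanSpace ℝ (I ⊕ I)) (i : I) : ℝ × ℝ := (x (.inl i), x (.inr i))

theorem continuous_euclideanToPlanar : Continuous (euclideanToPlanar (I := I)) := by
  unfold euclideanToPlanar
  fun_prop

theorem charFun_map_planarToEuclidean {Ω : Type*} [MeasurableSpace Ω] {μ : Measure Ω}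
    {Z : Ω → I → ℝ × ℝ} (hZ : AEMeasurable Z μ) (ζ : EuclideanSpace ℝ (I ⊕ I)) :
    charFun (μ.map (planarToEuclidean ∘ Z)) ζ = ∫ ω, Complex.exp ((∑ i, (ζ (.inl i) * (Z ω i).1
      + ζ (.inr i) * (Z ω i).2) : ℝ) * Complex.I) ∂μ := by
  rw [charFun_apply, integral_map (continuous_planarToEuclidean.measurable.comp_aemeasurable hZ)
    (Continuous.aestronglyMeasurable (by fun_prop))]
  refine integral_congr_ae (ae_of_all _ fun ω => ?_)
  simp [PiLp.inner_apply, planarToEuclidean, Fintype.sum_sum_type, Finset.sum_add_distrib]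

theorem charFun_planarBrownian {D : ℝ} (hD : 0 ≤ D) (ζ : EuclideanSpace ℝ (I ⊕ I)) {t : ℝ}
    (ht : ∀ i : I, ((i : ℝ≥0) : ℝ) ≤ t) :
    charFun (((BrownianReal.projectiveFamily I).prod (BrownianReal.projectiveFamily I)).map
        (planarToEuclidean ∘ fun (b : (I → ℝ) × (I → ℝ)) (i : I) =>
          (Real.sqrt (2 * D) * b.1 i, Real.sqrt (2 * D) * b.2 i))) ζ
      = Complex.exp ((-(D * phaseVariance (fun i : I => ((i : ℝ≥0) : ℝ)) (fun i => ζ (.inl i))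
          (fun i => ζ (.inr i)) t) : ℝ)) := by
  rw [charFun_map_planarToEuclidean (by fun_prop)]
  have hs : Real.sqrt (2 * D) ^ 2 = 2 * D := Real.sq_sqrt (by positivity)
  set σ := Real.sqrt (2 * D) with hσ
  have e : ∀ b : (I → ℝ) × (I → ℝ), Complex.exp ((∑ i, (ζ (.inl i) * (σ * b.1 i)
      + ζ (.inr i) * (σ * b.2 i)) : ℝ) * Complex.I)
      = Complex.exp ((∑ i, (σ * ζ (.inl i)) * b.1 i : ℝ) * Complex.I)
        * Complex.exp ((∑ i, (σ * ζ (.inr i)) * b.2 i : ℝ) * Complex.I) := by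
    intro b
    rw [← Complex.exp_add, ← add_mul, ← Complex.ofReal_add, ← Finset.sum_add_distrib]
    congr 4
    funext i
    ring
  simp only [e]
  rw [integral_prod_mul (fun x : I → ℝ =>
      Complex.exp ((∑ i, (σ * ζ (.inl i)) * x i : ℝ) * Complex.I))
    fun x : I → ℝ => Complex.exp ((∑ i, (σ * ζ (.inr i)) * x i : ℝ) * Complex.I),
    integral_exp_projectiveFamily, integral_exp_projectiveFamily, ← Complex.exp_add,
    ← Complex.ofReal_add]
  congr 2
  rw [phaseVariance, Finset.mul_sum, ← neg_add, ← add_div, ← Finset.sum_add_distrib,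
    Finset.sum_div]
  congr 1
  refine Finset.sum_congr rfl fun i _ => ?_
  rw [← Finset.sum_add_distrib, Finset.sum_div, Finset.mul_sum]
  refine Finset.sum_congr rfl fun j _ => ?_
  rw [min_eq_right ((min_le_left _ _).trans (ht i))]
  linear_combination (ζ (.inl i) * ζ (.inl j) + ζ (.inr i) * ζ (.inr j))
    * min ((i : ℝ≥0) : ℝ) (j : ℝ≥0) / 2 * hs

variable {p q : ℝ} {lam c : ℕ → ℝ} {Ω : ℕ → Type*} [∀ n, MeasurableSpace (Ω n)]
  {P : ∀ n, Measure (Ω n)} [∀ n, IsProbabilityMeasure (P n)] {J : ∀ n, Ω n → ZMod 4}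
  {τ : ∀ n, ℕ → Ω n → ℝ} {ξ : ∀ n, ℕ → Ω n → ZMod 4}

theorem tendstoInDistribution_position (hpq : p + q ≤ 1) (hpq0 : 0 < p + q)
    (hlam_pos : ∀ n, 0 < lam n) (hc_pos : ∀ n, 0 < c n) (hc : Tendsto c atTop atTop)
    (hratio : Tendsto (fun n => c n ^ 2 / lam n) atTop (𝓝 1))
    (hmotion : ∀ n, IsTurningMotion (P n) p q (lam n) (J n) (τ n) (ξ n)) (I : Finset ℝ≥0) :
    TendstoInDistribution
      (fun n ω (i : I) => position (c n) (J n) (τ n) (ξ n) ((i : ℝ≥0) : ℝ) ω) atTop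
      (fun (b : (I → ℝ) × (I → ℝ)) (i : I) =>
        (Real.sqrt (2 * diffusionCoeff p q) * b.1 i, Real.sqrt (2 * diffusionCoeff p q) * b.2 i))
      P ((BrownianReal.projectiveFamily I).prod (BrownianReal.projectiveFamily I)) := by
  have hX : ∀ n, AEMeasurable
      (fun ω (i : I) => position (c n) (J n) (τ n) (ξ n) ((i : ℝ≥0) : ℝ) ω) (P n) := fun n =>
    aemeasurable_pi_lambda _ fun i =>
      (hmotion n).aemeasurable_position (hlam_pos n) (c n) (i : ℝ≥0).2
  have hZ : AEMeasurable (fun (b : (I → ℝ) × (I → ℝ)) (i : I) =>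
        (Real.sqrt (2 * diffusionCoeff p q) * b.1 i, Real.sqrt (2 * diffusionCoeff p q) * b.2 i))
      ((BrownianReal.projectiveFamily I).prod (BrownianReal.projectiveFamily I)) := by fun_prop
  have hE : TendstoInDistribution
      (fun n => planarToEuclidean ∘ fun ω (i : I) =>
        position (c n) (J n) (τ n) (ξ n) ((i : ℝ≥0) : ℝ) ω) atTop
      (planarToEuclidean ∘ fun (b : (I → ℝ) × (I → ℝ)) (i : I) =>
        (Real.sqrt (2 * diffusionCoeff p q) * b.1 i, Real.sqrt (2 * diffusionCoeff p q) * b.2 i))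
      P ((BrownianReal.projectiveFamily I).prod (BrownianReal.projectiveFamily I)) := by
    refine ⟨fun n => continuous_planarToEuclidean.measurable.comp_aemeasurable (hX n),
      continuous_planarToEuclidean.measurable.comp_aemeasurable hZ, ?_⟩
    refine ProbabilityMeasure.tendsto_iff_tendsto_charFun.2 fun ζ => ?_
    have hT : ∀ i : I, (0 : ℝ) ≤ ((i : ℝ≥0) : ℝ) := fun i => (i : ℝ≥0).2
    have ht : ∀ i : I, ((i : ℝ≥0) : ℝ) ≤ ∑ j : I, ((j : ℝ≥0) : ℝ) := fun i =>
      Finset.single_le_sum (f := fun j : I => ((j : ℝ≥0) : ℝ)) (fun j _ => hT j)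
        (Finset.mem_univ i)
    have h := tendsto_phaseMean (θ := fun i : I => ζ (.inl i)) (η := fun i : I => ζ (.inr i))
      hpq hpq0 hlam_pos hc_pos hc hratio hmotion hT
      (Finset.sum_nonneg (s := Finset.univ) fun j _ => hT j)
    rw [← charFun_planarBrownian (diffusionCoeff_nonneg hpq) ζ ht] at h
    refine h.congr fun n => ?_
    refine Eq.trans ?_ (charFun_map_planarToEuclidean (hX n) ζ).symm
    simp only [phaseMean, min_eq_right (ht _)]
  exact hE.continuous_comp continuous_euclideanToPlanar

end FiniteDimensional

end

theorem mainTheorem1 (p q : ℝ) (hp : 0 ≤ p) (hq : 0 ≤ q) (hpq : p + q ≤ 1) (hpq0 : 0 < p + q)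
    (lam c : ℕ → ℝ) (hlam_pos : ∀ n, 0 < lam n) (hc_pos : ∀ n, 0 < c n)
    (hlam : Tendsto lam atTop atTop) (hc : Tendsto c atTop atTop)
    (hratio : Tendsto (fun n => c n ^ 2 / lam n) atTop (𝓝 1))
    {Ω : ℕ → Type*} [∀ n, MeasurableSpace (Ω n)] (P : ∀ n, Measure (Ω n))
    [∀ n, IsProbabilityMeasure (P n)] (J : ∀ n, Ω n → ZMod 4) (τ : ∀ n, ℕ → Ω n → ℝ)
    (ξ : ∀ n, ℕ → Ω n → ZMod 4)
    (hmotion : ∀ n, IsTurningMotion (P n) p q (lam n) (J n) (τ n) (ξ n)) :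
    -- the interior density of the motion satisfies the fourth-order equation
    (∀ n (u : ℝ × ℝ × ℝ → ℝ),
      IsInteriorDensity (P n) p q (c n) (position (c n) (J n) (τ n) (ξ n)) u →
      IsWeakSolution (motionOpTranspose p q (lam n) (c n)) (interiorRegion p q (c n)) u) ∧
    -- divided by `lam ^ 3`, the fourth-order operator converges to a positive multiple
    -- of the heat operator
    0 < 4 * (p + q) * ((1 - p) ^ 2 + (1 - q) ^ 2) ∧
    (∀ (U : Set (ℝ × ℝ × ℝ)) (u : ℝ × ℝ × ℝ → ℝ), IsOpen U → ContDiffOn ℝ 4 u U →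
      TendstoLocallyUniformlyOn (fun n z => motionOp p q (lam n) (c n) u z / lam n ^ 3)
        (fun z => 4 * (p + q) * ((1 - p) ^ 2 + (1 - q) ^ 2) * heatOp (diffusionCoeff p q) u z)
        atTop U) ∧
    -- limits of solutions of the fourth-order equations solve the heat equation
    (∀ (U : Set (ℝ × ℝ × ℝ)) (v : ℕ → ℝ × ℝ × ℝ → ℝ) (u : ℝ × ℝ × ℝ → ℝ), IsOpen U →
      (∀ n, IsWeakSolution (motionOpTranspose p q (lam n) (c n)) U (v n)) →
      LocallyIntegrableOn u U →
      (∀ φ, IsTestFunction U φ →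
        Tendsto (fun n => ∫ z, v n z * φ z) atTop (𝓝 (∫ z, u z * φ z))) →
      IsWeakSolution (heatOpTranspose (diffusionCoeff p q)) U u) ∧
    -- the finite-dimensional distributions of the motion converge to those of a planar
    -- Brownian motion with independent components of variance `2 D t`
    (∀ I : Finset ℝ≥0,
      TendstoInDistribution
        (fun n ω (i : I) => position (c n) (J n) (τ n) (ξ n) ((i : ℝ≥0) : ℝ) ω) atTop
        (fun (b : (I → ℝ) × (I → ℝ)) (i : I) =>
          (Real.sqrt (2 * diffusionCoeff p q) * b.1 i, Real.sqrt (2 * diffusionCoeff p q) * b.2 i))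
        P ((BrownianReal.projectiveFamily I).prod (BrownianReal.projectiveFamily I))) ∧
    -- the diffusion coefficient is maximal exactly at `p = q = 1 / 2`
    (diffusionCoeff p q ≤ diffusionCoeff (1 / 2) (1 / 2) ∧
      (diffusionCoeff p q = diffusionCoeff (1 / 2) (1 / 2) ↔ p = 1 / 2 ∧ q = 1 / 2)) :=
  ⟨fun n _ hu => hu.isWeakSolution (hmotion n) (hlam_pos n) (hc_pos n),
    mul_pos (by positivity) (sq_add_sq_pos_of_add_le_one hpq),
    fun _ _ hU hu => tendstoLocallyUniformlyOn_motionOp hpq hlam_pos hlam hratio hU hu,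
    fun _ _ _ _ hv hu hlim =>
      isWeakSolution_heatOpTranspose hpq hpq0 hlam_pos hlam hratio hv hu hlim,
    tendstoInDistribution_position hpq hpq0 hlam_pos hc_pos hc hratio hmotion,
    diffusionCoeff_le_half hpq, diffusionCoeff_eq_half_iff hpq⟩
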